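/- A \emph{vertical plane} $(\mathcal P,\pi)$ is an oriented topological space $\mathcal P$ homeomorphic to $\mathbb R^2$ with a locally trivial topological fibration $\pi:\mathcal P\to\mathbb R$; its \emph{vertical lines} are the fibers of $\pi$. Write $(\mathbb R^2,x)$ for the canonical one. A \emph{transversal graph} in $(\mathcal P,\pi)$ is a closed subset $G\subset\mathcal P$ partitioned into finitely many points (\emph{vertices}) and finitely many subsets homeomorphic to open segments (\emph{open edges}) such that: the closure $\overline E$ of each open edge $E$ (an \emph{edge}) is homeomorphic to a closed, possibly unbounded, interval of $\mathbb R$, and $\overline E\setminus E$ consists of $0$, $1$ or $2$ vertices; the restriction of $\pi$ to each edge is a homeomorphism onto its image; and $\pi|_G$ is proper. It is \emph{generic} if every vertex has valency $1$ or $3$, if distinct vertices lie on distinct vertical lines, and if the three edges at a vertex of valency $3$ do not all leave it on the same side of the vertical line through it. The \emph{topological critical set} of a curve $\mathcal C\subset\mathcal P$ is the set of points of $\mathcal C$ without a neighborhood in $\mathcal C$ on which $\pi$ is a homeomorphism onto its image. A \emph{domain of finite type} is a closed subset $\mathcal D\subset\mathcal P$ that is a topological surface with non-empty boundary $\mathcal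 C$, such that $\pi|_{\mathcal D}$ is proper and the topological critical set of $\mathcal C$ is finite. An \emph{algebraic domain} is a closed subset of $\mathbb R^2$ that is a topological surface with boundary, whose boundary is a disjoint union of finitely many smooth connected components of real algebraic plane curves. The \emph{$\mathcal D$-collapse} $(\tilde{\mathcal P},\tilde\pi)$ of $\mathcal P$ is the quotient of $\mathcal P$ that contracts to a point each connected component of each $\mathcal D\cap\pi^{-1}(x_0)$, $x_0\in\mathbb R$, with the induced projection and the orientation induced from $\mathcal P\setminus\mathcal D$. The \emph{Poincaré--Reeb graph} of $\mathcal D$ is the image of $\mathcal D$ in $\tilde{\mathcal P}$; its vertices are the images of the topological critical points of $\mathcal C$. Subsets $X$, $X'$ of vertical planes $(\mathcal P,\pi)$, $(\mathcal P',\pi')$ are \emph{vertically equivalent} if there are orientation preserving homeomorphisms $\Phi:\mathcal P\to\mathcal P'$ and $\psi:\mathbb R\to\mathbb R$ with $\pi'\circ\Phi=\psi\circ\pi$ and $\Phi(X)=X'$. \textbf{Theorem.} Let $G$ be a non-empty compact connected generic transversal graph in a vertical plane. Then there is a connected algebraic domain $\mathcal D\subset\mathbb R^2$ that is a domain of finite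 type in $(\mathbb R^2,x)$, whose $\mathcal D$-collapse is a vertical plane, and whose Poincaré--Reeb graph is vertically equivalent to $G$, by an equivalence that maps the vertices of $G$ onto the vertices of the Poincaré--Reeb graph. -/

import Mathlib

open Set Topology

/-! ## Vertical planes -/

/-- A space `P` with a projection to `ℝ` and a relation `below` between points of the same fiber.
This is the raw data of a vertical plane; the axioms are in `IsVerticalPlane`. -/
structure VerticalSpace (P : Type*) where
  /-- the projection, whose fibers are the vertical lines -/
  proj : P → ℝ
  /-- `below p q`: the points `p`, `q` lie on the same vertical line, and `p` lies strictly below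
  `q` for the orientation of that line -/
  below : P → P → Prop

/-- `(P, proj)` is a vertical plane: `P` is homeomorphic to `ℝ²`, and `proj` is a locally trivial
fibration (whose fibers are homeomorphic to `ℝ`, as `P` is a plane), with an orientation.
Because `ℝ` is oriented, an orientation of `P` is the same as a coherent orientation of the
vertical lines: the charts of the form `(proj, y)` that define an oriented atlas are those in which
`y` increases upwards. Every point of `ℝ` is required to have such a chart over a neighborhood. -/
structure IsVerticalPlane {P : Type*} [TopologicalSpace P] (V : VerticalSpace P) : Prop where
  homeomorphic_plane : Nonempty (P ≃ₜ ℝ × ℝ)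
  locally_trivial : ∀ x : ℝ, ∃ e : Bundle.Trivialization ℝ V.proj, x ∈ e.baseSet ∧
    ∀ p q : P, V.proj p ∈ e.baseSet →
      (V.below p q ↔ V.proj p = V.proj q ∧ (e p).2 < (e q).2)

/-- The canonical affine vertical plane `(ℝ², x)`, with the standard orientation. -/
def canonicalPlane : VerticalSpace (ℝ × ℝ) where
  proj := Prod.fst
  below p q := p.1 = q.1 ∧ p.2 < q.2

/-- A pair of orientation preserving homeomorphisms `Φ : P → P'` and `ψ : ℝ → ℝ` that commute with
the projections. As `ψ` is increasing, `Φ` preserves the orientation if and only if it is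
increasing on the vertical lines. -/
structure VerticalEquiv {P P' : Type*} [TopologicalSpace P] [TopologicalSpace P']
    (V : VerticalSpace P) (V' : VerticalSpace P') where
  Φ : P ≃ₜ P'
  ψ : ℝ ≃ₜ ℝ
  strictMono_ψ : StrictMono ψ
  comm : ∀ p, V'.proj (Φ p) = ψ (V.proj p)
  below_iff : ∀ p q, V'.below (Φ p) (Φ q) ↔ V.below p q

/-! ## Transversal graphs -/

/-- A transversal graph in `(P, proj)`. -/
structure TransversalGraph {P : Type*} [TopologicalSpace P] (V : VerticalSpace P) where
  vertices : Set P
  openEdges : Set (Set P)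
  finite_vertices : vertices.Finite
  finite_openEdges : openEdges.Finite
  /-- the graph, as a subset of the plane, is closed -/
  isClosed : IsClosed (vertices ∪ ⋃₀ openEdges)
  disjoint_vertices : ∀ E ∈ openEdges, Disjoint vertices E
  pairwise_disjoint : openEdges.PairwiseDisjoint id
  /-- an open edge is homeomorphic to an open segment -/
  openEdge_homeo : ∀ E ∈ openEdges, Nonempty (E ≃ₜ ℝ)
  /-- an edge is homeomorphic to a closed, possibly unbounded, interval of `ℝ` -/
  edge_homeo : ∀ E ∈ openEdges, ∃ I : Set ℝ, IsClosed I ∧ I.OrdConnected ∧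
    Nonempty (closure E ≃ₜ I)
  /-- the ends of an edge are `0`, `1` or `2` vertices -/
  ends_subset : ∀ E ∈ openEdges, closure E \ E ⊆ vertices
  ends_card : ∀ E ∈ openEdges, (closure E \ E).encard ≤ 2
  /-- the edges are topologically transversal to the vertical lines: the restriction of the
  projection to an edge is a homeomorphism onto its image -/
  transversal : ∀ E ∈ openEdges, IsEmbedding ((closure E).domRestrict V.proj)
  proper : IsProperMap ((vertices ∪ ⋃₀ openEdges).domRestrict V.proj)

namespace TransversalGraph

variable {P : Type*} [TopologicalSpace P] {V : VerticalSpace P}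

/-- The graph, as a subset of the plane. -/
def carrier (G : TransversalGraph V) : Set P := G.vertices ∪ ⋃₀ G.openEdges

/-- The number of edges that contain `v` (a transversal graph has no loops). -/
noncomputable def valency (G : TransversalGraph V) (v : P) : ℕ :=
  {E | E ∈ G.openEdges ∧ v ∈ closure E}.ncard

/-- The vertices have valency `1` or `3`, and distinct vertices lie on distinct vertical lines. -/
def IsGeneric (G : TransversalGraph V) : Prop :=
  (∀ v ∈ G.vertices, G.valency v = 1 ∨ G.valency v = 3) ∧ InjOn V.proj G.vertices

/-- At a vertex of valency `3`, there is an edge on each side of the vertical line through it, so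
that two edges leave to one side and one edge to the other. -/
def IsTwoSided (G : TransversalGraph V) : Prop :=
  ∀ v ∈ G.vertices, G.valency v = 3 →
    (∃ E ∈ G.openEdges, v ∈ closure E ∧ ∀ p ∈ E, V.proj p < V.proj v) ∧
    (∃ E ∈ G.openEdges, v ∈ closure E ∧ ∀ p ∈ E, V.proj v < V.proj p)

end TransversalGraph

/-! ## Domains of finite type and algebraic domains -/

/-- The topological critical set of a curve `C`: the points of `C` that have no neighborhood in `C`
on which the projection is a homeomorphism onto its image. -/
def topCriticalSet {P : Type*} [TopologicalSpace P] (V : VerticalSpace P) (C : Set P) : Set P :=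
  {p | p ∈ C ∧ ¬ ∃ U ∈ 𝓝 p, IsEmbedding ((U ∩ C).domRestrict V.proj)}

/-- `D` is, with the subspace topology, a topological surface with (possibly empty) boundary:
it is locally homeomorphic to open subsets of the closed half-plane. If `D` is closed in a
plane, then its boundary as a surface is its frontier, by the invariance of domain. -/
def IsSurfaceWithBoundary {P : Type*} [TopologicalSpace P] (D : Set P) : Prop :=
  Nonempty (ChartedSpace (EuclideanHalfSpace 2) D)

/-- Domains of finite type. -/
structure IsDomainOfFiniteType {P : Type*} [TopologicalSpace P] (V : VerticalSpace P)
    (D : Set P) : Prop where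
  isClosed : IsClosed D
  isSurface : IsSurfaceWithBoundary D
  boundary_nonempty : (frontier D).Nonempty
  proper : IsProperMap (D.domRestrict V.proj)
  finite_critical : (topCriticalSet V (frontier D)).Finite

/-- The set of real zeros of a polynomial in two variables. -/
def polyZeros (f : MvPolynomial (Fin 2) ℝ) : Set (ℝ × ℝ) :=
  {p | MvPolynomial.eval ![p.1, p.2] f = 0}

/-- `c` is a connected component of a real algebraic plane curve `f = 0`, and it is smooth: no
point of `c` is a singular point, that is, a common zero of both partial derivatives of `f`. -/
def IsSmoothCurveComponent (c : Set (ℝ × ℝ)) : Prop :=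
  ∃ f : MvPolynomial (Fin 2) ℝ, f ≠ 0 ∧
    (∃ p ∈ polyZeros f, c = connectedComponentIn (polyZeros f) p) ∧
    ∀ q ∈ c, MvPolynomial.eval ![q.1, q.2] (MvPolynomial.pderiv 0 f) ≠ 0 ∨
      MvPolynomial.eval ![q.1, q.2] (MvPolynomial.pderiv 1 f) ≠ 0

/-- Algebraic domains of `ℝ²`: the boundary is a disjoint union of finitely many smooth connected
components of real algebraic plane curves. -/
structure IsAlgebraicDomain (D : Set (ℝ × ℝ)) : Prop where
  isClosed : IsClosed D
  isSurface : IsSurfaceWithBoundary D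
  boundary : ∃ S : Set (Set (ℝ × ℝ)), S.Finite ∧ S.PairwiseDisjoint id ∧
    (∀ c ∈ S, IsSmoothCurveComponent c) ∧ frontier D = ⋃₀ S

/-! ## The collapse and the Poincaré–Reeb graph -/

section Collapse

variable {P : Type*} [TopologicalSpace P]

/-- Two points are vertically equivalent relative to `D` if they lie on the same fiber of the
projection and either in the same connected component of the intersection of `D` with that fiber,
or they are equal and not in `D`. -/
def VertRel (V : VerticalSpace P) (D : Set P) (p q : P) : Prop :=
  V.proj p = V.proj q ∧
    (q ∈ connectedComponentIn (V.proj ⁻¹' {V.proj p} ∩ D) p ∨ (p = q ∧ p ∉ D))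

theorem VertRel.mem {V : VerticalSpace P} {D : Set P} {p q : P}
    (h : q ∈ connectedComponentIn (V.proj ⁻¹' {V.proj p} ∩ D) p) : p ∈ D := by
  by_contra hp
  rw [connectedComponentIn_eq_empty (fun h' => hp h'.2)] at h
  exact h

theorem vertRel_equivalence (V : VerticalSpace P) (D : Set P) : Equivalence (VertRel V D) where
  refl p := by
    refine ⟨rfl, ?_⟩
    by_cases hp : p ∈ D
    · exact Or.inl (mem_connectedComponentIn ⟨rfl, hp⟩)
    · exact Or.inr ⟨rfl, hp⟩
  symm := by
    rintro p q ⟨h, h1 | ⟨rfl, h2⟩⟩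
    · refine ⟨h.symm, Or.inl ?_⟩
      rw [← h, ← connectedComponentIn_eq h1]
      exact mem_connectedComponentIn ⟨rfl, VertRel.mem h1⟩
    · exact ⟨rfl, Or.inr ⟨rfl, h2⟩⟩
  trans := by
    rintro p q r ⟨h, h1 | ⟨rfl, h2⟩⟩ ⟨h', h1' | ⟨rfl, h2'⟩⟩
    · refine ⟨h.trans h', Or.inl ?_⟩
      rw [connectedComponentIn_eq h1, h]
      exact h1'
    · exact ⟨h, Or.inl h1⟩
    · exact ⟨h', Or.inl h1'⟩
    · exact ⟨rfl, Or.inr ⟨rfl, h2⟩⟩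

/-- The equivalence relation whose quotient is the collapse. -/
def vertSetoid (V : VerticalSpace P) (D : Set P) : Setoid P :=
  ⟨VertRel V D, vertRel_equivalence V D⟩

/-- The `D`-collapse of `P`, with the quotient topology. -/
abbrev CollapseSpace (V : VerticalSpace P) (D : Set P) : Type _ := Quotient (vertSetoid V D)

/-- The collapsing map. -/
def collapseMap (V : VerticalSpace P) (D : Set P) : P → CollapseSpace V D :=
  Quotient.mk (vertSetoid V D)

/-- The projection and the orientation induced on the `D`-collapse: the collapsing map commutes
with the projections, and is increasing (not strictly) on the vertical lines. -/
def collapsePlane (V : VerticalSpace P) (D : Set P) : VerticalSpace (CollapseSpace V D) where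
  proj := Quotient.lift V.proj fun _ _ h => h.1
  below a b := a ≠ b ∧ ∃ p q, collapseMap V D p = a ∧ collapseMap V D q = b ∧ V.below p q

/-- The Poincaré–Reeb set of `D`, as a subset of the collapse. -/
def poincareReebSet (V : VerticalSpace P) (D : Set P) : Set (CollapseSpace V D) :=
  collapseMap V D '' D

/-- The vertices of the Poincaré–Reeb graph of `D`: the images of the topological critical points
of the boundary of `D`. -/
def poincareReebVertices (V : VerticalSpace P) (D : Set P) : Set (CollapseSpace V D) :=
  collapseMap V D '' topCriticalSet V (frontier D)

end Collapse

/-!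
Why every compact connected generic transversal graph is a Poincaré–Reeb graph.

A vertical plane is globally trivial (`IsVerticalPlane.exists_global_chart`): oriented coordinates
on the vertical lines exist locally, they form a convex set on each line, and so a partition of
unity on the base glues them. Hence the graph `G` may be placed in `ℝ²`. The same gluing principle,
`exists_continuous_of_local_fiberwise_convex`, is used a second time to compare plane graphs: the
pattern of a graph records the number of strands between consecutive vertices and, at each vertex,
whether a strand is born, dies, splits or merges, and at which position. Two subsets of `ℝ²` with
the same pattern are matched by a homeomorphism of the plane that preserves the vertical lines and
their orientation (`HasPattern.exists_homeomorph`): near a given vertical line one interpolates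
linearly between corresponding strands, and on a given line the points of the two sets determine
where each strand goes, so that the local solutions form convex sets. A generic transversal graph
has a pattern, which is valid in the sense that it starts and ends without strands and changes by
one strand at a time (`TransversalGraph.exists_edgeSystem`, `EdgeSystem.exists_hasPattern`).

It remains to find an algebraic domain whose Poincaré–Reeb graph has a prescribed valid pattern.
Each strand is doubled into two simple zeros of a function of `y ∈ [0, 1]`, and the domain is the
set where the function is nonpositive. A birth or a split inserts two adjacent zeros `α < β` in a
gap: the birth where the function is positive, the split where it is negative. So there are
polynomials `N 0, …, N n` in `y`, such that one of `N i`, `N (i + 1)` is the other one multiplied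
by `(y - α) * (y - β)` (`ValidPattern.exists_polynomials`). Interpolating from `N i` to `N (i + 1)`
for `x ∈ [i, i + 1]`, the varying factor is `1 - θ + θ * (y - α) * (y - β)`; it acquires a double
zero for exactly one `θ`, where the curve has a fold, with nonzero derivative in `x` and convex in
`y`. This configuration of simple zeros and folds is stable under small perturbations of the
function and of its derivatives (`FoldGerm.exists_foldSlab`), and so the interpolation in `x` may
be replaced by a polynomial one (`ValidPattern.exists_mvPolynomial`).

Let `D` be the part of the box `[0, n] × [0, 1]` where the resulting polynomial is nonpositive; it
does not meet the boundary of the box. All the zeros in the box are regular points of the curve, and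
the vertical tangents are the folds, which gives the properties of `D` as a domain
(`FoldFamily.isAlgebraicDomain`, `FoldFamily.isDomainOfFiniteType`,
`FoldFamily.topCriticalSet_eq`). The `D`-collapse is realized by the explicit height function
`gapHeight`, which integrates the distance to `D` along the vertical lines and is therefore constant
exactly on the vertical segments of `D` (`exists_collapse_homeomorph`). Over a point `x`, the
components of the fiber of `D` are intervals around separators that do not depend on `x` locally, so
that the strands of the Poincaré–Reeb graph are continuous, and it has the prescribed pattern
(`FoldFamily.hasPattern`). As the collapsing map is proper with connected fibers, `D` is connected
because `G` is.
-/


/-! ### Fiberwise constructions over the line -/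

/-- Local fiberwise solutions of a fiberwise convex condition can be glued, by a partition of unity
on the base. The set `C x` is a condition on the restriction of a function to the fiber over `x`. -/
theorem exists_continuous_of_local_fiberwise_convex {P : Type*} [TopologicalSpace P] {π : P → ℝ}
    (hπ : Continuous π) (C : ℝ → Set (P → ℝ)) (hconv : ∀ x, Convex ℝ (C x))
    (hext : ∀ x y y', (∀ p, π p = x → y p = y' p) → y ∈ C x → y' ∈ C x)
    (hloc : ∀ x₀, ∃ U, IsOpen U ∧ x₀ ∈ U ∧ ∃ y : P → ℝ, ContinuousOn y (π ⁻¹' U) ∧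
      ∀ x ∈ U, y ∈ C x) :
    ∃ y : P → ℝ, Continuous y ∧ ∀ x, y ∈ C x := by
  choose U hUo hxU y hyc hyC using hloc
  obtain ⟨ρ, hρ⟩ := PartitionOfUnity.exists_isSubordinate (isClosed_univ (X := ℝ)) U hUo
    (fun x _ => mem_iUnion.2 ⟨x, hxU x⟩)
  refine ⟨fun p => ∑ᶠ i, ρ i (π p) * y i p, ?_, fun x => ?_⟩
  · refine continuous_finsum (fun i => ?_) ?_
    · rw [continuous_iff_continuousAt]
      intro p
      by_cases hp : π p ∈ tsupport (ρ i)
      · refine ContinuousAt.mul ((ρ i).continuous.continuousAt.comp hπ.continuousAt) ?_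
        exact (hyc i).continuousAt (((hUo i).preimage hπ).mem_nhds (hρ i hp))
      · have h0 : (fun p => ρ i (π p) * y i p) =ᶠ[𝓝 p] fun _ => 0 := by
          have h1 : ∀ᶠ q in 𝓝 p, π q ∈ (tsupport (ρ i))ᶜ :=
            hπ.continuousAt.eventually ((isClosed_tsupport _).isOpen_compl.mem_nhds hp)
          filter_upwards [h1] with q hq
          rw [image_eq_zero_of_notMem_tsupport hq, zero_mul]
        exact continuousAt_const.congr h0.symm
    · refine LocallyFinite.subset (ρ.locallyFinite.preimage_continuous hπ) fun i p hp => ?_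
      simp only [Function.mem_support, ne_eq, mul_eq_zero, not_or] at hp
      exact hp.1
  · have h := (hconv x).finsum_mem (w := fun i => ρ i x) (z := y) (fun i => ρ.nonneg i x)
      (ρ.sum_eq_one (mem_univ x)) (fun i hi => hyC i x (hρ i (subset_tsupport _ hi)))
    refine hext x _ _ (fun p hp => ?_) h
    have hfin : (Function.support fun i => ρ i x • y i).Finite := by
      refine (ρ.locallyFinite.point_finite x).subset fun i hi => ?_
      intro h0
      exact hi (by simp only [h0, zero_smul])
    have h2 := (Pi.evalAddMonoidHom (fun _ : P => ℝ) p).map_finsum hfin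
    simp only [Pi.evalAddMonoidHom_apply, Pi.smul_apply, smul_eq_mul] at h2
    rw [h2, ← hp]

section VerticalPlane

variable {P : Type*} [TopologicalSpace P] {V : VerticalSpace P}

theorem IsVerticalPlane.continuous_proj (hV : IsVerticalPlane V) : Continuous V.proj := by
  rw [continuous_iff_continuousAt]
  intro p
  obtain ⟨e, he, -⟩ := hV.locally_trivial (V.proj p)
  exact e.continuousAt_proj (e.mem_source.2 he)

theorem IsVerticalPlane.proj_eq (hV : IsVerticalPlane V) {p q : P} (h : V.below p q) :
    V.proj p = V.proj q := by
  obtain ⟨e, he, hb⟩ := hV.locally_trivial (V.proj p)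
  exact ((hb p q he).1 h).1

theorem IsVerticalPlane.trichotomy (hV : IsVerticalPlane V) {p q : P} (h : V.proj p = V.proj q) :
    V.below p q ∨ p = q ∨ V.below q p := by
  obtain ⟨e, he, hb⟩ := hV.locally_trivial (V.proj p)
  have he' : V.proj q ∈ e.baseSet := h ▸ he
  rcases lt_trichotomy (e p).2 (e q).2 with h1 | h1 | h1
  · exact Or.inl ((hb p q he).2 ⟨h, h1⟩)
  · right; left
    refine e.injOn (e.mem_source.2 he) (e.mem_source.2 he') (Prod.ext ?_ h1)
    exact (e.coe_fst' he).trans (h.trans (e.coe_fst' he').symm)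
  · exact Or.inr (Or.inr ((hb q p he').2 ⟨h.symm, h1⟩))

theorem isVerticalPlane_canonicalPlane : IsVerticalPlane canonicalPlane where
  homeomorphic_plane := ⟨Homeomorph.refl _⟩
  locally_trivial x := by
    refine ⟨⟨(Homeomorph.refl (ℝ × ℝ)).toOpenPartialHomeomorph, univ, isOpen_univ, rfl,
      by simp, fun p _ => rfl⟩, mem_univ x, fun p q _ => ?_⟩
    rfl

/-- The functions whose restriction to the vertical line over `x` is increasing and unbounded in
both directions. -/
def fiberMono (V : VerticalSpace P) (x : ℝ) : Set (P → ℝ) :=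
  {y | (∀ p q, V.proj p = x → V.below p q → y p < y q) ∧
    ∀ M, (∃ p, V.proj p = x ∧ M ≤ y p) ∧ ∃ p, V.proj p = x ∧ y p ≤ M}

theorem IsVerticalPlane.convex_fiberMono (hV : IsVerticalPlane V) (x : ℝ) :
    Convex ℝ (fiberMono V x) := by
  rintro y ⟨hy1, hy2⟩ y' ⟨hy1', hy2'⟩ a b ha hb hab
  have key : ∀ u v u' v' : ℝ, u < v → u' < v' → a * u + b * u' < a * v + b * v' := by
    intro u v u' v' h h'
    rcases ha.eq_or_lt with rfl | ha'
    · have : b = 1 := by linarith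
      subst this; linarith
    · have := mul_lt_mul_of_pos_left h ha'
      have := mul_le_mul_of_nonneg_left h'.le hb
      linarith
  refine ⟨fun p q hp hpq => ?_, fun M => ⟨?_, ?_⟩⟩
  · simpa using key _ _ _ _ (hy1 p q hp hpq) (hy1' p q hp hpq)
  · obtain ⟨p, hp, hpM⟩ := (hy2 M).1
    obtain ⟨p', hp', hpM'⟩ := (hy2' M).1
    have hmain : ∃ r, V.proj r = x ∧ M ≤ y r ∧ M ≤ y' r := by
      rcases hV.trichotomy (hp.trans hp'.symm) with h | rfl | h
      · exact ⟨p', hp', hpM.trans (hy1 _ _ hp h).le, hpM'⟩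
      · exact ⟨p, hp, hpM, hpM'⟩
      · exact ⟨p, hp, hpM, hpM'.trans (hy1' _ _ hp' h).le⟩
    obtain ⟨r, hr, h1, h2⟩ := hmain
    refine ⟨r, hr, ?_⟩
    have := mul_le_mul_of_nonneg_left h1 ha
    have := mul_le_mul_of_nonneg_left h2 hb
    simp only [Pi.add_apply, Pi.smul_apply, smul_eq_mul]
    have : a * M + b * M = M := by rw [← add_mul, hab, one_mul]
    linarith
  · obtain ⟨p, hp, hpM⟩ := (hy2 M).2
    obtain ⟨p', hp', hpM'⟩ := (hy2' M).2
    have hmain : ∃ r, V.proj r = x ∧ y r ≤ M ∧ y' r ≤ M := by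
      rcases hV.trichotomy (hp.trans hp'.symm) with h | rfl | h
      · exact ⟨p, hp, hpM, (hy1' _ _ hp h).le.trans hpM'⟩
      · exact ⟨p, hp, hpM, hpM'⟩
      · exact ⟨p', hp', (hy1 _ _ hp' h).le.trans hpM, hpM'⟩
    obtain ⟨r, hr, h1, h2⟩ := hmain
    refine ⟨r, hr, ?_⟩
    have := mul_le_mul_of_nonneg_left h1 ha
    have := mul_le_mul_of_nonneg_left h2 hb
    simp only [Pi.add_apply, Pi.smul_apply, smul_eq_mul]
    have : a * M + b * M = M := by rw [← add_mul, hab, one_mul]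
    linarith

theorem fiberMono_congr (hV : IsVerticalPlane V) (x : ℝ) (y y' : P → ℝ)
    (h : ∀ p, V.proj p = x → y p = y' p) (hy : y ∈ fiberMono V x) : y' ∈ fiberMono V x := by
  refine ⟨fun p q hp hpq => ?_, fun M => ⟨?_, ?_⟩⟩
  · rw [← h p hp, ← h q ((hV.proj_eq hpq).symm.trans hp)]
    exact hy.1 p q hp hpq
  · obtain ⟨p, hp, hM⟩ := (hy.2 M).1
    exact ⟨p, hp, h p hp ▸ hM⟩
  · obtain ⟨p, hp, hM⟩ := (hy.2 M).2
    exact ⟨p, hp, h p hp ▸ hM⟩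

/-- A continuous function that is increasing and unbounded on each vertical line is the second
coordinate of a global chart. Continuity of the inverse is a fiberwise squeeze, so that invariance
of domain is not needed. -/
theorem IsVerticalPlane.exists_homeomorph (hV : IsVerticalPlane V) {y : P → ℝ} (hy : Continuous y)
    (hmono : ∀ x, y ∈ fiberMono V x) :
    ∃ K : P ≃ₜ ℝ × ℝ, (∀ p, K p = (V.proj p, y p)) ∧
      ∀ p q, V.below p q ↔ V.proj p = V.proj q ∧ y p < y q := by
  have hbelow : ∀ p q, V.below p q ↔ V.proj p = V.proj q ∧ y p < y q := by
    intro p q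
    refine ⟨fun h => ⟨hV.proj_eq h, (hmono _).1 p q rfl h⟩, fun ⟨h1, h2⟩ => ?_⟩
    rcases hV.trichotomy h1 with h | rfl | h
    · exact h
    · exact absurd h2 (lt_irrefl _)
    · exact absurd h2 ((hmono _).1 q p rfl h).le.not_gt
  have hinj : Function.Injective fun p => (V.proj p, y p) := by
    intro p q h
    simp only [Prod.mk.injEq] at h
    rcases hV.trichotomy h.1 with h' | h' | h'
    · exact absurd ((hmono _).1 p q rfl h') (by rw [h.2]; exact lt_irrefl _)
    · exact h'
    · exact absurd ((hmono _).1 q p rfl h') (by rw [h.2]; exact lt_irrefl _)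
  have hsurj : Function.Surjective fun p => (V.proj p, y p) := by
    rintro ⟨x, t⟩
    obtain ⟨e, he, hb⟩ := hV.locally_trivial x
    obtain ⟨p, hp, hpt⟩ := ((hmono x).2 t).1
    obtain ⟨q, hq, hqt⟩ := ((hmono x).2 t).2
    have hc : Continuous fun s : ℝ => y (e.toOpenPartialHomeomorph.symm (x, s)) := by
      refine hy.comp ?_
      have h1 : ContinuousOn e.toOpenPartialHomeomorph.symm (e.baseSet ×ˢ univ) := by
        rw [← e.target_eq]; exact e.toOpenPartialHomeomorph.continuousOn_symm
      exact h1.comp_continuous (by fun_prop) (fun s => ⟨he, mem_univ _⟩)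
    have hback : ∀ r, V.proj r = x → e.toOpenPartialHomeomorph.symm (x, (e r).2) = r := by
      intro r hr
      have := e.symm_apply_mk_proj (x := r) (e.mem_source.2 (hr ▸ he))
      rwa [hr] at this
    have h2 := mem_range_of_exists_le_of_exists_ge hc (c := t) ⟨(e q).2, by rw [hback q hq]; exact hqt⟩
      ⟨(e p).2, by rw [hback p hp]; exact hpt⟩
    obtain ⟨s, hs⟩ := h2
    exact ⟨_, Prod.ext (e.proj_symm_apply' he) hs⟩
  let E : P ≃ ℝ × ℝ := Equiv.ofBijective _ ⟨hinj, hsurj⟩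
  have hE : ∀ p, E p = (V.proj p, y p) := fun _ => rfl
  have hEs : ∀ z, V.proj (E.symm z) = z.1 ∧ y (E.symm z) = z.2 := by
    intro z
    have := E.apply_symm_apply z
    rw [hE] at this
    exact ⟨congrArg Prod.fst this, congrArg Prod.snd this⟩
  have hcont : Continuous E.symm := by
    rw [continuous_iff_continuousAt]
    rintro ⟨x₀, t₀⟩
    obtain ⟨e, he, hb⟩ := hV.locally_trivial x₀
    set p₀ := E.symm (x₀, t₀) with hp₀
    have hpx : V.proj p₀ = x₀ := (hEs _).1
    have hpy : y p₀ = t₀ := (hEs _).2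
    set s₀ := (e p₀).2 with hs₀
    have hback : ∀ r, V.proj r ∈ e.baseSet →
        e.toOpenPartialHomeomorph.symm (V.proj r, (e r).2) = r := by
      intro r hr
      exact e.symm_apply_mk_proj (x := r) (e.mem_source.2 hr)
    have hcs : ∀ s, ContinuousAt e.toOpenPartialHomeomorph.symm (x₀, s) := fun s =>
      e.toOpenPartialHomeomorph.continuousAt_symm (by rw [e.target_eq]; exact ⟨he, mem_univ _⟩)
    intro W hW
    have hW' : e.toOpenPartialHomeomorph.symm ⁻¹' W ∈ 𝓝 (x₀, s₀) := by
      apply hcs s₀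
      have : e.toOpenPartialHomeomorph.symm (x₀, s₀) = p₀ := by
        have := hback p₀ (by rw [hpx]; exact he)
        rwa [hpx] at this
      rw [this]; exact hW
    obtain ⟨ε, hε, hball⟩ := Metric.mem_nhds_iff.1 hW'
    have hs2 : ∀ x ∈ e.baseSet, ∀ s, (e (e.toOpenPartialHomeomorph.symm (x, s))).2 = s ∧
        V.proj (e.toOpenPartialHomeomorph.symm (x, s)) = x := by
      intro x hx s
      exact ⟨by rw [e.apply_symm_apply' hx], e.proj_symm_apply' hx⟩
    have hlo : y (e.toOpenPartialHomeomorph.symm (x₀, s₀ - ε / 2)) < t₀ := by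
      rw [← hpy]
      refine (hmono x₀).1 _ _ (hs2 x₀ he _).2 ((hb _ _ ?_).2 ⟨?_, ?_⟩)
      · rw [(hs2 x₀ he _).2]; exact he
      · rw [(hs2 x₀ he _).2, hpx]
      · rw [(hs2 x₀ he _).1]; linarith
    have hhi : t₀ < y (e.toOpenPartialHomeomorph.symm (x₀, s₀ + ε / 2)) := by
      rw [← hpy]
      refine (hmono x₀).1 _ _ hpx ((hb _ _ ?_).2 ⟨?_, ?_⟩)
      · rw [hpx]; exact he
      · rw [(hs2 x₀ he _).2, hpx]
      · rw [(hs2 x₀ he _).1]; linarith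
    have hcy : ∀ s, ContinuousAt (fun z : ℝ × ℝ => y (e.toOpenPartialHomeomorph.symm (z.1, s)))
        (x₀, t₀) := by
      intro s
      refine hy.continuousAt.comp ?_
      exact ContinuousAt.comp (f := fun z : ℝ × ℝ => (z.1, s)) (hcs s) (by fun_prop)
    have ev1 := (hcy (s₀ - ε / 2)).eventually_lt (continuousAt_snd (p := (x₀, t₀))) hlo
    have ev2 := (continuousAt_snd (p := (x₀, t₀))).eventually_lt (hcy (s₀ + ε / 2)) hhi
    have ev3 : ∀ᶠ z : ℝ × ℝ in 𝓝 (x₀, t₀), z.1 ∈ e.baseSet :=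
      continuousAt_fst.eventually (e.open_baseSet.mem_nhds he)
    have ev4 : ∀ᶠ z : ℝ × ℝ in 𝓝 (x₀, t₀), z.1 ∈ Metric.ball x₀ ε :=
      continuousAt_fst.eventually (Metric.ball_mem_nhds x₀ hε)
    change ∀ᶠ z in 𝓝 (x₀, t₀), E.symm z ∈ W
    filter_upwards [ev1, ev2, ev3, ev4] with z h1 h2 h3 h4
    obtain ⟨hz1, hz2⟩ := hEs z
    have hzb : V.proj (E.symm z) ∈ e.baseSet := by rw [hz1]; exact h3
    have hlow : s₀ - ε / 2 < (e (E.symm z)).2 := by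
      by_contra hcon
      rw [not_lt] at hcon
      have : y (E.symm z) ≤ y (e.toOpenPartialHomeomorph.symm (z.1, s₀ - ε / 2)) := by
        rcases hcon.eq_or_lt with h | h
        · rw [← h, ← hz1, hback _ hzb]
        · refine ((hmono z.1).1 _ _ hz1 ((hb _ _ hzb).2 ⟨?_, ?_⟩)).le
          · rw [(hs2 z.1 h3 _).2, hz1]
          · rw [(hs2 z.1 h3 _).1]; exact h
      rw [hz2] at this
      linarith
    have hhigh : (e (E.symm z)).2 < s₀ + ε / 2 := by
      by_contra hcon
      rw [not_lt] at hcon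
      have : y (e.toOpenPartialHomeomorph.symm (z.1, s₀ + ε / 2)) ≤ y (E.symm z) := by
        rcases hcon.eq_or_lt with h | h
        · rw [h, ← hz1, hback _ hzb]
        · refine ((hmono z.1).1 _ _ (hs2 z.1 h3 _).2 ((hb _ _ ?_).2 ⟨?_, ?_⟩)).le
          · rw [(hs2 z.1 h3 _).2]; exact h3
          · rw [(hs2 z.1 h3 _).2, hz1]
          · rw [(hs2 z.1 h3 _).1]; exact h
      rw [hz2] at this
      linarith
    have hmem : (z.1, (e (E.symm z)).2) ∈ Metric.ball (x₀, s₀) ε := by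
      rw [← ball_prod_same]
      refine ⟨h4, ?_⟩
      rw [Metric.mem_ball, Real.dist_eq, abs_lt]
      constructor <;> linarith
    have := hball hmem
    rw [mem_preimage, ← hz1, hback _ hzb] at this
    exact this
  exact ⟨⟨E, by change Continuous fun p => (V.proj p, y p); exact hV.continuous_proj.prodMk hy, hcont⟩,
    hE, hbelow⟩

/-- A vertical plane is globally trivial, as an oriented fibration. -/
theorem IsVerticalPlane.exists_global_chart (hV : IsVerticalPlane V) :
    ∃ K : P ≃ₜ ℝ × ℝ, (∀ p, (K p).1 = V.proj p) ∧
      ∀ p q, V.below p q ↔ V.proj p = V.proj q ∧ (K p).2 < (K q).2 := by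
  obtain ⟨y, hyc, hy⟩ := exists_continuous_of_local_fiberwise_convex hV.continuous_proj
    (fiberMono V) hV.convex_fiberMono (fiberMono_congr hV) (fun x₀ => by
      obtain ⟨e, he, hb⟩ := hV.locally_trivial x₀
      refine ⟨e.baseSet, e.open_baseSet, he, fun p => (e p).2, ?_, fun x hx => ⟨?_, fun M => ?_⟩⟩
      · rw [← e.source_eq]
        exact continuous_snd.comp_continuousOn e.toOpenPartialHomeomorph.continuousOn
      · intro p q hp hpq
        exact ((hb p q (hp ▸ hx)).1 hpq).2
      · have h1 : V.proj (e.toOpenPartialHomeomorph.symm (x, M)) = x := e.proj_symm_apply' hx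
        have h2 : (e (e.toOpenPartialHomeomorph.symm (x, M))).2 = M := by
          rw [e.apply_symm_apply' hx]
        exact ⟨⟨_, h1, h2.ge⟩, ⟨_, h1, h2.le⟩⟩)
  obtain ⟨K, hK, hb⟩ := hV.exists_homeomorph hyc hy
  refine ⟨K, fun p => by rw [hK], fun p q => ?_⟩
  rw [hb, hK, hK]

end VerticalPlane

/-- A homeomorphism to `ℝ²` that is compatible with projections and orientations makes a space a
vertical plane. -/
theorem isVerticalPlane_of_homeomorph {P : Type*} [TopologicalSpace P] {V : VerticalSpace P}
    (K : P ≃ₜ ℝ × ℝ) (hK : ∀ p, (K p).1 = V.proj p)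
    (hb : ∀ p q, V.below p q ↔ V.proj p = V.proj q ∧ (K p).2 < (K q).2) : IsVerticalPlane V where
  homeomorphic_plane := ⟨K⟩
  locally_trivial x := ⟨⟨K.toOpenPartialHomeomorph, univ, isOpen_univ, rfl, by simp,
    fun p _ => hK p⟩, mem_univ x, fun p q _ => hb p q⟩

/-! ### The collapse of a compact set -/

/-- The signed length of the vertical segment from `(x, 0)` to `(x, y)`, weighted by the distance
to `D`. It is constant exactly along the vertical segments contained in `D`, so that it serves as
the height function of the `D`-collapse. -/
noncomputable def gapHeight (D : Set (ℝ × ℝ)) (x y : ℝ) : ℝ :=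
  ∫ s in (0 : ℝ)..y, Metric.infDist (x, s) D

section GapHeight

variable {D : Set (ℝ × ℝ)}

theorem continuous_gapHeight : Continuous fun p : ℝ × ℝ => gapHeight D p.1 p.2 := by
  unfold gapHeight
  refine intervalIntegral.continuous_parametric_intervalIntegral_of_continuous
    (f := fun (p : ℝ × ℝ) s => Metric.infDist (p.1, s) D) ?_ continuous_snd
  exact (Metric.continuous_infDist_pt D).comp (by fun_prop)

theorem gapHeight_sub (x y y' : ℝ) :
    gapHeight D x y' - gapHeight D x y = ∫ s in y..y', Metric.infDist (x, s) D := by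
  have hc : Continuous fun s : ℝ => Metric.infDist (x, s) D :=
    (Metric.continuous_infDist_pt D).comp (by fun_prop)
  exact intervalIntegral.integral_interval_sub_left (hc.intervalIntegrable _ _)
    (hc.intervalIntegrable _ _)

theorem gapHeight_mono (x : ℝ) : Monotone (gapHeight D x) := by
  intro y y' h
  have := gapHeight_sub (D := D) x y y'
  have h0 : 0 ≤ ∫ s in y..y', Metric.infDist (x, s) D :=
    intervalIntegral.integral_nonneg h fun _ _ => Metric.infDist_nonneg
  linarith

theorem gapHeight_eq_iff (hD : IsClosed D) (hne : D.Nonempty) {x y y' : ℝ} (h : y < y') :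
    gapHeight D x y = gapHeight D x y' ↔ ∀ s ∈ Icc y y', (x, s) ∈ D := by
  have hc : Continuous fun s : ℝ => Metric.infDist (x, s) D :=
    (Metric.continuous_infDist_pt D).comp (by fun_prop)
  have hsub := gapHeight_sub (D := D) x y y'
  constructor
  · intro heq
    by_contra! hcon
    obtain ⟨s, hs, hsD⟩ := hcon
    have hpos : 0 < Metric.infDist (x, s) D :=
      (hD.notMem_iff_infDist_pos hne).1 hsD
    have := intervalIntegral.integral_pos h hc.continuousOn (fun _ _ => Metric.infDist_nonneg)
      ⟨s, hs, hpos⟩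
    linarith
  · intro hs
    have : ∫ s in y..y', Metric.infDist (x, s) D = 0 := by
      rw [intervalIntegral.integral_congr (g := fun _ => 0)]
      · simp
      · intro s hs'
        rw [uIcc_of_le h.le] at hs'
        exact Metric.infDist_zero_of_mem (hs s hs')
    linarith

theorem gapHeight_eq_iff_uIcc (hD : IsClosed D) (hne : D.Nonempty) {x y y' : ℝ} :
    gapHeight D x y = gapHeight D x y' ↔ y = y' ∨ ∀ s ∈ uIcc y y', (x, s) ∈ D := by
  rcases lt_trichotomy y y' with h | rfl | h
  · rw [gapHeight_eq_iff hD hne h, uIcc_of_le h.le]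
    simp [h.ne]
  · simp
  · rw [eq_comm, gapHeight_eq_iff hD hne h, uIcc_comm, uIcc_of_le h.le]
    simp [h.ne']

theorem exists_le_gapHeight (hD : IsCompact D) (hne : D.Nonempty) :
    ∃ M, 0 ≤ M ∧ ∀ x y, |y| - M ≤ |gapHeight D x y| := by
  obtain ⟨r, hr⟩ := hD.isBounded.subset_closedBall (0 : ℝ × ℝ)
  refine ⟨|r| + 1, by positivity, fun x y => ?_⟩
  have hc : Continuous fun s : ℝ => Metric.infDist (x, s) D :=
    (Metric.continuous_infDist_pt D).comp (by fun_prop)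
  have hone : ∀ s : ℝ, |r| + 1 ≤ |s| → 1 ≤ Metric.infDist (x, s) D := by
    intro s hs
    refine (Metric.le_infDist hne).2 fun z hz => ?_
    have h1 : |z.2| ≤ r := by
      have := hr hz
      rw [mem_closedBall_zero_iff] at this
      exact (norm_snd_le z).trans this
    have h2 : |s - z.2| ≤ dist (x, s) z := by
      rw [← Real.dist_eq]
      exact le_max_right _ _
    have h3 := abs_sub_abs_le_abs_sub s z.2
    have h4 := le_abs_self r
    linarith
  have h0 : gapHeight D x 0 = 0 := by simp [gapHeight]
  rcases le_total (|y|) (|r| + 1) with hy | hy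
  · have := abs_nonneg (gapHeight D x y); linarith
  rcases le_total 0 y with hy0 | hy0
  · rw [abs_of_nonneg hy0] at hy ⊢
    have h1 := gapHeight_sub (D := D) x (|r| + 1) y
    have h2 : ∫ _ in (|r| + 1)..y, (1 : ℝ) ≤ ∫ s in (|r| + 1)..y, Metric.infDist (x, s) D :=
      intervalIntegral.integral_mono_on hy (by simp) (hc.intervalIntegrable _ _) fun s hs =>
        hone s (hs.1.trans (le_abs_self s))
    simp only [intervalIntegral.integral_const, smul_eq_mul, mul_one] at h2
    have h3 := gapHeight_mono (D := D) x (by positivity : (0 : ℝ) ≤ |r| + 1)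
    have h4 := le_abs_self (gapHeight D x y)
    linarith
  · rw [abs_of_nonpos hy0] at hy ⊢
    have h1 := gapHeight_sub (D := D) x y (-(|r| + 1))
    have h2 : ∫ _ in y..(-(|r| + 1)), (1 : ℝ) ≤ ∫ s in y..(-(|r| + 1)), Metric.infDist (x, s) D :=
      intervalIntegral.integral_mono_on (by linarith) (by simp) (hc.intervalIntegrable _ _)
        fun s hs => hone s (by have := neg_le_abs s; have := hs.2; linarith)
    simp only [intervalIntegral.integral_const, smul_eq_mul, mul_one] at h2
    have h3 := gapHeight_mono (D := D) x (neg_nonpos.2 (by positivity : (0 : ℝ) ≤ |r| + 1))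
    have h4 := neg_le_abs (gapHeight D x y)
    linarith

/-- The model of the collapsing map of `D`. -/
noncomputable def flatten (D : Set (ℝ × ℝ)) (p : ℝ × ℝ) : ℝ × ℝ := (p.1, gapHeight D p.1 p.2)

theorem continuous_flatten : Continuous (flatten D) :=
  continuous_fst.prodMk continuous_gapHeight

theorem surjective_flatten (hD : IsCompact D) (hne : D.Nonempty) :
    Function.Surjective (flatten D) := by
  rintro ⟨x, t⟩
  obtain ⟨M, hM0, hM⟩ := exists_le_gapHeight hD hne
  have h0 : gapHeight D x 0 = 0 := by simp [gapHeight]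
  have hc : Continuous (gapHeight D x) :=
    continuous_gapHeight.comp (f := fun y : ℝ => (x, y)) (by fun_prop)
  have hhi : t ≤ gapHeight D x (|t| + M) := by
    have h1 := hM x (|t| + M)
    have h2 := gapHeight_mono (D := D) x (by positivity : 0 ≤ |t| + M)
    rw [h0] at h2
    rw [abs_of_nonneg h2, abs_of_nonneg (by positivity)] at h1
    linarith [le_abs_self t]
  have hlo : gapHeight D x (-(|t| + M)) ≤ t := by
    have h1 := hM x (-(|t| + M))
    have h2 := gapHeight_mono (D := D) x (neg_nonpos.2 (by positivity : 0 ≤ |t| + M))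
    rw [h0] at h2
    rw [abs_of_nonpos h2, abs_neg, abs_of_nonneg (by positivity)] at h1
    linarith [neg_le_abs t]
  obtain ⟨y, hy⟩ := mem_range_of_exists_le_of_exists_ge hc ⟨_, hlo⟩ ⟨_, hhi⟩
  exact ⟨(x, y), Prod.ext rfl hy⟩

theorem isProperMap_flatten (hD : IsCompact D) (hne : D.Nonempty) : IsProperMap (flatten D) := by
  rw [isProperMap_iff_isCompact_preimage]
  refine ⟨continuous_flatten, fun K hK => ?_⟩
  obtain ⟨M, hM0, hM⟩ := exists_le_gapHeight hD hne
  obtain ⟨r, hr⟩ := hK.isBounded.subset_closedBall (0 : ℝ × ℝ)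
  refine (isCompact_closedBall (0 : ℝ × ℝ) (r + M)).of_isClosed_subset
    (hK.isClosed.preimage continuous_flatten) fun p hp => ?_
  have h1 := hr hp
  rw [mem_closedBall_zero_iff] at h1 ⊢
  have h2 := (norm_fst_le (flatten D p)).trans h1
  have h3 := (norm_snd_le (flatten D p)).trans h1
  have h4 := hM p.1 p.2
  simp only [flatten, Real.norm_eq_abs] at h2 h3
  refine norm_prod_le_iff.2 ⟨?_, ?_⟩
  · rw [Real.norm_eq_abs]; linarith
  · rw [Real.norm_eq_abs]; linarith

theorem isConnected_flatten_fiber (hD : IsCompact D) (hne : D.Nonempty) (z : ℝ × ℝ) :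
    IsConnected (flatten D ⁻¹' {z}) := by
  have h : flatten D ⁻¹' {z} = (fun y => (z.1, y)) '' (gapHeight D z.1 ⁻¹' {z.2}) := by
    ext ⟨x, y⟩
    simp only [flatten, mem_preimage, mem_singleton_iff, mem_image, Prod.mk.injEq]
    constructor
    · intro h
      have h1 := congrArg Prod.fst h
      have h2 := congrArg Prod.snd h
      simp only at h1 h2
      exact ⟨y, by rw [← h1]; exact h2, h1.symm, rfl⟩
    · rintro ⟨y', h1, rfl, rfl⟩
      exact Prod.ext rfl h1
  refine ⟨?_, ?_⟩
  · obtain ⟨p, hp⟩ := surjective_flatten hD hne z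
    exact ⟨p, hp⟩
  · rw [h]
    refine IsPreconnected.image (OrdConnected.isPreconnected ?_) _ (by fun_prop)
    exact ordConnected_singleton.preimage_mono (gapHeight_mono z.1)

/-- The map `flatten D` is proper with connected fibers, so that connectedness lifts from the image
of `D`. -/
theorem isConnected_of_flatten_image (hD : IsCompact D) (h : IsConnected (flatten D '' D)) :
    IsConnected D := by
  have hne : D.Nonempty := h.nonempty.of_image
  have hpre : flatten D ⁻¹' (flatten D '' D) = D := by
    refine Subset.antisymm ?_ (subset_preimage_image _ _)
    rintro ⟨x, y⟩ ⟨⟨x', y'⟩, hq, hpq⟩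
    simp only [flatten, Prod.mk.injEq] at hpq
    obtain ⟨rfl, h2⟩ := hpq
    rcases (gapHeight_eq_iff_uIcc hD.isClosed hne).1 h2 with rfl | h3
    · exact hq
    · exact h3 y right_mem_uIcc
  rw [← hpre]
  have hq : IsQuotientMap (flatten D) :=
    (isProperMap_flatten hD hne).isClosedMap.isQuotientMap continuous_flatten
      (surjective_flatten hD hne)
  exact hq.isCoinducing.isConnected_preimage_of_isClosed (isConnected_flatten_fiber hD hne)
    ((hD.image continuous_flatten).isClosed) h

theorem vertRel_canonicalPlane_iff (hD : IsClosed D) (hne : D.Nonempty) (p q : ℝ × ℝ) :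
    VertRel canonicalPlane D p q ↔ flatten D p = flatten D q := by
  obtain ⟨x, y⟩ := p
  obtain ⟨x', y'⟩ := q
  simp only [VertRel, canonicalPlane, flatten, Prod.mk.injEq]
  refine and_congr_right fun hx => ?_
  subst hx
  rw [gapHeight_eq_iff_uIcc hD hne]
  constructor
  · rintro (h | ⟨h, -⟩)
    · right
      set F := Prod.fst ⁻¹' {x} ∩ D with hF
      have h1 : IsPreconnected (Prod.snd '' connectedComponentIn F (x, y)) :=
        isPreconnected_connectedComponentIn.image _ continuous_snd.continuousOn
      intro s hs
      have hmem : (x, y) ∈ F := by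
        by_contra hcon
        rw [connectedComponentIn_eq_empty hcon] at h
        exact h
      have h2 := h1.ordConnected.uIcc_subset ⟨_, mem_connectedComponentIn hmem, rfl⟩ ⟨_, h, rfl⟩ hs
      obtain ⟨⟨x', s'⟩, hz, rfl⟩ := h2
      have h3 := connectedComponentIn_subset _ _ hz
      obtain ⟨h4, h5⟩ := h3
      simp only [mem_preimage, mem_singleton_iff] at h4
      subst h4
      exact h5
    · exact Or.inl h.2
  · rintro (h | h)
    · by_cases hy : (x, y) ∈ D
      · left; rw [← h]; exact mem_connectedComponentIn ⟨rfl, hy⟩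
      · right; exact ⟨⟨rfl, h⟩, hy⟩
    · left
      have h1 : IsPreconnected ((fun s => (x, s)) '' uIcc y y') :=
        isPreconnected_uIcc.image _ (by fun_prop)
      refine h1.subset_connectedComponentIn ⟨y, left_mem_uIcc, rfl⟩ ?_ ⟨y', right_mem_uIcc, rfl⟩
      rintro _ ⟨s, hs, rfl⟩
      exact ⟨rfl, h s hs⟩

/-- The `D`-collapse of the plane is again a plane. -/
theorem exists_collapse_homeomorph (hD : IsCompact D) (hne : D.Nonempty) :
    ∃ K : CollapseSpace canonicalPlane D ≃ₜ ℝ × ℝ,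
      (∀ p, K (collapseMap canonicalPlane D p) = flatten D p) ∧
      (∀ a, (K a).1 = (collapsePlane canonicalPlane D).proj a) ∧
      ∀ a b, (collapsePlane canonicalPlane D).below a b ↔
        (collapsePlane canonicalPlane D).proj a = (collapsePlane canonicalPlane D).proj b ∧
          (K a).2 < (K b).2 := by
  have hrel := vertRel_canonicalPlane_iff hD.isClosed hne
  have hq : IsQuotientMap (flatten D) :=
    (isProperMap_flatten hD hne).isClosedMap.isQuotientMap continuous_flatten
      (surjective_flatten hD hne)
  have hlift : Continuous (Quotient.lift (flatten D) fun p q h => (hrel p q).1 h :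
      CollapseSpace canonicalPlane D → ℝ × ℝ) := continuous_flatten.quotient_lift _
  let E : CollapseSpace canonicalPlane D ≃ ℝ × ℝ :=
    Equiv.ofBijective (Quotient.lift (flatten D) fun p q h => (hrel p q).1 h) (by
      constructor
      · intro a b
        refine Quotient.inductionOn₂ a b fun p q h => ?_
        exact Quotient.sound ((hrel p q).2 h)
      · intro z
        obtain ⟨p, hp⟩ := surjective_flatten hD hne z
        exact ⟨Quotient.mk _ p, hp⟩)
  have hEp : ∀ p, E (collapseMap canonicalPlane D p) = flatten D p := fun _ => rfl
  have hinv : Continuous E.symm := by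
    rw [hq.continuous_iff]
    have : E.symm ∘ flatten D = collapseMap canonicalPlane D := by
      funext p
      rw [Function.comp_apply, ← hEp, E.symm_apply_apply]
    rw [this]
    exact continuous_quotient_mk'
  refine ⟨⟨E, hlift, hinv⟩, hEp, fun a => ?_, fun a b => ?_⟩
  · exact Quotient.inductionOn a fun p => rfl
  · refine Quotient.inductionOn₂ a b fun p q => ?_
    change (_ ≠ _ ∧ _) ↔ p.1 = q.1 ∧ gapHeight D p.1 p.2 < gapHeight D q.1 q.2
    constructor
    · rintro ⟨hne', p', q', hp, hq', h1, h2⟩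
      have hp' := (hrel _ _).1 (Quotient.exact hp)
      have hq'' := (hrel _ _).1 (Quotient.exact hq')
      simp only [flatten, Prod.mk.injEq] at hp' hq''
      have hx : p.1 = q.1 := by rw [← hp'.1, ← hq''.1, h1]
      refine ⟨hx, lt_of_le_of_ne ?_ fun h => hne' ?_⟩
      · rw [← hp'.2, ← hq''.2, h1]
        exact gapHeight_mono _ h2.le
      · exact Quotient.sound ((hrel p q).2 (Prod.ext hx h))
    · rintro ⟨hx, h⟩
      refine ⟨fun heq => ?_, p, q, rfl, rfl, hx, ?_⟩
      · have := (hrel _ _).1 (Quotient.exact heq)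
        simp only [flatten, Prod.mk.injEq] at this
        exact h.ne this.2
      · by_contra hcon
        rw [hx] at h
        exact h.not_ge (gapHeight_mono _ (not_lt.1 hcon))

end GapHeight

/-! ### Piecewise linear interpolation -/

/-- The function that is `0` before `a`, `1` after `b`, and affine in between. -/
noncomputable def ramp (a b y : ℝ) : ℝ := max 0 (min 1 ((y - a) / (b - a)))

theorem ramp_nonneg (a b y : ℝ) : 0 ≤ ramp a b y := le_max_left _ _

theorem ramp_le_one (a b y : ℝ) : ramp a b y ≤ 1 := max_le zero_le_one (min_le_left _ _)

theorem ramp_mono {a b : ℝ} (h : a ≤ b) : Monotone (ramp a b) := by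
  intro y y' hy
  refine max_le_max le_rfl (min_le_min le_rfl ?_)
  exact div_le_div_of_nonneg_right (by linarith) (by linarith)

theorem ramp_of_le {a b y : ℝ} (h : a ≤ b) (hy : y ≤ a) : ramp a b y = 0 :=
  max_eq_left ((min_le_right _ _).trans
    (div_nonpos_of_nonpos_of_nonneg (by linarith) (by linarith)))

theorem ramp_of_ge {a b y : ℝ} (h : a < b) (hy : b ≤ y) : ramp a b y = 1 := by
  have : 1 ≤ (y - a) / (b - a) := (one_le_div (by linarith)).2 (by linarith)
  rw [ramp, min_eq_left this, max_eq_right zero_le_one]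

theorem ramp_lt {a b y y' : ℝ} (hy : a ≤ y) (hyb : y < b) (hyy : y < y') :
    ramp a b y < ramp a b y' := by
  have hab : 0 < b - a := by linarith
  have h1 : 0 ≤ (y - a) / (b - a) := div_nonneg (by linarith) hab.le
  have h2 : (y - a) / (b - a) < 1 := (div_lt_one hab).2 (by linarith)
  have h3 : (y - a) / (b - a) < (y' - a) / (b - a) := div_lt_div_of_pos_right (by linarith) hab
  rw [ramp, min_eq_right h2.le, max_eq_right h1]
  exact (lt_min h2 h3).trans_le (le_max_right _ _)

/-- Two monotone sequences of length `N` with the same coincidences between consecutive terms. -/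
def Matched (N : ℕ) (a q : ℕ → ℝ) : Prop :=
  ∀ i, i + 1 < N → a i ≤ a (i + 1) ∧ q i ≤ q (i + 1) ∧ (a i = a (i + 1) ↔ q i = q (i + 1))

/-- The piecewise linear function that maps `a i` to `q i` for `i < N`, and has slope `1` outside
the interval spanned by the `a i`. -/
noncomputable def interp : ℕ → (ℕ → ℝ) → (ℕ → ℝ) → ℝ → ℝ
  | 0, _, _, y => y
  | M + 1, a, q, y => q 0 + min (y - a 0) 0 +
      ∑ i ∈ Finset.range M, (q (i + 1) - q i) * ramp (a i) (a (i + 1)) y + max (y - a M) 0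

theorem le_of_steps {N : ℕ} {a : ℕ → ℝ} (h : ∀ i, i + 1 < N → a i ≤ a (i + 1)) {i j : ℕ}
    (hij : i ≤ j) (hj : j < N) : a i ≤ a j := by
  induction j, hij using Nat.le_induction with
  | base => exact le_rfl
  | succ j hij ih => exact (ih (by omega)).trans (h j hj)

theorem lt_of_steps {N : ℕ} {a : ℕ → ℝ} (h : ∀ i, i + 1 < N → a i < a (i + 1)) {i j : ℕ}
    (hij : i < j) (hj : j < N) : a i < a j := by
  have h1 := h i (by omega)
  exact h1.trans_le (le_of_steps (fun i hi => (h i hi).le) (by omega) hj)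

theorem interp_apply {N : ℕ} {a q : ℕ → ℝ} (h : Matched N a q) {j : ℕ} (hj : j < N) :
    interp N a q (a j) = q j := by
  cases N with
  | zero => omega
  | succ M =>
    have hmono : ∀ {i j : ℕ}, i ≤ j → j < M + 1 → a i ≤ a j := fun h1 h2 =>
      le_of_steps (fun i hi => (h i hi).1) h1 h2
    have hsum : ∑ i ∈ Finset.range M, (q (i + 1) - q i) * ramp (a i) (a (i + 1)) (a j) =
        ∑ i ∈ Finset.range j, (q (i + 1) - q i) := by
      rw [← Finset.sum_subset (Finset.range_mono (Nat.lt_succ_iff.1 hj))]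
      · refine Finset.sum_congr rfl fun i hi => ?_
        rw [Finset.mem_range] at hi
        obtain ⟨h1, h2, h3⟩ := h i (by omega)
        rcases h1.eq_or_lt with h4 | h4
        · rw [h3.1 h4]; simp
        · rw [ramp_of_ge h4 (hmono (by omega) hj), mul_one]
      · intro i hi hij
        rw [Finset.mem_range] at hi hij
        rw [ramp_of_le (h i (by omega)).1 (hmono (by omega) (by omega)), mul_zero]
    rw [interp, hsum, Finset.sum_range_sub, min_eq_right (sub_nonneg.2 (hmono (Nat.zero_le j) hj)),
      max_eq_right (sub_nonpos.2 (hmono (Nat.lt_succ_iff.1 hj) (Nat.lt_succ_self M)))]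
    ring

theorem interp_strictMono {N : ℕ} {a q : ℕ → ℝ} (h : Matched N a q) :
    StrictMono (interp N a q) := by
  cases N with
  | zero => exact strictMono_id
  | succ M =>
    intro y y' hy
    have hs : ∀ i ∈ Finset.range M, (q (i + 1) - q i) * ramp (a i) (a (i + 1)) y ≤
        (q (i + 1) - q i) * ramp (a i) (a (i + 1)) y' := by
      intro i hi
      rw [Finset.mem_range] at hi
      obtain ⟨h1, h2, h3⟩ := h i (by omega)
      exact mul_le_mul_of_nonneg_left (ramp_mono h1 hy.le) (by linarith)
    have h1 : min (y - a 0) 0 ≤ min (y' - a 0) 0 := min_le_min (by linarith) le_rfl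
    have h2 := Finset.sum_le_sum hs
    have h3 : max (y - a M) 0 ≤ max (y' - a M) 0 := max_le_max (by linarith) le_rfl
    simp only [interp]
    rcases lt_or_ge y (a 0) with hlt | hge
    · have : min (y - a 0) 0 < min (y' - a 0) 0 := by
        rw [min_eq_left (by linarith)]
        exact lt_min (by linarith) (by linarith)
      linarith
    rcases le_or_gt (a M) y with hge' | hlt'
    · have : max (y - a M) 0 < max (y' - a M) 0 := by
        rw [max_eq_left (by linarith)]
        exact lt_of_lt_of_le (by linarith) (le_max_left _ _)
      linarith
    -- `y` lies in some interval `[a i, a (i + 1))`, and the corresponding term is increasing there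
    have hex : ∃ i < M, a i ≤ y ∧ y < a (i + 1) := by
      by_contra! hcon
      have : ∀ i ≤ M, a i ≤ y := by
        intro i
        induction i with
        | zero => intro _; exact hge
        | succ i ih => intro hi; exact hcon i (by omega) (ih (by omega))
      exact absurd (this M le_rfl) (not_le.2 hlt')
    obtain ⟨i, hi, hi1, hi2⟩ := hex
    obtain ⟨h4, h5, h6⟩ := h i (by omega)
    have h7 : q i < q (i + 1) := lt_of_le_of_ne h5 fun h => by
      have := h6.2 h; linarith
    have := Finset.sum_lt_sum hs ⟨i, Finset.mem_range.2 hi,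
      mul_lt_mul_of_pos_left (ramp_lt hi1 hi2 hy) (by linarith)⟩
    linarith

theorem interp_unbounded {N : ℕ} {a q : ℕ → ℝ} (h : Matched N a q) (t : ℝ) :
    (∃ y, t ≤ interp N a q y) ∧ ∃ y, interp N a q y ≤ t := by
  cases N with
  | zero => exact ⟨⟨t, le_rfl⟩, ⟨t, le_rfl⟩⟩
  | succ M =>
    have hq : ∀ i ∈ Finset.range M, ∀ y, 0 ≤ (q (i + 1) - q i) * ramp (a i) (a (i + 1)) y := by
      intro i hi y
      rw [Finset.mem_range] at hi
      exact mul_nonneg (by linarith [(h i (by omega)).2.1]) (ramp_nonneg _ _ _)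
    have hM : a 0 ≤ a M := le_of_steps (fun i hi => (h i hi).1) (Nat.zero_le M) (Nat.lt_succ_self M)
    constructor
    · refine ⟨max (a 0) (a M + (t - q 0)), ?_⟩
      set y := max (a 0) (a M + (t - q 0))
      have h1 := Finset.sum_nonneg fun i hi => hq i hi y
      have h2 : a 0 ≤ y := le_max_left _ _
      have h3 : a M + (t - q 0) ≤ y := le_max_right _ _
      have h4 : min (y - a 0) 0 = 0 := min_eq_right (by linarith)
      have h5 := le_max_left (y - a M) 0
      simp only [interp]
      linarith
    · refine ⟨min (a 0) (a 0 + (t - q 0)), ?_⟩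
      set y := min (a 0) (a 0 + (t - q 0))
      have h2 : y ≤ a 0 := min_le_left _ _
      have h3 : y ≤ a 0 + (t - q 0) := min_le_right _ _
      have h1 : ∑ i ∈ Finset.range M, (q (i + 1) - q i) * ramp (a i) (a (i + 1)) y = 0 := by
        refine Finset.sum_eq_zero fun i hi => ?_
        rw [Finset.mem_range] at hi
        rw [ramp_of_le (h i (by omega)).1, mul_zero]
        exact h2.trans (le_of_steps (fun i hi => (h i hi).1) (Nat.zero_le i) (by omega))
      have h4 := min_le_left (y - a 0) 0
      have h5 : max (y - a M) 0 = 0 := max_eq_right (by linarith)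
      simp only [interp, h1, h5]
      linarith

theorem continuousAt_interp {N : ℕ} {a q : ℕ → ℝ → ℝ} {x₀ : ℝ}
    (h : Matched N (fun i => a i x₀) (fun i => q i x₀))
    (ha : ∀ i < N, ContinuousAt (a i) x₀) (hq : ∀ i < N, ContinuousAt (q i) x₀) (y₀ : ℝ) :
    ContinuousAt (fun z : ℝ × ℝ => interp N (fun i => a i z.1) (fun i => q i z.1) z.2)
      (x₀, y₀) := by
  have hfst : ∀ {f : ℝ → ℝ}, ContinuousAt f x₀ →
      ContinuousAt (fun z : ℝ × ℝ => f z.1) (x₀, y₀) := fun hf =>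
    ContinuousAt.comp (f := fun z : ℝ × ℝ => z.1) hf continuousAt_fst
  cases N with
  | zero => exact continuousAt_snd
  | succ M =>
    simp only [interp]
    refine ((((hfst (hq 0 (by omega))).add ?_).add ?_).add ?_)
    · exact (continuousAt_snd.sub (hfst (ha 0 (by omega)))).min continuousAt_const
    · refine tendsto_finsetSum _ fun i hi => ?_
      rw [Finset.mem_range] at hi
      have ha0 := hfst (ha i (by omega))
      have ha1 := hfst (ha (i + 1) (by omega))
      have hd : ContinuousAt (fun z : ℝ × ℝ => q (i + 1) z.1 - q i z.1) (x₀, y₀) :=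
        (hfst (hq (i + 1) (by omega))).sub (hfst (hq i (by omega)))
      by_cases hne : a i x₀ = a (i + 1) x₀
      · -- the interval collapses: the term is squeezed by its increment
        have hq0 : q (i + 1) x₀ - q i x₀ = 0 := by
          rw [sub_eq_zero]; exact (((h i (by omega)).2.2).1 hne).symm
        simp only [hq0, zero_mul]
        refine squeeze_zero_norm (a := fun z : ℝ × ℝ => ‖q (i + 1) z.1 - q i z.1‖) (fun z => ?_) ?_
        · rw [norm_mul, Real.norm_eq_abs (ramp _ _ _), abs_of_nonneg (ramp_nonneg _ _ _)]
          exact mul_le_of_le_one_right (norm_nonneg _) (ramp_le_one _ _ _)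
        · have := hd.norm
          rw [ContinuousAt, hq0, norm_zero] at this
          exact this
      · refine hd.mul ?_
        unfold ramp
        refine continuousAt_const.max (continuousAt_const.min ?_)
        exact (continuousAt_snd.sub ha0).div (ha1.sub ha0) (sub_ne_zero.2 (Ne.symm hne))
    · exact (continuousAt_snd.sub (hfst (ha M (by omega)))).max continuousAt_const

/-- Finitely many values of an increasing homeomorphism of the line can be prescribed. -/
theorem exists_homeomorph_interpolating {n : ℕ} {v v' : ℕ → ℝ}
    (hv : ∀ i, i + 1 < n → v i < v (i + 1)) (hv' : ∀ i, i + 1 < n → v' i < v' (i + 1)) :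
    ∃ ψ : ℝ ≃ₜ ℝ, StrictMono ψ ∧ ∀ i < n, ψ (v i) = v' i := by
  have hM : Matched n v v' := fun i hi =>
    ⟨(hv i hi).le, (hv' i hi).le, iff_of_false (hv i hi).ne (hv' i hi).ne⟩
  have hmono := interp_strictMono hM
  have hcont : Continuous (interp n v v') := by
    rw [continuous_iff_continuousAt]
    intro y
    have := continuousAt_interp (a := fun i _ => v i) (q := fun i _ => v' i) (x₀ := 0) hM
      (fun _ _ => continuousAt_const) (fun _ _ => continuousAt_const) y
    exact ContinuousAt.comp (f := fun y : ℝ => ((0 : ℝ), y)) this (by fun_prop)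
  have hsurj : Function.Surjective (interp n v v') := fun t =>
    mem_range_of_exists_le_of_exists_ge hcont (interp_unbounded hM t).2 (interp_unbounded hM t).1
  refine ⟨(hmono.orderIsoOfSurjective _ hsurj).toHomeomorph, fun x y h => hmono h, fun i hi => ?_⟩
  exact interp_apply hM hi

/-! ### Combinatorial patterns of plane graphs -/

/-- Near `x₀`, the set `A` is described by the `N` continuous functions `q 0 ≤ q 1 ≤ ⋯`: over `x`,
the strands `i` and `i + 1` coincide when `glued i x`, and `A` consists of the strands that are
not `virtual`. -/
def LocalStrands (A : Set (ℝ × ℝ)) (x₀ : ℝ) (N : ℕ) (glued virtual : ℕ → ℝ → Prop)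
    (q : ℕ → ℝ → ℝ) : Prop :=
  ∀ᶠ x in 𝓝 x₀, (∀ i < N, ContinuousAt (q i) x) ∧
    (∀ i, i + 1 < N → q i x ≤ q (i + 1) x ∧ (q i x = q (i + 1) x ↔ glued i x)) ∧
    ∀ y, (x, y) ∈ A ↔ ∃ i < N, ¬ virtual i x ∧ q i x = y

/-- Near `x₀`, the set `A` consists of `k` disjoint graphs of continuous functions. -/
def RegularAt (A : Set (ℝ × ℝ)) (x₀ : ℝ) (k : ℕ) : Prop :=
  ∃ q, LocalStrands A x₀ k (fun _ _ => False) (fun _ _ => False) q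

/-- At `x₀` the number of strands of `A` changes between `k` and `k + 1`, at the point `(x₀, c)`.
There are `k + 1` strands on the right if `e = 1`, on the left if `e = -1`. If each strand is
doubled, then the change is the insertion of two new strands at the position `p`:
for `p = 2 * i`, a new strand with index `i` is born; for `p = 2 * i + 1`, the strand with
index `i` splits. -/
def EventAt (A : Set (ℝ × ℝ)) (x₀ e : ℝ) (k p : ℕ) (c : ℝ) : Prop :=
  ∃ q, LocalStrands A x₀ (k + 1) (fun i x => p = 2 * i + 1 ∧ e * (x - x₀) ≤ 0)
    (fun i x => p = 2 * i ∧ e * (x - x₀) < 0) q ∧ q (p / 2) x₀ = c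

/-- The number of the first `n` terms of `v` that are smaller than `x`. -/
noncomputable def countBelow (n : ℕ) (v : ℕ → ℝ) (x : ℝ) : ℕ :=
  ((Finset.range n).filter fun i => v i < x).card

/-- The set `A` has `n` events, at the points `(v i, c i)` with abscissas in increasing order, and
`k i` strands between the events `i - 1` and `i`. -/
structure HasPattern (A : Set (ℝ × ℝ)) (n : ℕ) (k p : ℕ → ℕ) (e : ℕ → ℝ) (v c : ℕ → ℝ) :
    Prop where
  lt_succ : ∀ i, i + 1 < n → v i < v (i + 1)
  event : ∀ i < n, EventAt A (v i) (e i) (min (k i) (k (i + 1))) (p i) (c i)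
  regular : ∀ x, (∀ i < n, v i ≠ x) → RegularAt A x (k (countBelow n v x))

/-- The patterns that occur: the graph is empty at both ends, and the events insert or remove a
strand at a position that exists. -/
structure ValidPattern (n : ℕ) (k p : ℕ → ℕ) (e : ℕ → ℝ) : Prop where
  start : k 0 = 0
  finish : k n = 0
  step : ∀ i < n, (e i = 1 ∧ k (i + 1) = k i + 1) ∨ (e i = -1 ∧ k i = k (i + 1) + 1)
  pos_le : ∀ i < n, p i ≤ 2 * min (k i) (k (i + 1))

/-- A monotone bijection between finite sets of reals is unique. -/
theorem eqOn_of_strictMono_of_image_eq {f g : ℝ → ℝ} (hf : StrictMono f) (hg : StrictMono g)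
    {S : Set ℝ} (hS : S.Finite) (h : f '' S = g '' S) : EqOn f g S := by
  by_contra hcon
  simp only [EqOn, not_forall] at hcon
  obtain ⟨s₀, hs₀, hne₀⟩ := hcon
  have hfin : {s | s ∈ S ∧ f s ≠ g s}.Finite := hS.subset fun s hs => hs.1
  obtain ⟨s, ⟨hsS, hne⟩, hmin⟩ := exists_min_image _ id hfin ⟨s₀, hs₀, hne₀⟩
  have hmin' : ∀ t ∈ S, t < s → f t = g t := by
    intro t ht hts
    by_contra hne'
    exact absurd (hmin t ⟨ht, hne'⟩) (not_le.2 hts)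
  rcases lt_or_gt_of_ne hne with hlt | hlt
  · obtain ⟨t, ht, hts⟩ := h ▸ mem_image_of_mem f hsS
    have hlt' : t < s := hg.lt_iff_lt.1 (hts.trans_lt hlt)
    have := hmin' t ht hlt'
    rw [hts] at this
    exact hlt'.ne (hf.injective this)
  · obtain ⟨t, ht, hts⟩ := h.symm ▸ mem_image_of_mem g hsS
    have hlt' : t < s := hf.lt_iff_lt.1 (hts.trans_lt hlt)
    have := hmin' t ht hlt'
    rw [hts] at this
    exact hlt'.ne (hg.injective this.symm)

/-- The functions that are increasing and unbounded on the vertical line over `x`, and map the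
points of `A` over `x` onto the points of `B` over `ψ x`. -/
def fiberMatching (A B : Set (ℝ × ℝ)) (ψ : ℝ → ℝ) (x : ℝ) : Set (ℝ × ℝ → ℝ) :=
  {y | y ∈ fiberMono canonicalPlane x ∧
    (fun t => y (x, t)) '' {t | (x, t) ∈ A} = {t | (ψ x, t) ∈ B}}

theorem fiberMatching_eq {A B : Set (ℝ × ℝ)} {ψ : ℝ → ℝ} {x : ℝ} (hfin : {t | (x, t) ∈ A}.Finite)
    {y y' : ℝ × ℝ → ℝ} (hy : y ∈ fiberMatching A B ψ x) (hy' : y' ∈ fiberMatching A B ψ x) {t : ℝ}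
    (ht : (x, t) ∈ A) : y (x, t) = y' (x, t) :=
  eqOn_of_strictMono_of_image_eq (f := fun t => y (x, t)) (g := fun t => y' (x, t))
    (fun _ _ h => hy.1.1 _ _ rfl ⟨rfl, h⟩) (fun _ _ h => hy'.1.1 _ _ rfl ⟨rfl, h⟩) hfin
    (hy.2.trans hy'.2.symm) ht

theorem convex_fiberMatching {A B : Set (ℝ × ℝ)} {ψ : ℝ → ℝ} {x : ℝ}
    (hfin : {t | (x, t) ∈ A}.Finite) : Convex ℝ (fiberMatching A B ψ x) := by
  intro y hy y' hy' a b ha hb hab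
  refine ⟨isVerticalPlane_canonicalPlane.convex_fiberMono x hy.1 hy'.1 ha hb hab, ?_⟩
  rw [← hy.2]
  refine image_congr fun t ht => ?_
  simp only [Pi.add_apply, Pi.smul_apply, smul_eq_mul]
  rw [← fiberMatching_eq hfin hy hy' ht, ← add_mul, hab, one_mul]

theorem LocalStrands.finite {A : Set (ℝ × ℝ)} {x₀ : ℝ} {N : ℕ} {gl vi : ℕ → ℝ → Prop}
    {q : ℕ → ℝ → ℝ} (h : LocalStrands A x₀ N gl vi q) : {t | (x₀, t) ∈ A}.Finite := by
  obtain ⟨-, -, h3⟩ := h.self_of_nhds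
  refine ((Finset.range N).finite_toSet.image fun i => q i x₀).subset fun t ht => ?_
  obtain ⟨i, hi, -, rfl⟩ := (h3 t).1 ht
  exact ⟨i, by simpa using hi, rfl⟩

/-- Two sets with corresponding strands are matched by interpolation between the strands. -/
theorem LocalStrands.exists_matching {A B : Set (ℝ × ℝ)} {ψ : ℝ ≃ₜ ℝ} {x₀ : ℝ} {N : ℕ}
    {gl vi gl' vi' : ℕ → ℝ → Prop} {q q' : ℕ → ℝ → ℝ} (hA : LocalStrands A x₀ N gl vi q)
    (hB : LocalStrands B (ψ x₀) N gl' vi' q') (hgl : ∀ i x, gl' i (ψ x) ↔ gl i x)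
    (hvi : ∀ i x, vi' i (ψ x) ↔ vi i x) :
    ∃ U, IsOpen U ∧ x₀ ∈ U ∧ ∃ y : ℝ × ℝ → ℝ, ContinuousOn y (Prod.fst ⁻¹' U) ∧
      (∀ x ∈ U, y ∈ fiberMatching A B ψ x) ∧ ∀ i < N, y (x₀, q i x₀) = q' i (ψ x₀) := by
  have hB' := ψ.continuous.continuousAt.eventually hB
  obtain ⟨U, hU, hUo, hxU⟩ := eventually_nhds_iff.1 (hA.and hB')
  have hM : ∀ x ∈ U, Matched N (fun i => q i x) (fun i => q' i (ψ x)) := by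
    intro x hx i hi
    obtain ⟨⟨-, h2, -⟩, -, h2', -⟩ := hU x hx
    exact ⟨(h2 i hi).1, (h2' i hi).1, by rw [(h2 i hi).2, (h2' i hi).2, hgl]⟩
  refine ⟨U, hUo, hxU, fun z => interp N (fun i => q i z.1) (fun i => q' i (ψ z.1)) z.2,
    ?_, ?_, fun i hi => interp_apply (hM x₀ hxU) hi⟩
  · rintro ⟨x, y⟩ hx
    obtain ⟨⟨h1, -, -⟩, h1', -, -⟩ := hU x hx
    exact (continuousAt_interp (q := fun i x => q' i (ψ x)) (hM x hx) h1
      (fun i hi => (h1' i hi).comp ψ.continuous.continuousAt) y).continuousWithinAt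
  · intro x hx
    obtain ⟨⟨-, -, h3⟩, -, -, h3'⟩ := hU x hx
    refine ⟨⟨?_, fun M => ?_⟩, ?_⟩
    · rintro ⟨a, b⟩ ⟨a', b'⟩ rfl ⟨hab, hlt⟩
      simp only at hab hlt
      subst hab
      exact interp_strictMono (hM _ hx) hlt
    · obtain ⟨⟨y, hy⟩, y', hy'⟩ := interp_unbounded (hM x hx) M
      exact ⟨⟨(x, y), rfl, hy⟩, (x, y'), rfl, hy'⟩
    · ext t
      simp only [mem_image, mem_ofPred_eq, h3, h3', hvi]
      constructor
      · rintro ⟨_, ⟨i, hi, hv, rfl⟩, rfl⟩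
        exact ⟨i, hi, hv, (interp_apply (hM x hx) hi).symm⟩
      · rintro ⟨i, hi, hv, rfl⟩
        exact ⟨_, ⟨i, hi, hv, rfl⟩, interp_apply (hM x hx) hi⟩

/-- A set with a pattern is determined by the pattern, up to a homeomorphism of the plane that
respects the projection and the orientations. -/
theorem HasPattern.exists_homeomorph {A B : Set (ℝ × ℝ)} {n : ℕ} {k p : ℕ → ℕ}
    {e v c v' c' : ℕ → ℝ} (hA : HasPattern A n k p e v c) (hB : HasPattern B n k p e v' c')
    (hval : ValidPattern n k p e) :
    ∃ (ψ : ℝ ≃ₜ ℝ) (M : ℝ × ℝ ≃ₜ ℝ × ℝ), StrictMono ψ ∧ (∀ z, (M z).1 = ψ z.1) ∧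
      (∀ z w, z.1 = w.1 → (z.2 < w.2 ↔ (M z).2 < (M w).2)) ∧ M '' A = B ∧
      ∀ i < n, M (v i, c i) = (v' i, c' i) := by
  obtain ⟨ψ, hψ, hψv⟩ := exists_homeomorph_interpolating hA.lt_succ hB.lt_succ
  have hidx : ∀ x, countBelow n v' (ψ x) = countBelow n v x := by
    intro x
    unfold countBelow
    congr 1
    refine Finset.filter_congr fun i hi => ?_
    rw [← hψv i (Finset.mem_range.1 hi), hψ.lt_iff_lt]
  have hsign : ∀ i < n, ∀ x, (e i * (ψ x - ψ (v i)) ≤ 0 ↔ e i * (x - v i) ≤ 0) ∧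
      (e i * (ψ x - ψ (v i)) < 0 ↔ e i * (x - v i) < 0) := by
    intro i hi x
    have h1 : (ψ x < ψ (v i) ↔ x < v i) := hψ.lt_iff_lt
    have h2 : (ψ x ≤ ψ (v i) ↔ x ≤ v i) := hψ.le_iff_le
    have h3 : (ψ (v i) < ψ x ↔ v i < x) := hψ.lt_iff_lt
    have h4 : (ψ (v i) ≤ ψ x ↔ v i ≤ x) := hψ.le_iff_le
    rcases hval.step i hi with ⟨h, -⟩ | ⟨h, -⟩
    · rw [h]
      simp only [one_mul, sub_nonpos, sub_neg, h1, h2, and_self]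
    · rw [h]
      simp only [neg_mul, one_mul, neg_sub, sub_nonpos, sub_neg, h3, h4, and_self]
  have hevent : ∀ i < n, {t | (v i, t) ∈ A}.Finite ∧ (v i, c i) ∈ A ∧
      ∃ U, IsOpen U ∧ v i ∈ U ∧ ∃ y : ℝ × ℝ → ℝ, ContinuousOn y (Prod.fst ⁻¹' U) ∧
      (∀ x ∈ U, y ∈ fiberMatching A B ψ x) ∧ y (v i, c i) = c' i := by
    intro i hi
    obtain ⟨q, hq, hc⟩ := hA.event i hi
    obtain ⟨q', hq', hc'⟩ := hB.event i hi
    have hple : p i / 2 < min (k i) (k (i + 1)) + 1 := by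
      have := hval.pos_le i hi; omega
    refine ⟨hq.finite, ?_, ?_⟩
    · obtain ⟨-, -, h3⟩ := hq.self_of_nhds
      exact (h3 (c i)).2 ⟨p i / 2, hple, by simp, hc⟩
    · rw [← hψv i hi] at hq' hc'
      obtain ⟨U, hU, hx, y, hy1, hy2, hy3⟩ := hq.exists_matching hq'
        (fun j x => and_congr_right fun _ => (hsign i hi x).1)
        (fun j x => and_congr_right fun _ => (hsign i hi x).2)
      refine ⟨U, hU, hx, y, hy1, hy2, ?_⟩
      have := hy3 (p i / 2) hple
      rw [hc, hc'] at this
      exact this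
  have hfin : ∀ x, {t | (x, t) ∈ A}.Finite := by
    intro x
    by_cases hx : ∀ i < n, v i ≠ x
    · obtain ⟨q, hq⟩ := hA.regular x hx
      exact hq.finite
    · push Not at hx
      obtain ⟨i, hi, rfl⟩ := hx
      exact (hevent i hi).1
  obtain ⟨y, hyc, hy⟩ := exists_continuous_of_local_fiberwise_convex (P := ℝ × ℝ) continuous_fst
    (fiberMatching A B ψ) (fun x => convex_fiberMatching (hfin x))
    (fun x y y' h hy => ⟨fiberMono_congr isVerticalPlane_canonicalPlane x y y' h hy.1, by
      rw [← hy.2]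
      exact image_congr fun t _ => (h (x, t) rfl).symm⟩)
    (fun x₀ => by
      by_cases hx : ∀ i < n, v i ≠ x₀
      · obtain ⟨q, hq⟩ := hA.regular x₀ hx
        obtain ⟨q', hq'⟩ := hB.regular (ψ x₀) (fun i hi h => hx i hi (by
          rw [← hψv i hi] at h; exact ψ.injective h))
        rw [hidx] at hq'
        obtain ⟨U, hU, hxU, y, hy1, hy2, -⟩ := hq.exists_matching hq' (fun _ _ => Iff.rfl)
          (fun _ _ => Iff.rfl)
        exact ⟨U, hU, hxU, y, hy1, hy2⟩
      · push Not at hx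
        obtain ⟨i, hi, rfl⟩ := hx
        obtain ⟨-, -, U, hU, hxU, y, hy1, hy2, -⟩ := hevent i hi
        exact ⟨U, hU, hxU, y, hy1, hy2⟩)
  obtain ⟨K, hK, hKb⟩ := isVerticalPlane_canonicalPlane.exists_homeomorph hyc fun x => (hy x).1
  let Ψ : ℝ × ℝ ≃ₜ ℝ × ℝ := ψ.prodCongr (Homeomorph.refl ℝ)
  have hM : ∀ z, (K.trans Ψ) z = (ψ z.1, y z) := by
    intro z
    rw [Homeomorph.trans_apply, hK]
    rfl
  refine ⟨ψ, K.trans Ψ, hψ, fun z => by rw [hM], fun z w hzw => ?_, ?_, fun i hi => ?_⟩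
  · have := hKb z w
    simp only [canonicalPlane, hzw, true_and] at this
    rw [this, hM, hM]
  · ext ⟨s, t⟩
    constructor
    · rintro ⟨⟨x, u⟩, hxA, hxu⟩
      rw [hM, Prod.mk.injEq] at hxu
      obtain ⟨rfl, rfl⟩ := hxu
      have h2 : y (x, u) ∈ {t | (ψ x, t) ∈ B} := (hy x).2 ▸ ⟨u, hxA, rfl⟩
      exact h2
    · intro hB
      have h2 : t ∈ {t | (ψ (ψ.symm s), t) ∈ B} := by simpa using hB
      rw [← (hy (ψ.symm s)).2] at h2
      obtain ⟨u, hu, hut⟩ := h2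
      refine ⟨(ψ.symm s, u), hu, ?_⟩
      rw [hM]
      exact Prod.ext (by simp) hut
  · obtain ⟨hf, hcA, U, -, hvU, y', -, hy', hyc'⟩ := hevent i hi
    rw [hM, Prod.mk.injEq]
    refine ⟨hψv i hi, ?_⟩
    rw [fiberMatching_eq hf (hy (v i)) (hy' _ hvU) hcA, hyc']

/-! ### The pattern of a system of edges over intervals -/

theorem exists_sorting {ι : Type*} [Nonempty ι] (T : Finset ι) (h : ι → ℝ) (hinj : InjOn h T) :
    ∃ σ : ℕ → ι, (∀ i < T.card, σ i ∈ T) ∧ (∀ E ∈ T, ∃ i < T.card, σ i = E) ∧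
      ∀ i, i + 1 < T.card → h (σ i) < h (σ (i + 1)) := by
  classical
  have hcard : (T.image h).card = T.card := Finset.card_image_of_injOn hinj
  have hex : ∀ i, ∃ E, ∀ hi : i < T.card, E ∈ T ∧ h E = (T.image h).orderEmbOfFin hcard ⟨i, hi⟩ := by
    intro i
    by_cases hi : i < T.card
    · have := (T.image h).orderEmbOfFin_mem hcard ⟨i, hi⟩
      rw [Finset.mem_image] at this
      obtain ⟨E, hE, hEi⟩ := this
      exact ⟨E, fun _ => ⟨hE, hEi⟩⟩
    · exact ⟨Classical.arbitrary ι, fun h => absurd h hi⟩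
  choose σ hσ using hex
  refine ⟨σ, fun i hi => (hσ i hi).1, fun E hE => ?_, fun i hi => ?_⟩
  · have h1 : h E ∈ range ((T.image h).orderEmbOfFin hcard) := by
      rw [Finset.range_orderEmbOfFin]
      exact Finset.mem_coe.2 (Finset.mem_image_of_mem h hE)
    obtain ⟨i, hi⟩ := h1
    exact ⟨i, i.2, hinj (hσ i i.2).1 hE ((hσ i i.2).2.trans hi)⟩
  · rw [(hσ i (by omega)).2, (hσ (i + 1) hi).2]
    exact ((T.image h).orderEmbOfFin hcard).strictMono (Fin.mk_lt_mk.2 (Nat.lt_succ_self i))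

theorem eventually_all_lt {x₀ : ℝ} {N : ℕ} {a b : ℕ → ℝ → ℝ} {Q : ℕ → Prop}
    (ha : ∀ i, Continuous (a i)) (hb : ∀ i, Continuous (b i))
    (h : ∀ i < N, Q i → a i x₀ < b i x₀) :
    ∀ᶠ x in 𝓝 x₀, ∀ i < N, Q i → a i x < b i x := by
  have : ∀ᶠ x in 𝓝 x₀, ∀ i ∈ Finset.range N, Q i → a i x < b i x := by
    rw [Finset.eventually_all]
    intro i hi
    by_cases hQ : Q i
    · have := (ha i).continuousAt.eventually_lt (hb i).continuousAt
        (h i (Finset.mem_range.1 hi) hQ)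
      filter_upwards [this] with x hx _ using hx
    · exact Filter.Eventually.of_forall fun x h => absurd h hQ
  filter_upwards [this] with x hx i hi using hx i (Finset.mem_range.2 hi)

section LocalSort

variable {ι : Type*} {A : Set (ℝ × ℝ)} {x₀ : ℝ} {g : ι → ℝ → ℝ}

theorem regularAt_of_edges [Nonempty ι] (hg : ∀ E, Continuous (g E)) (T : Finset ι)
    (hinj : InjOn (fun E => g E x₀) T)
    (hA : ∀ᶠ x in 𝓝 x₀, ∀ y, (x, y) ∈ A ↔ ∃ E ∈ T, g E x = y) : RegularAt A x₀ T.card := by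
  obtain ⟨σ, h1, h2, h3⟩ := exists_sorting T _ hinj
  refine ⟨fun i => g (σ i), ?_⟩
  have h4 := eventually_all_lt (N := T.card) (Q := fun i => i + 1 < T.card) (x₀ := x₀)
    (fun i => hg (σ i)) (fun i => hg (σ (i + 1))) (fun i _ hi => h3 i hi)
  filter_upwards [hA, h4] with x hx hx4
  refine ⟨fun i _ => (hg _).continuousAt, fun i hi => ?_, fun y => ?_⟩
  · have := hx4 i (by omega) hi
    exact ⟨this.le, iff_of_false this.ne id⟩
  · rw [hx]
    constructor
    · rintro ⟨E, hE, rfl⟩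
      obtain ⟨i, hi, rfl⟩ := h2 E hE
      exact ⟨i, hi, id, rfl⟩
    · rintro ⟨i, hi, -, rfl⟩
      exact ⟨_, h1 i hi, rfl⟩

/-- A new edge appears at `(x₀, z)`, disjoint from the edges in `T`. -/
theorem eventAt_birth (hg : ∀ E, Continuous (g E)) {e z : ℝ} (T : Finset ι) (E₀ : ι)
    (hE₀ : E₀ ∉ T) (hinj : InjOn (fun E => g E x₀) T) (hz : g E₀ x₀ = z)
    (hTz : ∀ E ∈ T, g E x₀ ≠ z)
    (hA : ∀ᶠ x in 𝓝 x₀, ∀ y, (x, y) ∈ A ↔ ∃ E, g E x = y ∧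
      (E ∈ T ∨ E = E₀ ∧ 0 ≤ e * (x - x₀))) :
    ∃ j ≤ T.card, EventAt A x₀ e T.card (2 * j) z := by
  classical
  have : Nonempty ι := ⟨E₀⟩
  have hcard : (insert E₀ T).card = T.card + 1 := Finset.card_insert_of_notMem hE₀
  have hinj' : InjOn (fun E => g E x₀) (insert E₀ T : Finset ι) := by
    rw [Finset.coe_insert, injOn_insert (by simpa using hE₀)]
    refine ⟨hinj, ?_⟩
    rintro ⟨E, hE, h⟩
    exact hTz E hE (h.trans hz)
  obtain ⟨σ, h1, h2, h3⟩ := exists_sorting _ _ hinj'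
  rw [hcard] at h1 h2 h3
  obtain ⟨j, hj, hjE⟩ := h2 E₀ (Finset.mem_insert_self _ _)
  have hσinj : ∀ i < T.card + 1, σ i = E₀ → i = j := by
    intro i hi hi'
    rcases lt_trichotomy i j with h | h | h
    · have := lt_of_steps (a := fun i => g (σ i) x₀) (N := T.card + 1) h3 h hj
      rw [hi', hjE] at this
      exact absurd this (lt_irrefl _)
    · exact h
    · have := lt_of_steps (a := fun i => g (σ i) x₀) (N := T.card + 1) h3 h hi
      rw [hi', hjE] at this
      exact absurd this (lt_irrefl _)
  refine ⟨j, by omega, fun i => g (σ i), ?_, ?_⟩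
  · have h4 := eventually_all_lt (N := T.card + 1) (Q := fun i => i + 1 < T.card + 1) (x₀ := x₀)
      (fun i => hg (σ i)) (fun i => hg (σ (i + 1))) (fun i _ hi => h3 i hi)
    filter_upwards [hA, h4] with x hx hx4
    refine ⟨fun i _ => (hg _).continuousAt, fun i hi => ?_, fun y => ?_⟩
    · have := hx4 i (by omega) hi
      exact ⟨this.le, iff_of_false this.ne (by omega)⟩
    · rw [hx]
      constructor
      · rintro ⟨E, rfl, hE | ⟨rfl, hE⟩⟩
        · obtain ⟨i, hi, rfl⟩ := h2 E (Finset.mem_insert_of_mem hE)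
          refine ⟨i, hi, fun h => hE₀ ?_, rfl⟩
          rw [← hjE, show j = i by omega]; exact hE
        · exact ⟨j, hj, fun h => absurd h.2 (not_lt.2 hE), by rw [hjE]⟩
      · rintro ⟨i, hi, hv, rfl⟩
        refine ⟨σ i, rfl, ?_⟩
        rcases Finset.mem_insert.1 (h1 i hi) with h | h
        · right
          refine ⟨h, not_lt.1 fun hlt => hv ⟨?_, hlt⟩⟩
          rw [hσinj i hi h]
        · exact Or.inl h
  · rw [Nat.mul_div_cancel_left _ (by norm_num)]
    change g (σ j) x₀ = z
    rw [hjE, hz]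

/-- The edge `E₀` splits into `E₁` and `E₂` at `(x₀, z)`, away from the edges in `T`. -/
theorem eventAt_split (hg : ∀ E, Continuous (g E)) {e z : ℝ} (T : Finset ι) (E₀ E₁ E₂ : ι)
    (hE₀ : E₀ ∉ T) (hinj : InjOn (fun E => g E x₀) T) (hz : g E₀ x₀ = z) (hz₁ : g E₁ x₀ = z)
    (hz₂ : g E₂ x₀ = z) (hTz : ∀ E ∈ T, g E x₀ ≠ z)
    (hne : ∀ᶠ x in 𝓝 x₀, 0 < e * (x - x₀) → g E₁ x ≠ g E₂ x)
    (he : e ≠ 0)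
    (hA : ∀ᶠ x in 𝓝 x₀, ∀ y, (x, y) ∈ A ↔ ∃ E, g E x = y ∧
      (E ∈ T ∨ E = E₀ ∧ e * (x - x₀) ≤ 0 ∨ (E = E₁ ∨ E = E₂) ∧ 0 ≤ e * (x - x₀))) :
    ∃ j ≤ T.card, EventAt A x₀ e (T.card + 1) (2 * j + 1) z := by
  classical
  have : Nonempty ι := ⟨E₀⟩
  have hcard : (insert E₀ T).card = T.card + 1 := Finset.card_insert_of_notMem hE₀
  have hinj' : InjOn (fun E => g E x₀) (insert E₀ T : Finset ι) := by
    rw [Finset.coe_insert, injOn_insert (by simpa using hE₀)]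
    refine ⟨hinj, ?_⟩
    rintro ⟨E, hE, h⟩
    exact hTz E hE (h.trans hz)
  obtain ⟨σ, h1, h2, h3⟩ := exists_sorting _ _ hinj'
  rw [hcard] at h1 h2 h3
  obtain ⟨j, hj, hjE⟩ := h2 E₀ (Finset.mem_insert_self _ _)
  have hσinj : ∀ i < T.card + 1, σ i = E₀ → i = j := by
    intro i hi hi'
    rcases lt_trichotomy i j with h | h | h
    · have := lt_of_steps (a := fun i => g (σ i) x₀) (N := T.card + 1) h3 h hj
      rw [hi', hjE] at this
      exact absurd this (lt_irrefl _)
    · exact h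
    · have := lt_of_steps (a := fun i => g (σ i) x₀) (N := T.card + 1) h3 h hi
      rw [hi', hjE] at this
      exact absurd this (lt_irrefl _)
  let lo : ℝ → ℝ := fun x => if e * (x - x₀) ≤ 0 then g E₀ x else min (g E₁ x) (g E₂ x)
  let hi : ℝ → ℝ := fun x => if e * (x - x₀) ≤ 0 then g E₀ x else max (g E₁ x) (g E₂ x)
  have hx₀ : ∀ x, e * (x - x₀) = 0 → x = x₀ := by
    intro x h
    rcases mul_eq_zero.1 h with h | h
    · exact absurd h he
    · linarith
  have hloc : Continuous lo := by
    refine (hg E₀).if_le ((hg E₁).min (hg E₂)) (by fun_prop) continuous_const fun x hx => ?_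
    rw [hx₀ x hx, hz, hz₁, hz₂, min_self]
  have hhic : Continuous hi := by
    refine (hg E₀).if_le ((hg E₁).max (hg E₂)) (by fun_prop) continuous_const fun x hx => ?_
    rw [hx₀ x hx, hz, hz₁, hz₂, max_self]
  have hlo0 : lo x₀ = z := by simp [lo, hz]
  have hhi0 : hi x₀ = z := by simp [hi, hz]
  let q : ℕ → ℝ → ℝ := fun i => if i < j then g (σ i) else if i = j then lo else
    if i = j + 1 then hi else g (σ (i - 1))
  have q_lt : ∀ i, i < j → q i = g (σ i) := fun i h => by simp only [q, if_pos h]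
  have q_j : q j = lo := by simp only [q, lt_irrefl, if_false, if_true]
  have q_j1 : q (j + 1) = hi := by
    simp only [q]
    rw [if_neg (by omega), if_neg (by omega), if_pos trivial]
  have q_gt : ∀ i, j + 1 < i → q i = g (σ (i - 1)) := fun i h => by
    simp only [q]
    rw [if_neg (by omega), if_neg (by omega), if_neg (by omega)]
  have hqc : ∀ i, Continuous (q i) := by
    intro i
    rcases lt_trichotomy i j with h | h | h
    · rw [q_lt i h]; exact hg _
    · rw [h, q_j]; exact hloc
    · rcases (Nat.succ_le_of_lt h).eq_or_lt with h | h
      · rw [← h, q_j1]; exact hhic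
      · rw [q_gt i h]; exact hg _
  have hq0 : ∀ i, i < j + 1 → q i x₀ = g (σ i) x₀ := by
    intro i hi
    rcases (Nat.lt_succ_iff.1 hi).lt_or_eq with h | h
    · rw [q_lt i h]
    · rw [h, q_j, hlo0, hjE, hz]
  have hq0' : ∀ i, j < i → q i x₀ = g (σ (i - 1)) x₀ := by
    intro i hi
    rcases (Nat.succ_le_of_lt hi).eq_or_lt with h | h
    · rw [← h, q_j1, hhi0, Nat.succ_sub_one, hjE, hz]
    · rw [q_gt i h]
  refine ⟨j, by omega, q, ?_, ?_⟩
  · have h4 := eventually_all_lt (N := T.card + 2) (Q := fun i => i ≠ j ∧ i + 1 < T.card + 2)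
      (x₀ := x₀) (fun i => hqc i) (fun i => hqc (i + 1)) (fun i _ hi => by
        rcases lt_or_gt_of_ne hi.1 with h | h
        · rw [hq0 i (by omega), hq0 (i + 1) (by omega)]
          exact h3 i (by omega)
        · rw [hq0' i h, hq0' (i + 1) (by omega)]
          have := h3 (i - 1) (by omega)
          rwa [Nat.sub_add_cancel (by omega)] at this)
    filter_upwards [hA, h4, hne] with x hx hx4 hxne
    refine ⟨fun i _ => (hqc _).continuousAt, fun i hi' => ?_, fun y => ?_⟩
    · by_cases hij : i = j
      · subst hij
        rw [q_j, q_j1]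
        by_cases hs : e * (x - x₀) ≤ 0
        · simp [lo, hi, hs]
        · simp only [lo, hi, if_neg hs]
          have := hxne (not_le.1 hs)
          refine ⟨min_le_max, iff_of_false (fun h => this ?_) (fun h => hs h.2)⟩
          exact inf_eq_sup.1 h
      · have := hx4 i (by omega) ⟨hij, hi'⟩
        exact ⟨this.le, iff_of_false this.ne (by omega)⟩
    · rw [hx]
      have hvirt : ∀ i, ¬(2 * j + 1 = 2 * i ∧ e * (x - x₀) < 0) := fun i h => by omega
      constructor
      · rintro ⟨E, rfl, hE⟩
        rcases hE with hE | ⟨rfl, hE⟩ | ⟨hE12, hE⟩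
        · obtain ⟨i, hi, rfl⟩ := h2 E (Finset.mem_insert_of_mem hE)
          rcases lt_trichotomy i j with h | h | h
          · exact ⟨i, by omega, hvirt i, by rw [q_lt i h]⟩
          · rw [h, hjE] at hE; exact absurd hE hE₀
          · exact ⟨i + 1, by omega, hvirt _, by rw [q_gt _ (by omega), Nat.add_sub_cancel]⟩
        · exact ⟨j, by omega, hvirt j, by rw [q_j]; simp only [lo, if_pos hE]⟩
        · rcases hE.eq_or_lt with h | h
          · have hxx := hx₀ x h.symm
            refine ⟨j, by omega, hvirt j, ?_⟩
            rw [q_j, hxx, hlo0]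
            rcases hE12 with rfl | rfl
            · exact hz₁.symm
            · exact hz₂.symm
          · have hmm : (min (g E₁ x) (g E₂ x) = g E x) ∨ max (g E₁ x) (g E₂ x) = g E x := by
              rcases hE12 with rfl | rfl
              · rcases le_total (g E x) (g E₂ x) with h | h
                · exact Or.inl (min_eq_left h)
                · exact Or.inr (max_eq_left h)
              · rcases le_total (g E₁ x) (g E x) with h | h
                · exact Or.inr (max_eq_right h)
                · exact Or.inl (min_eq_right h)
            rcases hmm with hmm | hmm
            · exact ⟨j, by omega, hvirt j, by rw [q_j]; simp only [lo, if_neg (not_le.2 h), hmm]⟩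
            · exact ⟨j + 1, by omega, hvirt _, by
                rw [q_j1]; simp only [hi, if_neg (not_le.2 h), hmm]⟩
      · rintro ⟨i, hi', -, rfl⟩
        rcases lt_trichotomy i j with h | h | h
        · refine ⟨σ i, by rw [q_lt i h], Or.inl ?_⟩
          rcases Finset.mem_insert.1 (h1 i (by omega)) with h' | h'
          · exact absurd (hσinj i (by omega) h') (by omega)
          · exact h'
        · rw [h, q_j]
          by_cases hs : e * (x - x₀) ≤ 0
          · exact ⟨E₀, by simp only [lo, if_pos hs], Or.inr (Or.inl ⟨rfl, hs⟩)⟩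
          · simp only [lo, if_neg hs]
            rcases min_choice (g E₁ x) (g E₂ x) with h | h
            · exact ⟨E₁, h.symm, Or.inr (Or.inr ⟨Or.inl rfl, (not_le.1 hs).le⟩)⟩
            · exact ⟨E₂, h.symm, Or.inr (Or.inr ⟨Or.inr rfl, (not_le.1 hs).le⟩)⟩
        · rcases (Nat.succ_le_of_lt h).eq_or_lt with h | h
          · rw [← h, q_j1]
            by_cases hs : e * (x - x₀) ≤ 0
            · exact ⟨E₀, by simp only [hi, if_pos hs], Or.inr (Or.inl ⟨rfl, hs⟩)⟩
            · simp only [hi, if_neg hs]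
              rcases max_choice (g E₁ x) (g E₂ x) with h | h
              · exact ⟨E₁, h.symm, Or.inr (Or.inr ⟨Or.inl rfl, (not_le.1 hs).le⟩)⟩
              · exact ⟨E₂, h.symm, Or.inr (Or.inr ⟨Or.inr rfl, (not_le.1 hs).le⟩)⟩
          · refine ⟨σ (i - 1), by rw [q_gt i h], Or.inl ?_⟩
            rcases Finset.mem_insert.1 (h1 (i - 1) (by omega)) with h' | h'
            · exact absurd (hσinj (i - 1) (by omega) h') (by omega)
            · exact h'
  · have : (2 * j + 1) / 2 = j := by omega
    rw [this, q_j, hlo0]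

end LocalSort

theorem lt_countBelow_iff {n : ℕ} {v : ℕ → ℝ} (hv : ∀ i, i + 1 < n → v i < v (i + 1)) {i : ℕ}
    (hi : i < n) {x : ℝ} : v i < x ↔ i < countBelow n v x := by
  simp only [countBelow]
  constructor
  · intro h
    have : Finset.range (i + 1) ⊆ (Finset.range n).filter fun i => v i < x := by
      intro j hj
      rw [Finset.mem_range] at hj
      rw [Finset.mem_filter, Finset.mem_range]
      exact ⟨by omega, (le_of_steps (fun i hi => (hv i hi).le) (by omega) hi).trans_lt h⟩
    have := Finset.card_le_card this
    rw [Finset.card_range] at this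
    omega
  · intro h
    by_contra hcon
    have : ((Finset.range n).filter fun i => v i < x) ⊆ Finset.range i := by
      intro j hj
      rw [Finset.mem_filter, Finset.mem_range] at hj
      rw [Finset.mem_range]
      by_contra hij
      have := le_of_steps (fun i hi => (hv i hi).le) (not_lt.1 hij) hj.1
      exact absurd (this.trans_lt hj.2) hcon
    have := Finset.card_le_card this
    rw [Finset.card_range] at this
    omega

/-- A plane graph whose edges are graphs of functions `g E` over compact intervals
`[a E, b E]`, with generic vertices `W`. The functions `g E` are extended continuously to the whole
line. Each vertex is either an end of exactly one edge, or the point where one edge becomes two or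
two edges become one. -/
structure EdgeSystem (A W : Set (ℝ × ℝ)) (ι : Type*) [Fintype ι] where
  a : ι → ℝ
  b : ι → ℝ
  g : ι → ℝ → ℝ
  lt : ∀ E, a E < b E
  continuous_g : ∀ E, Continuous (g E)
  mem_iff : ∀ x y, (x, y) ∈ A ↔ ∃ E, g E x = y ∧ a E ≤ x ∧ x ≤ b E
  disjoint : ∀ E E' x, E ≠ E' → a E ≤ x → x ≤ b E → a E' ≤ x → x ≤ b E' → g E x = g E' x →
    x = a E ∨ x = b E
  left_mem : ∀ E, (a E, g E (a E)) ∈ W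
  right_mem : ∀ E, (b E, g E (b E)) ∈ W
  finite : W.Finite
  injOn : InjOn Prod.fst W
  valency : ∀ w ∈ W,
    (({E | b E = w.1}.ncard = 0 ∧ {E | a E = w.1}.ncard = 1) ∨
      ({E | b E = w.1}.ncard = 1 ∧ {E | a E = w.1}.ncard = 2)) ∨
    (({E | b E = w.1}.ncard = 1 ∧ {E | a E = w.1}.ncard = 0) ∨
      ({E | b E = w.1}.ncard = 2 ∧ {E | a E = w.1}.ncard = 1))

namespace EdgeSystem

variable {A W : Set (ℝ × ℝ)} {ι : Type*} [Fintype ι]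

open Classical in
/-- The edges that cross the vertical line over `x`. -/
noncomputable def crossing (S : EdgeSystem A W ι) (x : ℝ) : Finset ι :=
  Finset.univ.filter fun E => S.a E < x ∧ x < S.b E

theorem mem_crossing (S : EdgeSystem A W ι) {x : ℝ} {E : ι} :
    E ∈ S.crossing x ↔ S.a E < x ∧ x < S.b E := by
  simp [crossing]

theorem injOn_crossing (S : EdgeSystem A W ι) (x : ℝ) :
    InjOn (fun E => S.g E x) (S.crossing x) := by
  intro E hE E' hE' h
  rw [Finset.mem_coe, mem_crossing] at hE hE'
  by_contra hne
  rcases S.disjoint E E' x hne hE.1.le hE.2.le hE'.1.le hE'.2.le h with h | h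
  · exact hE.1.ne' h
  · exact hE.2.ne h

theorem value_left (S : EdgeSystem A W ι) {w : ℝ × ℝ} (hw : w ∈ W) {E : ι} (h : S.a E = w.1) :
    S.g E w.1 = w.2 := by
  have := S.injOn (S.left_mem E) hw h
  rw [← h, ← this]

theorem value_right (S : EdgeSystem A W ι) {w : ℝ × ℝ} (hw : w ∈ W) {E : ι} (h : S.b E = w.1) :
    S.g E w.1 = w.2 := by
  have := S.injOn (S.right_mem E) hw h
  rw [← h, ← this]

/-- Near `x₀`, each edge is over `x` if it crosses the line over `x₀`, or ends or starts there and
`x` is on the correct side. -/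
theorem eventually_over (S : EdgeSystem A W ι) (x₀ : ℝ) :
    ∀ᶠ x in 𝓝 x₀, ∀ E, (S.a E ≤ x ∧ x ≤ S.b E) ↔ (E ∈ S.crossing x₀ ∨
      S.b E = x₀ ∧ x ≤ x₀ ∨ S.a E = x₀ ∧ x₀ ≤ x) := by
  rw [Filter.eventually_all]
  intro E
  have hab := S.lt E
  simp only [mem_crossing]
  have h1 : ∀ t, t ≠ x₀ → ∀ᶠ x in 𝓝 x₀, (t ≤ x ↔ t < x₀) ∧ (x ≤ t ↔ x₀ < t) := by
    intro t ht
    rcases lt_or_gt_of_ne ht with h | h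
    · filter_upwards [eventually_gt_nhds h] with x hx
      exact ⟨iff_of_true hx.le h, iff_of_false (not_le.2 hx) (not_lt.2 h.le)⟩
    · filter_upwards [eventually_lt_nhds h] with x hx
      exact ⟨iff_of_false (not_le.2 hx) (not_lt.2 h.le), iff_of_true hx.le h⟩
  by_cases ha : S.a E = x₀
  · have hb : S.b E ≠ x₀ := by rw [← ha]; exact hab.ne'
    filter_upwards [h1 _ hb] with x hx
    rw [hx.2, ha]
    have : x₀ < S.b E := ha ▸ hab
    simp [this, hb]
  · by_cases hb : S.b E = x₀
    · filter_upwards [h1 _ ha] with x hx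
      rw [hx.1, hb]
      have : S.a E < x₀ := hb ▸ hab
      simp [this, ha]
    · filter_upwards [h1 _ ha, h1 _ hb] with x hx hx'
      rw [hx.1, hx'.2]
      simp [ha, hb]

theorem regularAt (S : EdgeSystem A W ι) [Nonempty ι] {x₀ : ℝ} (ha : ∀ E, S.a E ≠ x₀)
    (hb : ∀ E, S.b E ≠ x₀) : RegularAt A x₀ (S.crossing x₀).card := by
  refine regularAt_of_edges S.continuous_g _ (S.injOn_crossing x₀) ?_
  filter_upwards [S.eventually_over x₀] with x hx y
  rw [S.mem_iff]
  refine exists_congr fun E => ?_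
  rw [hx E, and_comm]
  simp [ha, hb]

/-- A vertex of valency `1` is a birth or a death of a strand; a vertex of valency `3`, where two
edges lie on one side and one on the other, is a split or a merger. -/
theorem eventAt (S : EdgeSystem A W ι) {w : ℝ × ℝ} (hw : w ∈ W) :
    (∃ p ≤ 2 * min ((S.crossing w.1).card + {E | S.b E = w.1}.ncard)
        ((S.crossing w.1).card + {E | S.a E = w.1}.ncard), ∃ e : ℝ,
      (e = 1 ∧ {E | S.a E = w.1}.ncard = {E | S.b E = w.1}.ncard + 1 ∨
        e = -1 ∧ {E | S.b E = w.1}.ncard = {E | S.a E = w.1}.ncard + 1) ∧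
      EventAt A w.1 e (min ((S.crossing w.1).card + {E | S.b E = w.1}.ncard)
        ((S.crossing w.1).card + {E | S.a E = w.1}.ncard)) p w.2) := by
  set T := S.crossing w.1 with hT
  have hTz : ∀ E ∈ T, S.g E w.1 ≠ w.2 := by
    intro E hE h
    rw [hT, mem_crossing] at hE
    have hne : ∃ E', S.a E' = w.1 ∨ S.b E' = w.1 := by
      by_contra! hcon
      have h1 : {E | S.b E = w.1} = ∅ := eq_empty_of_forall_notMem fun E h => (hcon E).2 h
      have h2 : {E | S.a E = w.1} = ∅ := eq_empty_of_forall_notMem fun E h => (hcon E).1 h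
      have := S.valency w hw
      simp only [h1, h2, ncard_empty] at this
      omega
    obtain ⟨E', hE'⟩ := hne
    have hEE : E ≠ E' := by
      rintro rfl
      rcases hE' with h | h
      · exact hE.1.ne h
      · exact hE.2.ne' h
    have hlt := S.lt E'
    rcases hE' with h' | h'
    · rcases S.disjoint E E' w.1 hEE hE.1.le hE.2.le h'.le (h' ▸ hlt.le)
        (h.trans (S.value_left hw h').symm) with h | h
      · exact hE.1.ne' h
      · exact hE.2.ne h
    · rcases S.disjoint E E' w.1 hEE hE.1.le hE.2.le (h' ▸ hlt.le) h'.ge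
        (h.trans (S.value_right hw h').symm) with h | h
      · exact hE.1.ne' h
      · exact hE.2.ne h
  have hmem : ∀ᶠ x in 𝓝 w.1, ∀ y, (x, y) ∈ A ↔ ∃ E, S.g E x = y ∧ (E ∈ T ∨
      S.b E = w.1 ∧ x ≤ w.1 ∨ S.a E = w.1 ∧ w.1 ≤ x) := by
    filter_upwards [S.eventually_over w.1] with x hx y
    rw [S.mem_iff]
    exact exists_congr fun E => and_congr_right fun _ => hx E
  have hinj := S.injOn_crossing w.1
  -- two different edges that start (or end) at `w` are disjoint nearby
  have hnea : ∀ E E', E ≠ E' → S.a E = w.1 → S.a E' = w.1 → ∀ᶠ x in 𝓝 w.1,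
      0 < 1 * (x - w.1) → S.g E x ≠ S.g E' x := by
    intro E E' hEE h h'
    filter_upwards [eventually_lt_nhds (h ▸ S.lt E), eventually_lt_nhds (h' ▸ S.lt E')]
      with x h1 h2 h3 h4
    rcases S.disjoint E E' x hEE (by linarith) h1.le (by linarith) h2.le h4 with h5 | h5 <;> linarith
  have hneb : ∀ E E', E ≠ E' → S.b E = w.1 → S.b E' = w.1 → ∀ᶠ x in 𝓝 w.1,
      0 < -1 * (x - w.1) → S.g E x ≠ S.g E' x := by
    intro E E' hEE h h'
    filter_upwards [eventually_gt_nhds (h ▸ S.lt E), eventually_gt_nhds (h' ▸ S.lt E')]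
      with x h1 h2 h3 h4
    rcases S.disjoint E E' x hEE h1.le (by linarith) h2.le (by linarith) h4 with h5 | h5 <;> linarith
  have hnotT : ∀ E, (S.a E = w.1 ∨ S.b E = w.1) → E ∉ T := by
    intro E hE h
    rw [hT, mem_crossing] at h
    rcases hE with h' | h'
    · exact h.1.ne h'
    · exact h.2.ne' h'
  rcases S.valency w hw with (⟨h0, h1⟩ | ⟨h0, h1⟩) | (⟨h0, h1⟩ | ⟨h0, h1⟩)
  · obtain ⟨E₀, hE₀⟩ := ncard_eq_one.1 h1
    have hb : ∀ E, S.b E ≠ w.1 := fun E h => by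
      rw [ncard_eq_zero] at h0
      exact notMem_empty E (h0 ▸ h)
    have ha : ∀ E, S.a E = w.1 ↔ E = E₀ := fun E => by
      have : E ∈ {E | S.a E = w.1} ↔ E ∈ ({E₀} : Set ι) := by rw [hE₀]
      exact this
    obtain ⟨j, hj, hev⟩ := eventAt_birth (A := A) (x₀ := w.1) (e := 1) (z := w.2) S.continuous_g T
      E₀ (hnotT _ (Or.inl ((ha _).2 rfl))) hinj (S.value_left hw ((ha _).2 rfl)) hTz (by
        filter_upwards [hmem] with x hx y
        rw [hx]
        simp only [ha, hb, false_and, false_or, one_mul, sub_nonneg])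
    rw [h0, h1]
    have : min (T.card + 0) (T.card + 1) = T.card := by omega
    rw [this]
    exact ⟨2 * j, by omega, 1, by simp, hev⟩
  · obtain ⟨E₀, hE₀⟩ := ncard_eq_one.1 h0
    obtain ⟨E₁, E₂, hne, hE₁₂⟩ := ncard_eq_two.1 h1
    have hb : ∀ E, S.b E = w.1 ↔ E = E₀ := fun E => by
      have : E ∈ {E | S.b E = w.1} ↔ E ∈ ({E₀} : Set ι) := by rw [hE₀]
      exact this
    have ha : ∀ E, S.a E = w.1 ↔ E = E₁ ∨ E = E₂ := fun E => by
      have : E ∈ {E | S.a E = w.1} ↔ E ∈ ({E₁, E₂} : Set ι) := by rw [hE₁₂]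
      exact this
    have ha1 := (ha E₁).2 (Or.inl rfl)
    have ha2 := (ha E₂).2 (Or.inr rfl)
    have hb0 := (hb E₀).2 rfl
    obtain ⟨j, hj, hev⟩ := eventAt_split (A := A) (x₀ := w.1) (e := 1) (z := w.2) S.continuous_g T
      E₀ E₁ E₂ (hnotT _ (Or.inr hb0)) hinj (S.value_right hw hb0) (S.value_left hw ha1)
      (S.value_left hw ha2) hTz (hnea E₁ E₂ hne ha1 ha2) one_ne_zero (by
        filter_upwards [hmem] with x hx y
        rw [hx]
        simp only [ha, hb, one_mul, sub_nonneg, sub_nonpos])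
    rw [h0, h1]
    have : min (T.card + 1) (T.card + 2) = T.card + 1 := by omega
    rw [this]
    exact ⟨2 * j + 1, by omega, 1, by simp, hev⟩
  · obtain ⟨E₀, hE₀⟩ := ncard_eq_one.1 h0
    have ha : ∀ E, S.a E ≠ w.1 := fun E h => by
      rw [ncard_eq_zero] at h1
      exact notMem_empty E (h1 ▸ h)
    have hb : ∀ E, S.b E = w.1 ↔ E = E₀ := fun E => by
      have : E ∈ {E | S.b E = w.1} ↔ E ∈ ({E₀} : Set ι) := by rw [hE₀]
      exact this
    obtain ⟨j, hj, hev⟩ := eventAt_birth (A := A) (x₀ := w.1) (e := -1) (z := w.2) S.continuous_g T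
      E₀ (hnotT _ (Or.inr ((hb _).2 rfl))) hinj (S.value_right hw ((hb _).2 rfl)) hTz (by
        filter_upwards [hmem] with x hx y
        rw [hx]
        simp only [ha, hb, false_and, or_false, neg_mul, one_mul, neg_sub, sub_nonneg])
    rw [h0, h1]
    have : min (T.card + 1) (T.card + 0) = T.card := by omega
    rw [this]
    exact ⟨2 * j, by omega, -1, by simp, hev⟩
  · obtain ⟨E₀, hE₀⟩ := ncard_eq_one.1 h1
    obtain ⟨E₁, E₂, hne, hE₁₂⟩ := ncard_eq_two.1 h0
    have ha : ∀ E, S.a E = w.1 ↔ E = E₀ := fun E => by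
      have : E ∈ {E | S.a E = w.1} ↔ E ∈ ({E₀} : Set ι) := by rw [hE₀]
      exact this
    have hb : ∀ E, S.b E = w.1 ↔ E = E₁ ∨ E = E₂ := fun E => by
      have : E ∈ {E | S.b E = w.1} ↔ E ∈ ({E₁, E₂} : Set ι) := by rw [hE₁₂]
      exact this
    have hb1 := (hb E₁).2 (Or.inl rfl)
    have hb2 := (hb E₂).2 (Or.inr rfl)
    have ha0 := (ha E₀).2 rfl
    obtain ⟨j, hj, hev⟩ := eventAt_split (A := A) (x₀ := w.1) (e := -1) (z := w.2) S.continuous_g T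
      E₀ E₁ E₂ (hnotT _ (Or.inl ha0)) hinj (S.value_left hw ha0) (S.value_right hw hb1)
      (S.value_right hw hb2) hTz (hneb E₁ E₂ hne hb1 hb2) (by norm_num) (by
        filter_upwards [hmem] with x hx y
        rw [hx]
        simp only [ha, hb, neg_mul, one_mul, neg_sub, sub_nonneg, sub_nonpos]
        refine exists_congr fun E => and_congr_right fun _ => or_congr_right or_comm)
    rw [h0, h1]
    have : min (T.card + 2) (T.card + 1) = T.card + 1 := by omega
    rw [this]
    exact ⟨2 * j + 1, by omega, -1, by simp, hev⟩

/-- The vertices, sorted by abscissa, are the events of a valid pattern. -/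
theorem exists_hasPattern (S : EdgeSystem A W ι) [Nonempty ι] :
    ∃ n k p e v c, ValidPattern n k p e ∧ HasPattern A n k p e v c ∧
      W = {w | ∃ i < n, (v i, c i) = w} := by
  classical
  obtain ⟨w, hw1, hw2, hw3⟩ := exists_sorting S.finite.toFinset (fun w : ℝ × ℝ => w.1)
    (by simpa using S.injOn)
  set n := S.finite.toFinset.card with hn
  have hwW : ∀ i < n, w i ∈ W := fun i hi => by simpa using hw1 i hi
  have hsurj : ∀ z ∈ W, ∃ i < n, w i = z := fun z hz => hw2 z (by simpa using hz)
  have hvlt : ∀ i j, i < n → j < n → ((w i).1 < (w j).1 ↔ i < j) := by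
    intro i j hi hj
    constructor
    · intro h
      by_contra hcon
      have := le_of_steps (a := fun i => (w i).1) (N := n) (fun i hi => (hw3 i hi).le)
        (not_lt.1 hcon) hi
      exact absurd h (not_lt.2 this)
    · intro h
      exact lt_of_steps (a := fun i => (w i).1) (N := n) hw3 h hj
  choose s hs hsw using fun E => hsurj _ (S.left_mem E)
  choose t ht htw using fun E => hsurj _ (S.right_mem E)
  have hsa : ∀ E, S.a E = (w (s E)).1 := fun E => by rw [hsw]
  have htb : ∀ E, S.b E = (w (t E)).1 := fun E => by rw [htw]
  have hst : ∀ E, s E < t E := fun E => by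
    rw [← hvlt _ _ (hs E) (ht E), ← hsa, ← htb]; exact S.lt E
  have hinjv : ∀ i j, i < n → j < n → ((w i).1 = (w j).1 ↔ i = j) := by
    intro i j hi hj
    refine ⟨fun h => ?_, fun h => by rw [h]⟩
    rcases lt_trichotomy i j with h' | h' | h'
    · exact absurd h ((hvlt i j hi hj).2 h').ne
    · exact h'
    · exact absurd h ((hvlt j i hj hi).2 h').ne'
  let k : ℕ → ℕ := fun j => (Finset.univ.filter fun E => s E < j ∧ j ≤ t E).card
  have hcross : ∀ i < n, S.crossing (w i).1 = Finset.univ.filter fun E => s E < i ∧ i < t E := by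
    intro i hi
    ext E
    rw [mem_crossing, Finset.mem_filter, hsa, htb, hvlt _ _ (hs E) hi, hvlt _ _ hi (ht E)]
    simp
  have hbset : ∀ i < n, {E | S.b E = (w i).1}.ncard = (Finset.univ.filter fun E => t E = i).card := by
    intro i hi
    rw [← ncard_coe_finset]
    congr 1
    ext E
    rw [Finset.mem_coe, Finset.mem_filter]
    simp only [Finset.mem_univ, true_and]
    change S.b E = _ ↔ _
    rw [htb, hinjv _ _ (ht E) hi]
  have haset : ∀ i < n, {E | S.a E = (w i).1}.ncard = (Finset.univ.filter fun E => s E = i).card := by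
    intro i hi
    rw [← ncard_coe_finset]
    congr 1
    ext E
    rw [Finset.mem_coe, Finset.mem_filter]
    simp only [Finset.mem_univ, true_and]
    change S.a E = _ ↔ _
    rw [hsa, hinjv _ _ (hs E) hi]
  have hk1 : ∀ i < n, k i = (S.crossing (w i).1).card + {E | S.b E = (w i).1}.ncard := by
    intro i hi
    rw [hcross i hi, hbset i hi, ← Finset.card_union_of_disjoint]
    · change Finset.card _ = _
      congr 1
      ext E
      simp only [Finset.mem_filter, Finset.mem_univ, true_and, Finset.mem_union]
      have := hst E
      omega
    · rw [Finset.disjoint_filter]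
      intro E _ h
      omega
  have hk2 : ∀ i < n, k (i + 1) = (S.crossing (w i).1).card + {E | S.a E = (w i).1}.ncard := by
    intro i hi
    rw [hcross i hi, haset i hi, ← Finset.card_union_of_disjoint]
    · change Finset.card _ = _
      congr 1
      ext E
      simp only [Finset.mem_filter, Finset.mem_univ, true_and, Finset.mem_union]
      have := hst E
      omega
    · rw [Finset.disjoint_filter]
      intro E _ h
      omega
  have hev : ∀ i, ∃ (p : ℕ) (e : ℝ), i < n → p ≤ 2 * min (k i) (k (i + 1)) ∧
      ((e = 1 ∧ k (i + 1) = k i + 1) ∨ (e = -1 ∧ k i = k (i + 1) + 1)) ∧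
      EventAt A (w i).1 e (min (k i) (k (i + 1))) p (w i).2 := by
    intro i
    by_cases hi : i < n
    · obtain ⟨p, hp, e, he, hE⟩ := S.eventAt (hwW i hi)
      rw [← hk1 i hi, ← hk2 i hi] at hp hE
      refine ⟨p, e, fun _ => ⟨hp, ?_, hE⟩⟩
      rw [hk1 i hi, hk2 i hi]
      refine he.imp (fun h => ⟨h.1, ?_⟩) (fun h => ⟨h.1, ?_⟩)
      · rw [h.2, add_assoc]
      · rw [h.2, add_assoc]
    · exact ⟨0, 0, fun h => absurd h hi⟩
  choose p e hpe using hev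
  refine ⟨n, k, p, e, fun i => (w i).1, fun i => (w i).2, ⟨?_, ?_, fun i hi => (hpe i hi).2.1,
    fun i hi => (hpe i hi).1⟩, ⟨hw3, fun i hi => (hpe i hi).2.2, fun x hx => ?_⟩, ?_⟩
  · simp [k]
  · simp only [k, Finset.card_eq_zero]
    refine Finset.filter_false_of_mem fun E _ h => ?_
    have := ht E
    omega
  · have h1 := S.regularAt (x₀ := x) (fun E => by rw [hsa]; exact hx _ (hs E))
      (fun E => by rw [htb]; exact hx _ (ht E))
    have h2 : (S.crossing x).card = k (countBelow n (fun i => (w i).1) x) := by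
      have hlow : ∀ i < n, ((w i).1 < x ↔ i < countBelow n (fun i => (w i).1) x) :=
        fun i hi => lt_countBelow_iff hw3 hi
      congr 1
      ext E
      rw [mem_crossing, Finset.mem_filter, hsa, htb, hlow _ (hs E)]
      simp only [Finset.mem_univ, true_and]
      refine and_congr_right fun _ => ?_
      rw [← not_lt, ← hlow _ (ht E), not_lt]
      exact ⟨le_of_lt, fun h => lt_of_le_of_ne h (hx _ (ht E)).symm⟩
    rw [h2] at h1
    exact h1
  · ext z
    constructor
    · intro hz
      obtain ⟨i, hi, rfl⟩ := hsurj z hz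
      exact ⟨i, hi, rfl⟩
    · rintro ⟨i, hi, rfl⟩
      exact hwW i hi

end EdgeSystem

/-! ### Transversal graphs as systems of edges -/

/-- A subset of the plane that is homeomorphic to the line, and whose closure is compact and
projects injectively, is the graph of a function over an open interval. -/
theorem exists_graph_of_homeomorph_real {E : Set (ℝ × ℝ)} (hcpt : IsCompact (closure E))
    (hinj : InjOn Prod.fst (closure E)) (hE : Nonempty (E ≃ₜ ℝ)) :
    ∃ (a b : ℝ) (g : ℝ → ℝ), a < b ∧ Continuous g ∧
      (∀ x y, (x, y) ∈ closure E ↔ g x = y ∧ a ≤ x ∧ x ≤ b) ∧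
      ∀ x y, (x, y) ∈ E ↔ g x = y ∧ a < x ∧ x < b := by
  obtain ⟨h⟩ := hE
  -- the projection of `E` is an interval without first and last point
  let f : ℝ → ℝ := fun u => (h.symm u : ℝ × ℝ).1
  have hfc : Continuous f := continuous_fst.comp (continuous_subtype_val.comp h.symm.continuous)
  have hfi : Function.Injective f := fun u u' huu =>
    h.symm.injective (Subtype.ext (hinj (subset_closure (h.symm u).2)
      (subset_closure (h.symm u').2) huu))
  have hfr : range f = Prod.fst '' E := by
    ext x
    constructor
    · rintro ⟨u, rfl⟩; exact ⟨_, (h.symm u).2, rfl⟩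
    · rintro ⟨z, hz, rfl⟩; exact ⟨h ⟨z, hz⟩, by simp [f]⟩
  have hext : ∀ u, (∃ u', f u' < f u) ∧ ∃ u', f u < f u' := by
    intro u
    rcases hfc.strictMono_of_inj hfi with hm | hm
    · exact ⟨⟨u - 1, hm (by linarith)⟩, ⟨u + 1, hm (by linarith)⟩⟩
    · exact ⟨⟨u + 1, hm (by linarith)⟩, ⟨u - 1, hm (by linarith)⟩⟩
  have hne : E.Nonempty := ⟨_, (h.symm 0).2⟩
  have hEconn : IsPreconnected E := by
    have : IsPreconnected (range fun u => (h.symm u : ℝ × ℝ)) :=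
      isPreconnected_range (continuous_subtype_val.comp h.symm.continuous)
    convert this
    ext z
    exact ⟨fun hz => ⟨h ⟨z, hz⟩, by simp⟩, by rintro ⟨u, rfl⟩; exact (h.symm u).2⟩
  have hCI : ∃ a b, Prod.fst '' closure E = Icc a b := by
    have h1 : IsCompact (Prod.fst '' closure E) := hcpt.image continuous_fst
    have h2 : IsConnected (Prod.fst '' closure E) :=
      ⟨hne.closure.image _, hEconn.closure.image _ continuous_fst.continuousOn⟩
    exact ⟨_, _, eq_Icc_of_connected_compact h2 h1⟩
  obtain ⟨a, b, hab⟩ := hCI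
  have hEo : Prod.fst '' E = Ioo a b := by
    rw [← hfr]
    apply Subset.antisymm
    · have hsub : ∀ u, f u ∈ Icc a b := fun u => hab ▸ ⟨_, subset_closure (h.symm u).2, rfl⟩
      rintro _ ⟨u, rfl⟩
      obtain ⟨⟨u1, h1⟩, u2, h2⟩ := hext u
      exact ⟨(hsub u1).1.trans_lt h1, h2.trans_le (hsub u2).2⟩
    · intro x hx
      have hd : Icc a b ⊆ closure (range f) := by
        rw [← hab, hfr]
        exact image_closure_subset_closure_image continuous_fst
      have hle : a ≤ b := hx.1.le.trans hx.2.le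
      obtain ⟨_, hy1, u1, rfl⟩ := mem_closure_iff.1 (hd (left_mem_Icc.2 hle)) (Iio x) isOpen_Iio hx.1
      obtain ⟨_, hy2, u2, rfl⟩ := mem_closure_iff.1 (hd (right_mem_Icc.2 hle)) (Ioi x) isOpen_Ioi
        hx.2
      exact (isPreconnected_range hfc).ordConnected.out ⟨u1, rfl⟩ ⟨u2, rfl⟩ ⟨hy1.le, hy2.le⟩
  have hlt : a < b := by
    rw [← nonempty_Ioo, ← hEo]
    exact hne.image _
  -- the projection of the closure has a continuous inverse, by compactness
  have : CompactSpace (closure E) := isCompact_iff_compactSpace.1 hcpt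
  let r : closure E → Icc a b := fun z => ⟨z.1.1, hab ▸ ⟨z.1, z.2, rfl⟩⟩
  have hrc : Continuous r := by
    refine Continuous.subtype_mk ?_ _
    exact continuous_fst.comp continuous_subtype_val
  have hrb : Function.Bijective r := by
    constructor
    · intro z z' hzz
      exact Subtype.ext (hinj z.2 z'.2 (congrArg Subtype.val hzz))
    · rintro ⟨x, hx⟩
      rw [← hab] at hx
      obtain ⟨z, hz, rfl⟩ := hx
      exact ⟨⟨z, hz⟩, rfl⟩
  let R : closure E ≃ₜ Icc a b :=
    Continuous.homeoOfEquivCompactToT2 (f := Equiv.ofBijective r hrb) hrc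
  have hR : ∀ z, R z = r z := fun _ => rfl
  let g : ℝ → ℝ := IccExtend hlt.le fun x => (R.symm x : ℝ × ℝ).2
  have hgc : Continuous g := by
    refine Continuous.Icc_extend' ?_
    exact continuous_snd.comp (continuous_subtype_val.comp R.symm.continuous)
  have hfstR : ∀ x : Icc a b, (R.symm x : ℝ × ℝ).1 = x := fun x => by
    have := R.apply_symm_apply x
    rw [hR] at this
    exact congrArg Subtype.val this
  have hclos : ∀ x y, (x, y) ∈ closure E ↔ g x = y ∧ a ≤ x ∧ x ≤ b := by
    intro x y
    constructor
    · intro hxy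
      have hx : x ∈ Icc a b := hab ▸ ⟨_, hxy, rfl⟩
      refine ⟨?_, hx.1, hx.2⟩
      simp only [g]
      rw [IccExtend_of_mem _ _ hx]
      have : R.symm ⟨x, hx⟩ = ⟨(x, y), hxy⟩ := by
        rw [Homeomorph.symm_apply_eq]
        rfl
      rw [this]
    · rintro ⟨hg, hx1, hx2⟩
      simp only [g] at hg
      rw [IccExtend_of_mem _ _ ⟨hx1, hx2⟩] at hg
      have h1 := hfstR ⟨x, hx1, hx2⟩
      have : (x, y) = (R.symm ⟨x, hx1, hx2⟩ : ℝ × ℝ) := Prod.ext h1.symm hg.symm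
      rw [this]
      exact (R.symm _).2
  refine ⟨a, b, g, hlt, hgc, hclos, fun x y => ⟨fun hxy => ?_, fun ⟨h1, h2, h3⟩ => ?_⟩⟩
  · have hx : x ∈ Ioo a b := hEo ▸ ⟨_, hxy, rfl⟩
    exact ⟨((hclos x y).1 (subset_closure hxy)).1, hx.1, hx.2⟩
  · have hx : x ∈ Prod.fst '' E := hEo ▸ ⟨h2, h3⟩
    obtain ⟨⟨x', y'⟩, hz, rfl⟩ := hx
    rw [← h1, ((hclos x' y').1 (subset_closure hz)).1]
    exact hz

namespace TransversalGraph

variable {P : Type*} [TopologicalSpace P] {V : VerticalSpace P}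

/-- In a global chart, a compact generic transversal graph is a system of edges. -/
theorem exists_edgeSystem (G : TransversalGraph V) (hcompact : IsCompact G.carrier)
    (hne : G.carrier.Nonempty) (hgen : G.IsGeneric) (htwo : G.IsTwoSided) (K : P ≃ₜ ℝ × ℝ)
    (hK : ∀ p, (K p).1 = V.proj p) :
    ∃ (_ : Fintype G.openEdges), Nonempty G.openEdges ∧
      Nonempty (EdgeSystem (K '' G.carrier) (K '' G.vertices) G.openEdges) := by
  have hedge : ∀ E : G.openEdges, ∃ (a b : ℝ) (g : ℝ → ℝ), a < b ∧ Continuous g ∧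
      (∀ p, p ∈ closure E.1 ↔ g (V.proj p) = (K p).2 ∧ a ≤ V.proj p ∧ V.proj p ≤ b) ∧
      ∀ p, p ∈ E.1 ↔ g (V.proj p) = (K p).2 ∧ a < V.proj p ∧ V.proj p < b := by
    rintro ⟨E, hE⟩
    have hcl : closure (K '' E) = K '' closure E := (K.image_closure E).symm
    have hsub : closure E ⊆ G.carrier :=
      closure_minimal (subset_union_of_subset_right (subset_sUnion_of_mem hE) _) G.isClosed
    have hc : IsCompact (closure (K '' E)) := by
      rw [hcl]
      exact (hcompact.of_isClosed_subset isClosed_closure hsub).image K.continuous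
    have hi : InjOn Prod.fst (closure (K '' E)) := by
      rw [hcl]
      rintro _ ⟨p, hp, rfl⟩ _ ⟨q, hq, rfl⟩ hpq
      rw [hK, hK] at hpq
      have := (G.transversal E hE).injective (a₁ := ⟨p, hp⟩) (a₂ := ⟨q, hq⟩) hpq
      rw [Subtype.mk.injEq] at this
      rw [this]
    obtain ⟨h⟩ := G.openEdge_homeo E hE
    obtain ⟨a, b, g, hab, hg, h1, h2⟩ := exists_graph_of_homeomorph_real hc hi
      ⟨(K.image E).symm.trans h⟩
    have hpair : ∀ p, (V.proj p, (K p).2) = K p := fun p => Prod.ext (hK p).symm rfl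
    refine ⟨a, b, g, hab, hg, fun p => ?_, fun p => ?_⟩
    · rw [← h1, hpair, hcl, K.injective.mem_set_image]
    · rw [← h2, hpair, K.injective.mem_set_image]
  choose a b g hab hg hcl hop using hedge
  have hfin : Finite G.openEdges := G.finite_openEdges.to_subtype
  have hsym : ∀ x y, V.proj (K.symm (x, y)) = x ∧ K (K.symm (x, y)) = (x, y) := fun x y => by
    rw [← hK, K.apply_symm_apply]; exact ⟨rfl, rfl⟩
  have hend : ∀ (E : G.openEdges) x, a E ≤ x → x ≤ b E → (x = a E ∨ x = b E) →
      (x, g E x) ∈ K '' G.vertices := by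
    intro E x h1 h2 h3
    refine ⟨K.symm (x, g E x), ?_, (hsym _ _).2⟩
    refine G.ends_subset E.1 E.2 ⟨?_, fun h => ?_⟩
    · rw [hcl, (hsym _ _).1, (hsym _ _).2]
      exact ⟨rfl, h1, h2⟩
    · rw [hop, (hsym _ _).1] at h
      rcases h3 with h3 | h3
      · exact h.2.1.ne' h3
      · exact h.2.2.ne h3
  have hinj : InjOn Prod.fst (K '' G.vertices) := by
    rintro _ ⟨p, hp, rfl⟩ _ ⟨q, hq, rfl⟩ hpq
    rw [hK, hK] at hpq
    rw [hgen.2 hp hq hpq]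
  -- the edges at a vertex are those that start or end on the vertical line through it
  have hat : ∀ v ∈ G.vertices, ∀ E : G.openEdges, v ∈ closure E.1 ↔
      a E = V.proj v ∨ b E = V.proj v := by
    intro v hv E
    constructor
    · intro h
      have h' := (hcl E v).1 h
      by_contra! hcon
      have : v ∈ E.1 := (hop E v).2 ⟨h'.1, lt_of_le_of_ne h'.2.1 hcon.1,
        lt_of_le_of_ne h'.2.2 hcon.2.symm⟩
      exact disjoint_left.1 (G.disjoint_vertices E.1 E.2) hv this
    · intro h
      have hx : a E ≤ V.proj v ∧ V.proj v ≤ b E := by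
        rcases h with h | h
        · exact ⟨h.le, h ▸ (hab E).le⟩
        · exact ⟨h ▸ (hab E).le, h.ge⟩
      have h1 := hend E (V.proj v) hx.1 hx.2 (h.imp Eq.symm Eq.symm)
      have h2 := hinj h1 (mem_image_of_mem K hv) (hK v).symm
      rw [hcl]
      exact ⟨congrArg Prod.snd h2, hx⟩
  have hval : ∀ v ∈ G.vertices, G.valency v =
      {E : G.openEdges | b E = V.proj v}.ncard + {E : G.openEdges | a E = V.proj v}.ncard := by
    intro v hv
    have h1 : {E | E ∈ G.openEdges ∧ v ∈ closure E} =
        Subtype.val '' ({E : G.openEdges | b E = V.proj v} ∪ {E : G.openEdges | a E = V.proj v}) := by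
      ext E
      constructor
      · rintro ⟨hE, hvE⟩
        exact ⟨⟨E, hE⟩, ((hat v hv ⟨E, hE⟩).1 hvE).symm, rfl⟩
      · rintro ⟨E, hE, rfl⟩
        exact ⟨E.2, (hat v hv E).2 (Or.symm hE)⟩
    rw [valency, h1, ncard_image_of_injective _ Subtype.val_injective, ncard_union_eq]
    rw [disjoint_left]
    intro E h h'
    have h2 : b E = V.proj v := h
    have h3 : a E = V.proj v := h'
    exact (hab E).ne (h3.trans h2.symm)
  have hne' : Nonempty G.openEdges := by
    obtain ⟨p, hp | ⟨E, hE, -⟩⟩ := hne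
    · by_contra hcon
      have hemp : IsEmpty G.openEdges := not_nonempty_iff.1 hcon
      have h1 := hval p hp
      simp only [Set.eq_empty_of_isEmpty, ncard_empty] at h1
      rcases hgen.1 p hp with h | h <;> omega
    · exact ⟨⟨E, hE⟩⟩
  refine ⟨Fintype.ofFinite _, hne', ⟨?_⟩⟩
  letI : Fintype G.openEdges := Fintype.ofFinite _
  refine {
    a := a
    b := b
    g := g
    lt := hab
    continuous_g := hg
    mem_iff := ?_
    disjoint := ?_
    left_mem := fun E => hend E _ le_rfl (hab E).le (Or.inl rfl)
    right_mem := fun E => hend E _ (hab E).le le_rfl (Or.inr rfl)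
    finite := G.finite_vertices.image K
    injOn := hinj
    valency := ?_ }
  · intro x y
    constructor
    · rintro ⟨p, hp, hpxy⟩
      have hx : V.proj p = x := by rw [← hK, hpxy]
      have hy : (K p).2 = y := by rw [hpxy]
      have hcover : ∃ E : G.openEdges, p ∈ closure E.1 := by
        rcases hp with hp | ⟨E, hE, hpE⟩
        · by_contra! hcon
          have h1 := hval p hp
          have h2 : ∀ E : G.openEdges, ¬ (a E = V.proj p ∨ b E = V.proj p) := fun E h =>
            hcon E ((hat p hp E).2 h)
          have h3 : {E : G.openEdges | b E = V.proj p} = ∅ :=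
            eq_empty_of_forall_notMem fun E h => h2 E (Or.inr h)
          have h4 : {E : G.openEdges | a E = V.proj p} = ∅ :=
            eq_empty_of_forall_notMem fun E h => h2 E (Or.inl h)
          rw [h3, h4, ncard_empty] at h1
          rcases hgen.1 p hp with h | h <;> omega
        · exact ⟨⟨E, hE⟩, subset_closure hpE⟩
      obtain ⟨E, hE⟩ := hcover
      rw [hcl, hx, hy] at hE
      exact ⟨E, hE⟩
    · rintro ⟨E, h⟩
      refine ⟨K.symm (x, y), ?_, (hsym _ _).2⟩
      have hsub : closure E.1 ⊆ G.carrier :=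
        closure_minimal (subset_union_of_subset_right (subset_sUnion_of_mem E.2) _) G.isClosed
      refine hsub ((hcl E _).2 ?_)
      rw [(hsym _ _).1, (hsym _ _).2]
      exact h
  · intro E E' x hne h1 h2 h3 h4 heq
    by_contra! hcon
    have hp : K.symm (x, g E x) ∈ E.1 := by
      rw [hop, (hsym _ _).1, (hsym _ _).2]
      exact ⟨rfl, lt_of_le_of_ne h1 hcon.1.symm, lt_of_le_of_ne h2 hcon.2⟩
    have hp' : K.symm (x, g E x) ∈ closure E'.1 := by
      rw [hcl, (hsym _ _).1, (hsym _ _).2]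
      exact ⟨heq.symm, h3, h4⟩
    by_cases hpE' : K.symm (x, g E x) ∈ E'.1
    · exact disjoint_left.1 (G.pairwise_disjoint E.2 E'.2 fun h => hne (Subtype.ext h)) hp hpE'
    · exact disjoint_left.1 (G.disjoint_vertices E.1 E.2) (G.ends_subset E'.1 E'.2 ⟨hp', hpE'⟩) hp
  · rintro _ ⟨v, hv, rfl⟩
    rw [hK]
    have h1 := hval v hv
    rcases hgen.1 v hv with h | h
    · omega
    · obtain ⟨⟨E, hE, hvE, hl⟩, E', hE', hvE', hr⟩ := htwo v hv h
      have hmid : ∀ E : G.openEdges, ∃ p ∈ E.1, a E < V.proj p ∧ V.proj p < b E := by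
        intro E
        have := hab E
        refine ⟨K.symm ((a E + b E) / 2, g E ((a E + b E) / 2)), ?_, ?_⟩
        · rw [hop, (hsym _ _).1, (hsym _ _).2]
          exact ⟨rfl, by linarith, by linarith⟩
        · rw [(hsym _ _).1]
          exact ⟨by linarith, by linarith⟩
      have h2 : 0 < {E : G.openEdges | b E = V.proj v}.ncard := by
        rw [ncard_pos]
        refine ⟨⟨E, hE⟩, ?_⟩
        rcases (hat v hv ⟨E, hE⟩).1 hvE with h' | h'
        · obtain ⟨p, hp, hp1, hp2⟩ := hmid ⟨E, hE⟩
          have := hl p hp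
          rw [h'] at hp1
          exact absurd this (not_lt.2 hp1.le)
        · exact h'
      have h3 : 0 < {E : G.openEdges | a E = V.proj v}.ncard := by
        rw [ncard_pos]
        refine ⟨⟨E', hE'⟩, ?_⟩
        rcases (hat v hv ⟨E', hE'⟩).1 hvE' with h' | h'
        · exact h'
        · obtain ⟨p, hp, hp1, hp2⟩ := hmid ⟨E', hE'⟩
          have := hr p hp
          rw [h'] at hp2
          exact absurd this (not_lt.2 hp2.le)
      omega

end TransversalGraph

/-! ### Families of functions on an interval and their zeros -/

/-- A function `f x y`, seen as a family of functions of `y ∈ [0, 1]` with parameter `x`, together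
with the partial derivatives that control its zeros. -/
structure Jet where
  f : ℝ → ℝ → ℝ
  fx : ℝ → ℝ → ℝ
  fy : ℝ → ℝ → ℝ
  fyy : ℝ → ℝ → ℝ
  hasDerivAt_x : ∀ x y, HasDerivAt (fun s => f s y) (fx x y) x
  hasDerivAt_y : ∀ x y, HasDerivAt (f x) (fy x y) y
  hasDerivAt_yy : ∀ x y, HasDerivAt (fy x) (fyy x y) y
  continuous_f : Continuous fun q : ℝ × ℝ => f q.1 q.2
  continuous_fx : Continuous fun q : ℝ × ℝ => fx q.1 q.2
  continuous_fy : Continuous fun q : ℝ × ℝ => fy q.1 q.2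
  continuous_fyy : Continuous fun q : ℝ × ℝ => fyy q.1 q.2

/-- The function and its partial derivatives over `x` and over `x'` differ by at most `ε`. -/
def CloseAt (ε : ℝ) (J : Jet) (x : ℝ) (J' : Jet) (x' : ℝ) : Prop :=
  ∀ y ∈ Icc (0 : ℝ) 1, |J.f x y - J'.f x' y| ≤ ε ∧ |J.fx x y - J'.fx x' y| ≤ ε ∧
    |J.fy x y - J'.fy x' y| ≤ ε ∧ |J.fyy x y - J'.fyy x' y| ≤ ε

theorem CloseAt.trans {ε ε' : ℝ} {J J' J'' : Jet} {x x' x'' : ℝ} (h : CloseAt ε J x J' x')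
    (h' : CloseAt ε' J' x' J'' x'') : CloseAt (ε + ε') J x J'' x'' := by
  intro y hy
  obtain ⟨h1, h2, h3, h4⟩ := h y hy
  obtain ⟨h1', h2', h3', h4'⟩ := h' y hy
  exact ⟨(abs_sub_le _ _ _).trans (add_le_add h1 h1'), (abs_sub_le _ _ _).trans (add_le_add h2 h2'),
    (abs_sub_le _ _ _).trans (add_le_add h3 h3'), (abs_sub_le _ _ _).trans (add_le_add h4 h4')⟩

theorem eventually_close_of_continuous {G : ℝ → ℝ → ℝ} (hG : Continuous fun q : ℝ × ℝ => G q.1 q.2)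
    (x₀ : ℝ) {ε : ℝ} (hε : 0 < ε) :
    ∀ᶠ x in 𝓝 x₀, ∀ y ∈ Icc (0 : ℝ) 1, |G x y - G x₀ y| ≤ ε := by
  have h : ∀ y ∈ Icc (0 : ℝ) 1, ∀ᶠ q : ℝ × ℝ in 𝓝 y ×ˢ 𝓝 x₀, |G q.2 q.1 - G x₀ q.1| < ε := by
    intro y _
    rw [← nhds_prod_eq]
    have hc : Continuous fun q : ℝ × ℝ => |G q.2 q.1 - G x₀ q.1| :=
      ((hG.comp (f := fun q : ℝ × ℝ => (q.2, q.1)) (by fun_prop)).sub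
        (hG.comp (f := fun q : ℝ × ℝ => (x₀, q.1)) (by fun_prop))).abs
    refine hc.continuousAt.eventually (gt_mem_nhds ?_)
    simpa using hε
  filter_upwards [isCompact_Icc.eventually_forall_of_forall_eventually (x₀ := x₀)
    (P := fun x y => |G x y - G x₀ y| < ε) (fun y hy => by
      have := h y hy
      rw [← nhds_prod_eq] at this
      exact (continuous_swap.tendsto (x₀, y)).eventually this)] with x hx y hy using (hx y hy).le

theorem Jet.eventually_closeAt (J : Jet) (x₀ : ℝ) {ε : ℝ} (hε : 0 < ε) :
    ∀ᶠ x in 𝓝 x₀, CloseAt ε J x J x₀ := by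
  filter_upwards [eventually_close_of_continuous J.continuous_f x₀ hε,
    eventually_close_of_continuous J.continuous_fx x₀ hε,
    eventually_close_of_continuous J.continuous_fy x₀ hε,
    eventually_close_of_continuous J.continuous_fyy x₀ hε] with x h1 h2 h3 h4 y hy
  exact ⟨h1 y hy, h2 y hy, h3 y hy, h4 y hy⟩

theorem abs_mul_sub_le {s a b ε : ℝ} (hs : |s| = 1) (h : |a - b| ≤ ε) : |s * a - s * b| ≤ ε := by
  rw [← mul_sub, abs_mul, hs, one_mul]; exact h

theorem eventually_pos_of_close {G : ℝ → ℝ} {K : Set ℝ} (hK : IsCompact K)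
    (hG : ContinuousOn G K) {s : ℝ} (hs : |s| = 1) (h : ∀ y ∈ K, 0 < s * G y) :
    ∀ᶠ ε in 𝓝[>] (0 : ℝ), ∀ G' : ℝ → ℝ, (∀ y ∈ K, |G' y - G y| ≤ ε) → ∀ y ∈ K, 0 < s * G' y := by
  rcases K.eq_empty_or_nonempty with rfl | hne
  · simp
  obtain ⟨y₀, hy₀, hmin⟩ := hK.exists_isMinOn hne (continuousOn_const.mul hG (f := fun _ => s))
  have hpos := h y₀ hy₀
  filter_upwards [Ioo_mem_nhdsGT hpos] with ε hε G' hG' y hy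
  have h1 := abs_le.1 (abs_mul_sub_le hs (hG' y hy))
  have h2 : s * G y₀ ≤ s * G y := hmin hy
  have := hε.2
  linarith [h1.1]

/-- Transversality at the zeros in a compact set is an open condition in the `C¹` topology. -/
theorem eventually_trans_of_close {G H : ℝ → ℝ} {K : Set ℝ} (hK : IsCompact K)
    (hG : ContinuousOn G K) (hH : ContinuousOn H K) {s : ℝ} (hs : |s| = 1)
    (h : ∀ y ∈ K, G y = 0 → s * H y < 0) :
    ∀ᶠ ε in 𝓝[>] (0 : ℝ), ∀ G' H' : ℝ → ℝ, (∀ y ∈ K, |G' y - G y| ≤ ε) →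
      (∀ y ∈ K, |H' y - H y| ≤ ε) → ∀ y ∈ K, G' y = 0 → s * H' y < 0 := by
  rcases K.eq_empty_or_nonempty with rfl | hne
  · simp
  -- at each point, either `G` is nonzero or `H` has the correct sign
  have hc : ContinuousOn (fun y => max |G y| (-(s * H y))) K :=
    ContinuousOn.sup hG.abs (continuousOn_const.mul hH).neg
  obtain ⟨y₀, hy₀, hmin⟩ := hK.exists_isMinOn hne hc
  have hpos : 0 < max |G y₀| (-(s * H y₀)) := by
    by_cases h0 : G y₀ = 0
    · exact lt_max_of_lt_right (by linarith [h y₀ hy₀ h0])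
    · exact lt_max_of_lt_left (abs_pos.2 h0)
  filter_upwards [Ioo_mem_nhdsGT hpos] with ε hε G' H' hG' hH' y hy hy0
  have h1 := hG' y hy
  rw [hy0, zero_sub, abs_neg] at h1
  have h2 : max |G y₀| (-(s * H y₀)) ≤ max |G y| (-(s * H y)) := hmin hy
  have h3 := hε.2.trans_le h2
  rcases lt_max_iff.1 h3 with h4 | h4
  · exact absurd h1 (not_le.2 h4)
  · have := abs_le.1 (abs_mul_sub_le hs (hH' y hy))
    linarith [this.2]

theorem abs_neg_one_pow_real (j : ℕ) : |(-1 : ℝ) ^ j| = 1 := by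
  rw [abs_pow, abs_neg, abs_one, one_pow]

/-- The function `g` with derivative `g'` has `m` zeros in `[0, 1]`, all of them simple; they are
separated by the points `z j`, between which the sign of `g` alternates. -/
structure Alternates (g g' : ℝ → ℝ) (z : ℕ → ℝ) (m : ℕ) : Prop where
  nonneg : 0 ≤ z 0
  last : z (m + 1) = 1
  lt : ∀ j ≤ m, z j < z (j + 1)
  sign : ∀ j ≤ m, 0 < (-1) ^ j * g (z j)
  trans : ∀ j < m, ∀ y ∈ Icc (z j) (z (j + 1)), g y = 0 → (-1) ^ j * g' y < 0
  pos_left : ∀ y ∈ Icc 0 (z 0), 0 < g y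
  pos : ∀ y ∈ Icc (z m) (z (m + 1)), 0 < (-1) ^ m * g y

theorem separators_mem {z : ℕ → ℝ} {m : ℕ} (h0 : 0 ≤ z 0) (h1 : z (m + 1) = 1)
    (hlt : ∀ j ≤ m, z j < z (j + 1)) {j : ℕ} (hj : j ≤ m + 1) : z j ∈ Icc (0 : ℝ) 1 := by
  have hle : ∀ i j, i ≤ j → j < m + 2 → z i ≤ z j := fun i j =>
    le_of_steps (fun i hi => (hlt i (by omega)).le)
  constructor
  · exact h0.trans (hle 0 j (by omega) (by omega))
  · rw [← h1]; exact hle j _ hj (by omega)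

theorem separators_Icc_subset {z : ℕ → ℝ} {m : ℕ} (h0 : 0 ≤ z 0) (h1 : z (m + 1) = 1)
    (hlt : ∀ j ≤ m, z j < z (j + 1)) {i j : ℕ} (hi : i ≤ m + 1) (hj : j ≤ m + 1) :
    Icc (z i) (z j) ⊆ Icc (0 : ℝ) 1 :=
  Icc_subset_Icc (separators_mem h0 h1 hlt hi).1 (separators_mem h0 h1 hlt hj).2

theorem Jet.continuous_f_right (J : Jet) (x : ℝ) : Continuous (J.f x) :=
  J.continuous_f.comp (f := fun y : ℝ => (x, y)) (by fun_prop)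

theorem Jet.continuous_fx_right (J : Jet) (x : ℝ) : Continuous (J.fx x) :=
  J.continuous_fx.comp (f := fun y : ℝ => (x, y)) (by fun_prop)

theorem Jet.continuous_fy_right (J : Jet) (x : ℝ) : Continuous (J.fy x) :=
  J.continuous_fy.comp (f := fun y : ℝ => (x, y)) (by fun_prop)

theorem Jet.continuous_fyy_right (J : Jet) (x : ℝ) : Continuous (J.fyy x) :=
  J.continuous_fyy.comp (f := fun y : ℝ => (x, y)) (by fun_prop)

theorem Jet.eventually_pos (F : Jet) (x₀ : ℝ) {a b s : ℝ} (hab : Icc a b ⊆ Icc (0 : ℝ) 1)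
    (hs : |s| = 1) (h : ∀ y ∈ Icc a b, 0 < s * F.f x₀ y) :
    ∀ᶠ ε in 𝓝[>] (0 : ℝ), ∀ (J : Jet) (x : ℝ), CloseAt ε J x F x₀ →
      ∀ y ∈ Icc a b, 0 < s * J.f x y := by
  filter_upwards [eventually_pos_of_close isCompact_Icc (F.continuous_f_right x₀).continuousOn hs h]
    with ε hε J x hJ
  exact hε (J.f x) fun y hy => (hJ y (hab hy)).1

theorem Jet.eventually_trans (F : Jet) (x₀ : ℝ) {a b s : ℝ} (hab : Icc a b ⊆ Icc (0 : ℝ) 1)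
    (hs : |s| = 1) (h : ∀ y ∈ Icc a b, F.f x₀ y = 0 → s * F.fy x₀ y < 0) :
    ∀ᶠ ε in 𝓝[>] (0 : ℝ), ∀ (J : Jet) (x : ℝ), CloseAt ε J x F x₀ →
      ∀ y ∈ Icc a b, J.f x y = 0 → s * J.fy x y < 0 := by
  filter_upwards [eventually_trans_of_close isCompact_Icc (F.continuous_f_right x₀).continuousOn
    (F.continuous_fy_right x₀).continuousOn hs h] with ε hε J x hJ
  exact hε (J.f x) (J.fy x) (fun y hy => (hJ y (hab hy)).1) (fun y hy => (hJ y (hab hy)).2.2.1)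

/-- Alternation with simple zeros is stable under small perturbations. -/
theorem Alternates.eventually {F : Jet} {x₀ : ℝ} {z : ℕ → ℝ} {m : ℕ}
    (h : Alternates (F.f x₀) (F.fy x₀) z m) :
    ∀ᶠ ε in 𝓝[>] (0 : ℝ), ∀ (J : Jet) (x : ℝ), CloseAt ε J x F x₀ →
      Alternates (J.f x) (J.fy x) z m := by
  have hsub : ∀ {i j}, i ≤ m + 1 → j ≤ m + 1 → Icc (z i) (z j) ⊆ Icc (0 : ℝ) 1 :=
    fun hi hj => separators_Icc_subset h.nonneg h.last h.lt hi hj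
  have h1 : ∀ᶠ ε in 𝓝[>] (0 : ℝ), ∀ j ∈ Finset.range (m + 1), ∀ (J : Jet) (x : ℝ),
      CloseAt ε J x F x₀ → ∀ y ∈ Icc (z j) (z j), 0 < (-1) ^ j * J.f x y := by
    rw [Finset.eventually_all]
    intro j hj
    rw [Finset.mem_range] at hj
    refine F.eventually_pos x₀ (hsub (by omega) (by omega)) (abs_neg_one_pow_real j) ?_
    intro y hy
    rw [Icc_self, mem_singleton_iff] at hy
    rw [hy]
    exact h.sign j (by omega)
  have h2 : ∀ᶠ ε in 𝓝[>] (0 : ℝ), ∀ j ∈ Finset.range m, ∀ (J : Jet) (x : ℝ),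
      CloseAt ε J x F x₀ → ∀ y ∈ Icc (z j) (z (j + 1)), J.f x y = 0 → (-1) ^ j * J.fy x y < 0 := by
    rw [Finset.eventually_all]
    intro j hj
    rw [Finset.mem_range] at hj
    exact F.eventually_trans x₀ (hsub (by omega) (by omega)) (abs_neg_one_pow_real j) (h.trans j hj)
  have h3 := F.eventually_pos x₀ (hsub (by omega) le_rfl) (abs_neg_one_pow_real m) h.pos
  have h4 := F.eventually_pos x₀ (a := 0) (b := z 0) (s := 1) (Icc_subset_Icc le_rfl
    (separators_mem h.nonneg h.last h.lt (by omega)).2) abs_one (by simpa using h.pos_left)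
  filter_upwards [h1, h2, h3, h4] with ε h1 h2 h3 h4 J x hJ
  exact ⟨h.nonneg, h.last, h.lt, fun j hj => h1 j (Finset.mem_range.2 (by omega)) J x hJ _ (by simp),
    fun j hj => h2 j (Finset.mem_range.2 hj) J x hJ, by simpa using h4 J x hJ, h3 J x hJ⟩

theorem pos_of_derivAt_pos {g g' : ℝ → ℝ} (hg : ∀ y, HasDerivAt g (g' y) y) {a b : ℝ} (hab : a < b)
    (h : ∀ y ∈ Ioo a b, 0 < g' y) : g a < g b := by
  have hm : StrictMonoOn g (Icc a b) := by
    refine strictMonoOn_of_deriv_pos (convex_Icc a b)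
      (fun y _ => (hg y).continuousAt.continuousWithinAt) fun y hy => ?_
    rw [interior_Icc] at hy
    rw [(hg y).deriv]
    exact h y hy
  exact hm (left_mem_Icc.2 hab.le) (right_mem_Icc.2 hab.le) hab

/-- In a strip where `f` is strictly convex in `y` and strictly decreasing in `x`, two zeros are
born at a single point `(t, y₀)`. -/
theorem exists_fold {f fx fy fyy : ℝ → ℝ → ℝ} {a b l h : ℝ}
    (hx : ∀ x y, HasDerivAt (fun s => f s y) (fx x y) x) (hy : ∀ x y, HasDerivAt (f x) (fy x y) y)
    (hyy : ∀ x y, HasDerivAt (fy x) (fyy x y) y) (hf : Continuous fun q : ℝ × ℝ => f q.1 q.2)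
    (hab : a ≤ b)
    (hyypos : ∀ x ∈ Icc a b, ∀ y ∈ Icc l h, 0 < fyy x y)
    (hxneg : ∀ x ∈ Icc a b, ∀ y ∈ Icc l h, fx x y < 0)
    (hl : ∀ x ∈ Icc a b, 0 < f x l) (hh : ∀ x ∈ Icc a b, 0 < f x h)
    (ha : ∀ y ∈ Icc l h, 0 < f a y) (hb : ∃ y ∈ Icc l h, f b y < 0) :
    ∃ t ∈ Ioo a b, ∃ y₀ ∈ Ioo l h, f t y₀ = 0 ∧ (∀ y ∈ Icc l h, y ≠ y₀ → 0 < f t y) ∧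
      (∀ x ∈ Ico a t, ∀ y ∈ Icc l h, 0 < f x y) ∧ (∀ x ∈ Ioc t b, f x y₀ < 0) ∧
      (∀ x ∈ Ioc t b, ∀ y ∈ Icc l y₀, f x y = 0 → fy x y < 0) ∧
      ∀ x ∈ Ioc t b, ∀ y ∈ Icc y₀ h, f x y = 0 → 0 < fy x y := by
  have hS : IsCompact (Prod.fst '' ((Icc a b ×ˢ Icc l h) ∩ {q : ℝ × ℝ | f q.1 q.2 ≤ 0})) :=
    ((isCompact_Icc.prod isCompact_Icc).inter_right
      (isClosed_le hf continuous_const)).image continuous_fst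
  obtain ⟨yb, hyb, hfb⟩ := hb
  have hSne : (Prod.fst '' ((Icc a b ×ˢ Icc l h) ∩ {q : ℝ × ℝ | f q.1 q.2 ≤ 0})).Nonempty :=
    ⟨b, (b, yb), ⟨⟨right_mem_Icc.2 hab, hyb⟩, hfb.le⟩, rfl⟩
  obtain ⟨t, ⟨⟨t', y₀⟩, ⟨⟨ht, hy₀⟩, hle⟩, rfl⟩, hmin⟩ := hS.exists_isLeast hSne
  simp only at ht hy₀ hmin
  have hle : f t' y₀ ≤ 0 := hle
  generalize t' = t at *
  have hbefore : ∀ x ∈ Ico a t, ∀ y ∈ Icc l h, 0 < f x y := by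
    intro x hxt y hy
    by_contra hcon
    have := hmin ⟨(x, y), ⟨⟨⟨hxt.1, hxt.2.le.trans ht.2⟩, hy⟩, not_lt.1 hcon⟩, rfl⟩
    exact absurd hxt.2 (not_lt.2 this)
  have hat : a < t := by
    refine lt_of_le_of_ne ht.1 ?_
    rintro rfl
    exact absurd (ha y₀ hy₀) (not_lt.2 hle)
  have hnonneg : ∀ y ∈ Icc l h, 0 ≤ f t y := by
    intro y hy
    by_contra hcon
    have h1 : ∀ᶠ x in 𝓝[<] t, f x y < 0 :=
      ((hx t y).continuousAt.eventually (gt_mem_nhds (not_le.1 hcon))).filter_mono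
        nhdsWithin_le_nhds
    obtain ⟨x, h2, h3⟩ := (h1.and (Ioo_mem_nhdsLT hat)).exists
    exact absurd (hbefore x ⟨h3.1.le, h3.2⟩ y hy) (not_lt.2 h2.le)
  have hzero : f t y₀ = 0 := le_antisymm hle (hnonneg y₀ hy₀)
  have htb : t < b := by
    refine lt_of_le_of_ne ht.2 ?_
    rintro rfl
    exact absurd (hnonneg yb hyb) (not_le.2 hfb)
  have hy₀' : y₀ ∈ Ioo l h := by
    refine ⟨lt_of_le_of_ne hy₀.1 ?_, lt_of_le_of_ne hy₀.2 ?_⟩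
    · rintro rfl
      exact absurd (hl t ht) (by rw [hzero]; exact lt_irrefl _)
    · rintro rfl
      exact absurd (hh t ht) (by rw [hzero]; exact lt_irrefl _)
  -- the derivative in `y` is increasing
  have hmono : ∀ x ∈ Icc a b, ∀ y y', y ∈ Icc l h → y' ∈ Icc l h → y < y' → fy x y < fy x y' := by
    intro x hx y y' hyl hyl' hlt
    exact pos_of_derivAt_pos (hyy x) hlt fun s hs =>
      hyypos x hx s ⟨hyl.1.trans hs.1.le, hs.2.le.trans hyl'.2⟩
  have hfy0 : fy t y₀ = 0 := by
    refine IsLocalMin.hasDerivAt_eq_zero (f := f t) ?_ (hy t y₀)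
    filter_upwards [Icc_mem_nhds hy₀'.1 hy₀'.2] with y hy
    rw [hzero]
    exact hnonneg y hy
  have hdec : ∀ x ∈ Ioc t b, f x y₀ < 0 := by
    intro x hxt
    have := pos_of_derivAt_pos (g := fun s => -f s y₀) (g' := fun s => -fx s y₀)
      (fun s => (hx s y₀).neg) hxt.1 fun s hs => by
        have := hxneg s ⟨ht.1.trans hs.1.le, hs.2.le.trans hxt.2⟩ y₀ hy₀
        linarith
    linarith
  refine ⟨t, ⟨hat, htb⟩, y₀, hy₀', hzero, ?_, hbefore, hdec, ?_, ?_⟩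
  · intro y hyI hne
    rcases lt_or_gt_of_ne hne with hlt | hlt
    · have := pos_of_derivAt_pos (g := fun s => -f t s) (g' := fun s => -fy t s)
        (fun s => (hy t s).neg) hlt fun s hs => by
          have := hmono t ht s y₀ ⟨hyI.1.trans hs.1.le, hs.2.le.trans hy₀.2⟩ hy₀ hs.2
          linarith
      linarith
    · have := pos_of_derivAt_pos (hy t) hlt fun s hs => by
          have := hmono t ht y₀ s hy₀ ⟨hy₀.1.trans hs.1.le, hs.2.le.trans hyI.2⟩ hs.1
          linarith
      linarith
  · intro x hxt y hyI h0
    have hxI : x ∈ Icc a b := ⟨ht.1.trans hxt.1.le, hxt.2⟩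
    by_contra hcon
    have hlt : y < y₀ := lt_of_le_of_ne hyI.2 fun heq => by
      have := hdec x hxt; rw [← heq, h0] at this; exact lt_irrefl _ this
    have := pos_of_derivAt_pos (hy x) hlt fun s hs => by
      have := hmono x hxI y s ⟨hyI.1, hyI.2.trans hy₀.2⟩
        ⟨hyI.1.trans hs.1.le, hs.2.le.trans hy₀.2⟩ hs.1
      linarith
    linarith [hdec x hxt]
  · intro x hxt y hyI h0
    have hxI : x ∈ Icc a b := ⟨ht.1.trans hxt.1.le, hxt.2⟩
    by_contra hcon
    have hlt : y₀ < y := lt_of_le_of_ne hyI.1 fun heq => by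
      have := hdec x hxt; rw [heq, h0] at this; exact lt_irrefl _ this
    have := pos_of_derivAt_pos (g := fun s => -f x s) (g' := fun s => -fy x s)
      (fun s => (hy x s).neg) hlt fun s hs => by
        have := hmono x hxI s y ⟨hy₀.1.trans hs.1.le, hs.2.le.trans hyI.2⟩
          ⟨hy₀.1.trans hyI.1, hyI.2⟩ hs.2
        linarith
    linarith [hdec x hxt]

/-- Near the parameter `t`, two zeros of `f x` are born on the side `0 < e * (x - t)`, at the point
`z (p + 1)`, between the separators `z p` and `z (p + 2)`; outside this interval, there are `m`
simple zeros. -/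
structure FoldAt (J : Jet) (z : ℕ → ℝ) (m p : ℕ) (e t : ℝ) (I : Set ℝ) : Prop where
  le : p ≤ m
  nonneg : 0 ≤ z 0
  last : z (m + 3) = 1
  lt : ∀ j ≤ m + 2, z j < z (j + 1)
  sign : ∀ x ∈ I, ∀ j ≤ m + 2, j ≠ p + 1 → 0 < (-1) ^ j * J.f x (z j)
  trans : ∀ x ∈ I, ∀ j < m + 2, j ≠ p → j ≠ p + 1 → ∀ y ∈ Icc (z j) (z (j + 1)),
    J.f x y = 0 → (-1) ^ j * J.fy x y < 0
  pos_left : ∀ x ∈ I, ∀ y ∈ Icc 0 (z 0), 0 < J.f x y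
  pos : ∀ x ∈ I, ∀ y ∈ Icc (z (m + 2)) (z (m + 3)), 0 < (-1) ^ m * J.f x y
  before : ∀ x ∈ I, e * (x - t) < 0 → ∀ y ∈ Icc (z p) (z (p + 2)), 0 < (-1) ^ p * J.f x y
  after : ∀ x ∈ I, 0 < e * (x - t) → Alternates (J.f x) (J.fy x) z (m + 2)
  fold : J.f t (z (p + 1)) = 0
  fold_pos : ∀ y ∈ Icc (z p) (z (p + 2)), y ≠ z (p + 1) → 0 < (-1) ^ p * J.f t y
  fold_x : J.fx t (z (p + 1)) ≠ 0

/-- If `g` has no zero between `z p` and `z (p + 2)`, then the separators `z (p + 1)` and `z (p + 2)`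
can be dropped. -/
theorem Alternates.of_skip {g g' : ℝ → ℝ} {z : ℕ → ℝ} {m p : ℕ} (hmp : p ≤ m) (h0 : 0 ≤ z 0)
    (hlast : z (m + 3) = 1) (hlt : ∀ j ≤ m + 2, z j < z (j + 1))
    (hsign : ∀ j ≤ m + 2, j ≠ p + 1 → 0 < (-1) ^ j * g (z j))
    (htrans : ∀ j < m + 2, j ≠ p → j ≠ p + 1 → ∀ y ∈ Icc (z j) (z (j + 1)),
      g y = 0 → (-1) ^ j * g' y < 0)
    (hposl : ∀ y ∈ Icc 0 (z 0), 0 < g y)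
    (hpos : ∀ y ∈ Icc (z (m + 2)) (z (m + 3)), 0 < (-1) ^ m * g y)
    (hb : ∀ y ∈ Icc (z p) (z (p + 2)), 0 < (-1) ^ p * g y) :
    Alternates g g' (fun j => if j ≤ p then z j else z (j + 2)) m := by
  have hpow : ∀ j, (-1 : ℝ) ^ (j + 2) = (-1) ^ j := fun j => by rw [pow_add]; norm_num
  refine ⟨?_, ?_, ?_, ?_, ?_, ?_, ?_⟩
  · simp [h0]
  · simp only [if_neg (show ¬ m + 1 ≤ p by omega)]
    exact hlast
  · intro j hj
    rcases lt_trichotomy j p with hjp | hjp | hjp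
    · simp only [if_pos hjp.le, if_pos (show j + 1 ≤ p by omega)]
      exact hlt j (by omega)
    · simp only [hjp, le_refl, if_true, if_neg (show ¬ p + 1 ≤ p by omega)]
      exact (hlt p (by omega)).trans ((hlt (p + 1) (by omega)).trans (hlt (p + 2) (by omega)))
    · simp only [if_neg (show ¬ j ≤ p by omega), if_neg (show ¬ j + 1 ≤ p by omega)]
      exact hlt (j + 2) (by omega)
  · intro j hj
    by_cases hjp : j ≤ p
    · simp only [if_pos hjp]
      exact hsign j (by omega) (by omega)
    · simp only [if_neg hjp]
      have := hsign (j + 2) (by omega) (by omega)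
      rwa [hpow] at this
  · intro j hj y hy h0
    rcases lt_trichotomy j p with hjp | hjp | hjp
    · simp only [if_pos hjp.le, if_pos (show j + 1 ≤ p by omega)] at hy
      exact htrans j (by omega) (by omega) (by omega) y hy h0
    · subst hjp
      simp only [le_refl, if_true, if_neg (show ¬ j + 1 ≤ j by omega)] at hy
      rcases le_total y (z (j + 2)) with hyz | hyz
      · have := hb y ⟨hy.1, hyz⟩
        rw [h0, mul_zero] at this
        exact absurd this (lt_irrefl _)
      · have := htrans (j + 2) (by omega) (by omega) (by omega) y ⟨hyz, hy.2⟩ h0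
        rwa [hpow] at this
    · simp only [if_neg (show ¬ j ≤ p by omega), if_neg (show ¬ j + 1 ≤ p by omega)] at hy
      have := htrans (j + 2) (by omega) (by omega) (by omega) y hy h0
      rwa [hpow] at this
  · intro y hy
    simp only [Nat.zero_le, if_true] at hy
    exact hposl y hy
  · intro y hy
    simp only [if_neg (show ¬ m + 1 ≤ p by omega)] at hy
    by_cases hmp' : m ≤ p
    · have : m = p := by omega
      subst this
      simp only [le_refl, if_true] at hy
      rcases le_total y (z (m + 2)) with hyz | hyz
      · exact hb y ⟨hy.1, hyz⟩
      · exact hpos y ⟨hyz, hy.2⟩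
    · simp only [if_neg hmp'] at hy
      exact hpos y hy

theorem FoldAt.alternates_before {J : Jet} {z : ℕ → ℝ} {m p : ℕ} {e t : ℝ} {I : Set ℝ}
    (h : FoldAt J z m p e t I) {x : ℝ} (hx : x ∈ I) (hxt : e * (x - t) < 0) :
    Alternates (J.f x) (J.fy x) (fun j => if j ≤ p then z j else z (j + 2)) m :=
  Alternates.of_skip h.le h.nonneg h.last h.lt (h.sign x hx) (h.trans x hx) (h.pos_left x hx)
    (h.pos x hx) (h.before x hx hxt)

/-- The infinitesimal data of a fold at `(t₀, z (p + 1))`: convexity in `y` and monotonicity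
in `x` over the strip between `z p` and `z (p + 2)`. -/
structure FoldGerm (F : Jet) (z : ℕ → ℝ) (m p : ℕ) (e t₀ : ℝ) : Prop where
  le : p ≤ m
  left_nonneg : 0 ≤ z 0
  last : z (m + 3) = 1
  lt : ∀ j ≤ m + 2, z j < z (j + 1)
  sign : ∀ j ≤ m + 2, j ≠ p + 1 → 0 < (-1) ^ j * F.f t₀ (z j)
  trans : ∀ j < m + 2, j ≠ p → j ≠ p + 1 → ∀ y ∈ Icc (z j) (z (j + 1)),
    F.f t₀ y = 0 → (-1) ^ j * F.fy t₀ y < 0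
  pos_left : ∀ y ∈ Icc 0 (z 0), 0 < F.f t₀ y
  pos : ∀ y ∈ Icc (z (m + 2)) (z (m + 3)), 0 < (-1) ^ m * F.f t₀ y
  yy_pos : ∀ y ∈ Icc (z p) (z (p + 2)), 0 < (-1) ^ p * F.fyy t₀ y
  x_neg : ∀ y ∈ Icc (z p) (z (p + 2)), 0 < (-(e * (-1) ^ p)) * F.fx t₀ y
  nonneg : ∀ y ∈ Icc (z p) (z (p + 2)), 0 ≤ (-1) ^ p * F.f t₀ y
  fold : F.f t₀ (z (p + 1)) = 0

/-- A fold persists under perturbation, at a nearby point. -/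
theorem FoldGerm.exists_foldAt {F : Jet} {z : ℕ → ℝ} {m p : ℕ} {e t₀ : ℝ}
    (h : FoldGerm F z m p e t₀) (he : e = 1 ∨ e = -1) {δ₀ : ℝ} (hδ₀ : 0 < δ₀) :
    ∃ δ, 0 < δ ∧ δ < δ₀ ∧ ∃ ε > 0, ∀ J : Jet,
      (∀ x ∈ Icc (t₀ - δ) (t₀ + δ), CloseAt ε J x F x) →
      ∃ t ∈ Ioo (t₀ - δ) (t₀ + δ), ∃ z', FoldAt J z' m p e t (Icc (t₀ - δ) (t₀ + δ)) := by
  have hmp := h.le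
  have hee : e * e = 1 := by rcases he with rfl | rfl <;> norm_num
  have habse : |e| = 1 := by rcases he with rfl | rfl <;> norm_num
  have hpow : ∀ j, (-1 : ℝ) ^ (j + 2) = (-1) ^ j := fun j => by rw [pow_add]; norm_num
  have habs : |(-(e * (-1 : ℝ) ^ p))| = 1 := by
    rw [abs_neg, abs_mul, habse, abs_neg_one_pow_real, one_mul]
  have hsub : ∀ {i j}, i ≤ m + 3 → j ≤ m + 3 → Icc (z i) (z j) ⊆ Icc (0 : ℝ) 1 :=
    fun hi hj => separators_Icc_subset h.left_nonneg h.last h.lt hi hj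
  have c1 : ∀ᶠ ε in 𝓝[>] (0 : ℝ), ∀ j ∈ Finset.range (m + 3), j ≠ p + 1 → ∀ (J : Jet) (x : ℝ),
      CloseAt ε J x F t₀ → ∀ y ∈ Icc (z j) (z j), 0 < (-1) ^ j * J.f x y := by
    rw [Finset.eventually_all]
    intro j hj
    rw [Finset.mem_range] at hj
    by_cases hjp : j = p + 1
    · exact Filter.Eventually.of_forall fun _ h => absurd hjp h
    filter_upwards [F.eventually_pos t₀ (hsub (i := j) (j := j) (by omega) (by omega))
      (abs_neg_one_pow_real j) (by
        intro y hy
        rw [Icc_self, mem_singleton_iff] at hy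
        rw [hy]
        exact h.sign j (by omega) hjp)] with ε hε _ using hε
  have c2 : ∀ᶠ ε in 𝓝[>] (0 : ℝ), ∀ j ∈ Finset.range (m + 2), j ≠ p → j ≠ p + 1 →
      ∀ (J : Jet) (x : ℝ), CloseAt ε J x F t₀ →
      ∀ y ∈ Icc (z j) (z (j + 1)), J.f x y = 0 → (-1) ^ j * J.fy x y < 0 := by
    rw [Finset.eventually_all]
    intro j hj
    rw [Finset.mem_range] at hj
    by_cases hjp : j = p
    · exact Filter.Eventually.of_forall fun _ h => absurd hjp h
    by_cases hjp' : j = p + 1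
    · exact Filter.Eventually.of_forall fun _ _ h => absurd hjp' h
    filter_upwards [F.eventually_trans t₀ (hsub (i := j) (j := j + 1) (by omega) (by omega))
      (abs_neg_one_pow_real j) (h.trans j hj hjp hjp')] with ε hε _ _ using hε
  have c3 := F.eventually_pos t₀ (hsub (by omega) le_rfl) (abs_neg_one_pow_real m) h.pos
  have c4 := eventually_pos_of_close isCompact_Icc (F.continuous_fyy_right t₀).continuousOn
    (abs_neg_one_pow_real p) h.yy_pos
  have c5 := eventually_pos_of_close isCompact_Icc (F.continuous_fx_right t₀).continuousOn
    habs h.x_neg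
  have c6 := F.eventually_pos t₀ (a := 0) (b := z 0) (s := 1) (Icc_subset_Icc le_rfl
    (separators_mem h.left_nonneg h.last h.lt (by omega)).2) abs_one (by simpa using h.pos_left)
  simp only [one_mul] at c6
  obtain ⟨ε₁, ⟨c1, c2, c3, c4, c5, c6⟩, hε₁⟩ :=
    ((c1.and (c2.and (c3.and (c4.and (c5.and c6))))).and self_mem_nhdsWithin).exists
  have hε₁ : 0 < ε₁ := hε₁
  obtain ⟨δ₁, hδ₁, hF⟩ := Metric.eventually_nhds_iff.1 (F.eventually_closeAt t₀ (half_pos hε₁))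
  set δ := min (δ₁ / 2) (δ₀ / 2) with hδ
  have hδpos : 0 < δ := lt_min (half_pos hδ₁) (half_pos hδ₀)
  have hδ1 : δ < δ₁ := (min_le_left _ _).trans_lt (by linarith)
  have hδ0 : δ < δ₀ := (min_le_right _ _).trans_lt (by linarith)
  have hFI : ∀ x ∈ Icc (t₀ - δ) (t₀ + δ), CloseAt (ε₁ / 2) F x F t₀ := by
    intro x hx
    apply hF
    rw [Real.dist_eq, abs_lt]
    constructor <;> linarith [hx.1, hx.2]
  have hstrip : Icc (z p) (z (p + 2)) ⊆ Icc (0 : ℝ) 1 := hsub (by omega) (by omega)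
  -- passage to the parameter `ξ`, for which the zeros are born as `ξ` increases
  have hI : ∀ ξ ∈ Icc (-δ) δ, t₀ + e * ξ ∈ Icc (t₀ - δ) (t₀ + δ) := by
    rintro ξ ⟨h1, h2⟩
    rcases he with rfl | rfl
    · constructor <;> linarith
    · constructor <;> linarith
  have hderx : ∀ (J : Jet) (ξ y : ℝ), HasDerivAt (fun s => (-1) ^ p * J.f (t₀ + e * s) y)
      ((-1) ^ p * (J.fx (t₀ + e * ξ) y * e)) ξ := by
    intro J ξ y
    have h1 : HasDerivAt (fun s => t₀ + e * s) e ξ := by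
      simpa using ((hasDerivAt_id ξ).const_mul e).const_add t₀
    exact ((J.hasDerivAt_x (t₀ + e * ξ) y).comp ξ h1).const_mul _
  have hxneg : ∀ (J : Jet) (ξ : ℝ), CloseAt ε₁ J (t₀ + e * ξ) F t₀ →
      ∀ y ∈ Icc (z p) (z (p + 2)), (-1) ^ p * (J.fx (t₀ + e * ξ) y * e) < 0 := by
    intro J ξ hJ y hy
    have := c5 (J.fx (t₀ + e * ξ)) (fun y hy => (hJ y (hstrip hy)).2.1) y hy
    linarith
  have hmono : ∀ {ε ε'} {J J' : Jet} {x x'}, ε ≤ ε' → CloseAt ε J x J' x' → CloseAt ε' J x J' x' :=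
    fun hle hc y hy => ⟨(hc y hy).1.trans hle, (hc y hy).2.1.trans hle,
      (hc y hy).2.2.1.trans hle, (hc y hy).2.2.2.trans hle⟩
  have hFxneg : ∀ ξ ∈ Icc (-δ) δ, ∀ y ∈ Icc (z p) (z (p + 2)),
      (-1) ^ p * (F.fx (t₀ + e * ξ) y * e) < 0 := fun ξ hξ =>
    hxneg F ξ (hmono (by linarith) (hFI _ (hI ξ hξ)))
  have hFdec : ∀ y ∈ Icc (z p) (z (p + 2)), ∀ ξ ξ', -δ ≤ ξ → ξ' ≤ δ → ξ < ξ' →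
      (-1) ^ p * F.f (t₀ + e * ξ') y < (-1) ^ p * F.f (t₀ + e * ξ) y := by
    intro y hy ξ ξ' h1 h2 hlt
    have := pos_of_derivAt_pos (fun s => (hderx F s y).neg) hlt fun s hs => by
      have := hFxneg s ⟨h1.trans hs.1.le, hs.2.le.trans h2⟩ y hy
      linarith
    simp only [Pi.neg_apply] at this
    linarith
  have hzz : z p < z (p + 1) ∧ z (p + 1) < z (p + 2) := ⟨h.lt p (by omega), h.lt (p + 1) (by omega)⟩
  have hmid : z (p + 1) ∈ Icc (z p) (z (p + 2)) := ⟨hzz.1.le, hzz.2.le⟩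
  have d1 := F.eventually_pos (t₀ + e * (-δ)) hstrip (abs_neg_one_pow_real p) (by
    intro y hy
    have h1 := hFdec y hy (-δ) 0 le_rfl hδpos.le (by linarith)
    have h2 := h.nonneg y hy
    rw [mul_zero, add_zero] at h1
    linarith)
  have d2 := F.eventually_pos (t₀ + e * δ) (a := z (p + 1)) (b := z (p + 1)) (s := -(-1) ^ p)
    (hsub (by omega) (by omega)) (by rw [abs_neg, abs_neg_one_pow_real]) (by
      intro y hy
      rw [Icc_self, mem_singleton_iff] at hy
      subst hy
      have h1 := hFdec _ hmid 0 δ (by linarith) le_rfl hδpos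
      rw [mul_zero, add_zero, h.fold, mul_zero] at h1
      linarith)
  obtain ⟨ε, ⟨⟨d1, d2⟩, hεlt⟩, hε⟩ := (((d1.and d2).and
    (Iio_mem_nhds (half_pos hε₁) |> mem_nhdsWithin_of_mem_nhds)).and self_mem_nhdsWithin).exists
  have hεlt : ε < ε₁ / 2 := hεlt
  refine ⟨δ, hδpos, hδ0, ε, hε, fun J hJ => ?_⟩
  have hJI : ∀ x ∈ Icc (t₀ - δ) (t₀ + δ), CloseAt ε₁ J x F t₀ := fun x hx =>
    hmono (by linarith) ((hJ x hx).trans (hFI x hx))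
  have hJsign : ∀ x ∈ Icc (t₀ - δ) (t₀ + δ), ∀ j ≤ m + 2, j ≠ p + 1 → 0 < (-1) ^ j * J.f x (z j) :=
    fun x hx j hj hjp => c1 j (Finset.mem_range.2 (by omega)) hjp J x (hJI x hx) _ (by simp)
  obtain ⟨τ, hτ, y₀, hy₀, hzero, hpos, hbef, haft, htr1, htr2⟩ := exists_fold
    (f := fun ξ y => (-1) ^ p * J.f (t₀ + e * ξ) y)
    (fx := fun ξ y => (-1) ^ p * (J.fx (t₀ + e * ξ) y * e))
    (fy := fun ξ y => (-1) ^ p * J.fy (t₀ + e * ξ) y)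
    (fyy := fun ξ y => (-1) ^ p * J.fyy (t₀ + e * ξ) y) (a := -δ) (b := δ)
    (l := z p) (h := z (p + 2)) (hderx J)
    (fun ξ y => (J.hasDerivAt_y _ y).const_mul _) (fun ξ y => (J.hasDerivAt_yy _ y).const_mul _)
    (continuous_const.mul (J.continuous_f.comp (f := fun q : ℝ × ℝ => (t₀ + e * q.1, q.2))
      (by fun_prop))) (by linarith)
    (fun ξ hξ => c4 _ fun y hy => (hJI _ (hI ξ hξ) y (hstrip hy)).2.2.2)
    (fun ξ hξ => hxneg J ξ (hJI _ (hI ξ hξ)))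
    (fun ξ hξ => hJsign _ (hI ξ hξ) p (by omega) (by omega))
    (fun ξ hξ => by
      have := hJsign _ (hI ξ hξ) (p + 2) (by omega) (by omega)
      rwa [hpow] at this)
    (d1 J _ (hJ _ (hI _ ⟨le_rfl, by linarith⟩)))
    ⟨z (p + 1), hmid, by
      have := d2 J _ (hJ _ (hI δ ⟨by linarith, le_rfl⟩)) (z (p + 1)) (by simp)
      linarith⟩
  have hτI : τ ∈ Icc (-δ) δ := ⟨hτ.1.le, hτ.2.le⟩
  have hback : ∀ x, t₀ + e * (e * (x - t₀)) = x := fun x => by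
    rw [← mul_assoc, hee]; ring
  have hξI : ∀ x ∈ Icc (t₀ - δ) (t₀ + δ), e * (x - t₀) ∈ Icc (-δ) δ := by
    rintro x ⟨h1, h2⟩
    rcases he with rfl | rfl
    · constructor <;> linarith
    · constructor <;> linarith
  have hdiff : ∀ x, e * (x - (t₀ + e * τ)) = e * (x - t₀) - τ := fun x => by
    linear_combination (-τ) * hee
  have hne1 : ((-1 : ℝ) ^ p) ≠ 0 := pow_ne_zero _ (by norm_num)
  let z' := Function.update z (p + 1) y₀
  have hz' : ∀ j, j ≠ p + 1 → z' j = z j := fun j hj => Function.update_of_ne hj _ _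
  have hz'p : z' (p + 1) = y₀ := Function.update_self _ _ _
  have hlt' : ∀ j ≤ m + 2, z' j < z' (j + 1) := by
    intro j hj
    by_cases h1 : j = p + 1
    · rw [h1, hz'p, hz' _ (by omega)]; exact hy₀.2
    · by_cases h2 : j = p
      · rw [h2, hz'p, hz' _ (by omega)]; exact hy₀.1
      · rw [hz' j h1, hz' (j + 1) (by omega)]; exact h.lt j hj
  have hsign' : ∀ x ∈ Icc (t₀ - δ) (t₀ + δ), ∀ j ≤ m + 2, j ≠ p + 1 →
      0 < (-1) ^ j * J.f x (z' j) := fun x hx j hj hjp => by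
    rw [hz' j hjp]; exact hJsign x hx j hj hjp
  have htrans' : ∀ x ∈ Icc (t₀ - δ) (t₀ + δ), ∀ j < m + 2, j ≠ p → j ≠ p + 1 →
      ∀ y ∈ Icc (z' j) (z' (j + 1)), J.f x y = 0 → (-1) ^ j * J.fy x y < 0 := by
    intro x hx j hj h1 h2
    rw [hz' j h2, hz' (j + 1) (by omega)]
    exact c2 j (Finset.mem_range.2 hj) h1 h2 J x (hJI x hx)
  have hpos' : ∀ x ∈ Icc (t₀ - δ) (t₀ + δ), ∀ y ∈ Icc (z' (m + 2)) (z' (m + 3)),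
      0 < (-1) ^ m * J.f x y := by
    intro x hx
    rw [hz' _ (by omega), hz' _ (by omega)]
    exact c3 J x (hJI x hx)
  have hz'0 : 0 ≤ z' 0 := by rw [hz' 0 (by omega)]; exact h.left_nonneg
  have hposl' : ∀ x ∈ Icc (t₀ - δ) (t₀ + δ), ∀ y ∈ Icc 0 (z' 0), 0 < J.f x y := by
    intro x hx
    rw [hz' 0 (by omega)]
    exact c6 J x (hJI x hx)
  refine ⟨t₀ + e * τ, ?_, z', ?_⟩
  · rcases he with rfl | rfl
    · constructor <;> linarith [hτ.1, hτ.2]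
    · constructor <;> linarith [hτ.1, hτ.2]
  · refine ⟨hmp, hz'0, ?_, hlt', hsign', htrans', hposl', hpos', ?_, ?_, ?_, ?_, ?_⟩
    · rw [hz' _ (by omega), h.last]
    · intro x hx hxt y hy
      rw [hz' p (by omega), hz' (p + 2) (by omega)] at hy
      rw [hdiff] at hxt
      have := hbef (e * (x - t₀)) ⟨(hξI x hx).1, by linarith⟩ y hy
      simp only [hback] at this
      exact this
    · intro x hx hxt
      rw [hdiff] at hxt
      have hmem : e * (x - t₀) ∈ Ioc τ δ := ⟨by linarith, (hξI x hx).2⟩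
      have k1 := haft _ hmem
      have k2 := htr1 _ hmem
      have k3 := htr2 _ hmem
      simp only [hback] at k1 k2 k3
      refine ⟨hz'0, ?_, hlt', ?_, ?_, hposl' x hx, ?_⟩
      · rw [hz' _ (by omega), h.last]
      · intro j hj
        by_cases hjp : j = p + 1
        · rw [hjp, hz'p, pow_succ]
          linarith
        · exact hsign' x hx j hj hjp
      · intro j hj y hy h0
        by_cases h1 : j = p
        · subst h1
          rw [hz'p, hz' j (by omega)] at hy
          exact k2 y hy (by rw [h0, mul_zero])
        · by_cases h2 : j = p + 1
          · subst h2
            rw [hz'p, hz' _ (by omega)] at hy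
            have := k3 y hy (by rw [h0, mul_zero])
            rw [pow_succ]
            linarith
          · exact htrans' x hx j hj h1 h2 y hy h0
      · intro y hy
        rw [hpow]
        exact hpos' x hx y hy
    · rw [hz'p]
      exact (mul_eq_zero.1 hzero).resolve_left hne1
    · intro y hy hne
      rw [hz' p (by omega), hz' (p + 2) (by omega)] at hy
      rw [hz'p] at hne
      exact hpos y hy hne
    · rw [hz'p]
      intro h0
      have := hxneg J τ (hJI _ (hI τ hτI)) y₀ ⟨hy₀.1.le, hy₀.2.le⟩
      rw [h0] at this
      simp at this

theorem CloseAt.mono {ε ε' : ℝ} {J J' : Jet} {x x' : ℝ} (h : CloseAt ε J x J' x') (hle : ε ≤ ε') :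
    CloseAt ε' J x J' x' := fun y hy =>
  ⟨(h y hy).1.trans hle, (h y hy).2.1.trans hle, (h y hy).2.2.1.trans hle,
    (h y hy).2.2.2.trans hle⟩

/-- Over `[a, b]`, the function `J.f x` has simple zeros only, `m` of them on one side of `t`
and `m + 2` on the other side, except at `t`, where the two additional zeros are born. -/
structure FoldSlab (J : Jet) (m p : ℕ) (e a b t : ℝ) : Prop where
  mem : t ∈ Ioo a b
  foldAt : ∃ z, ∃ I ∈ 𝓝 t, FoldAt J z m p e t I
  before : ∀ x ∈ Icc a b, e * (x - t) < 0 → ∃ z, Alternates (J.f x) (J.fy x) z m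
  after : ∀ x ∈ Icc a b, 0 < e * (x - t) → ∃ z, Alternates (J.f x) (J.fy x) z (m + 2)

theorem eventually_exists_alternates {F : Jet} {m : ℕ} {K : Set ℝ} (hK : IsCompact K)
    (h : ∀ x ∈ K, ∃ z, Alternates (F.f x) (F.fy x) z m) :
    ∀ᶠ ε in 𝓝[>] (0 : ℝ), ∀ (J : Jet), ∀ x ∈ K, CloseAt ε J x F x →
      ∃ z, Alternates (J.f x) (J.fy x) z m := by
  refine hK.induction_on (p := fun s => ∀ᶠ ε in 𝓝[>] (0 : ℝ), ∀ (J : Jet), ∀ x ∈ s,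
    CloseAt ε J x F x → ∃ z, Alternates (J.f x) (J.fy x) z m) ?_ ?_ ?_ ?_
  · exact Filter.Eventually.of_forall fun ε J x hx => absurd hx (notMem_empty x)
  · intro s t hst ht
    filter_upwards [ht] with ε hε J x hx using hε J x (hst hx)
  · intro s t hs ht
    filter_upwards [hs, ht] with ε h1 h2 J x hx
    rcases hx with hx | hx
    · exact h1 J x hx
    · exact h2 J x hx
  · intro x₀ hx₀
    obtain ⟨z, hz⟩ := h x₀ hx₀
    obtain ⟨ε₀, hε₀, hpos⟩ := (hz.eventually.and self_mem_nhdsWithin).exists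
    have hpos : 0 < ε₀ := hpos
    refine ⟨_, mem_nhdsWithin_of_mem_nhds (F.eventually_closeAt x₀ (half_pos hpos)), ?_⟩
    filter_upwards [mem_nhdsWithin_of_mem_nhds (Iio_mem_nhds (half_pos hpos))] with ε hε J x hx hJ
    have hε : ε < ε₀ / 2 := hε
    exact ⟨z, hε₀ J x ((hJ.trans hx).mono (by linarith))⟩

/-- The configuration of zeros over a slab persists under perturbation. -/
theorem FoldGerm.exists_foldSlab {F : Jet} {z : ℕ → ℝ} {m p : ℕ} {e a b t₀ : ℝ}
    (h : FoldGerm F z m p e t₀) (he : e = 1 ∨ e = -1) (ht₀ : t₀ ∈ Ioo a b)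
    (hbefore : ∀ x ∈ Icc a b, e * (x - t₀) < 0 → ∃ z, Alternates (F.f x) (F.fy x) z m)
    (hafter : ∀ x ∈ Icc a b, 0 < e * (x - t₀) → ∃ z, Alternates (F.f x) (F.fy x) z (m + 2)) :
    ∃ ε > 0, ∀ J : Jet, (∀ x ∈ Icc a b, CloseAt ε J x F x) →
      ∃ t, FoldSlab J m p e a b t := by
  have hδ₀ : 0 < min (t₀ - a) (b - t₀) := lt_min (by linarith [ht₀.1]) (by linarith [ht₀.2])
  obtain ⟨δ, hδ, hδlt, ε₁, hε₁, hfold⟩ := h.exists_foldAt he hδ₀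
  have hda : δ < t₀ - a := hδlt.trans_le (min_le_left _ _)
  have hdb : δ < b - t₀ := hδlt.trans_le (min_le_right _ _)
  have habs : ∀ x, |e * x| = |x| := fun x => by rcases he with rfl | rfl <;> simp
  have hK : ∀ s : ℝ, IsCompact (Icc a b ∩ {x | δ ≤ s * (e * (x - t₀))}) := fun s =>
    isCompact_Icc.inter_right (isClosed_le continuous_const (by fun_prop))
  have h1 := eventually_exists_alternates (F := F) (m := m) (hK (-1)) (by
    rintro x ⟨hx, hx'⟩
    have hx' : δ ≤ -1 * (e * (x - t₀)) := hx'
    exact hbefore x hx (by linarith))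
  have h2 := eventually_exists_alternates (F := F) (m := m + 2) (hK 1) (by
    rintro x ⟨hx, hx'⟩
    have hx' : δ ≤ 1 * (e * (x - t₀)) := hx'
    exact hafter x hx (by linarith))
  obtain ⟨ε, ⟨⟨h1, h2⟩, hlt⟩, hε⟩ := (((h1.and h2).and (mem_nhdsWithin_of_mem_nhds
    (Iio_mem_nhds hε₁))).and self_mem_nhdsWithin).exists
  have hlt : ε < ε₁ := hlt
  refine ⟨ε, hε, fun J hJ => ?_⟩
  have hsub : Icc (t₀ - δ) (t₀ + δ) ⊆ Icc a b := Icc_subset_Icc (by linarith) (by linarith)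
  obtain ⟨t, ht, z', hz'⟩ := hfold J fun x hx => (hJ x (hsub hx)).mono hlt.le
  have habs_t : |e * (t - t₀)| < δ := by
    rw [habs, abs_lt]; constructor <;> linarith [ht.1, ht.2]
  have hin : ∀ x, |e * (x - t₀)| < δ → x ∈ Icc (t₀ - δ) (t₀ + δ) := by
    intro x hx
    rw [habs, abs_lt] at hx
    constructor <;> linarith [hx.1, hx.2]
  rw [abs_lt] at habs_t
  refine ⟨t, ⟨by linarith [ht.1], by linarith [ht.2]⟩, ⟨z', _, Icc_mem_nhds ht.1 ht.2, hz'⟩, ?_, ?_⟩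
  · intro x hx hxt
    have h3 : e * (x - t) = e * (x - t₀) - e * (t - t₀) := by ring
    by_cases hfar : δ ≤ -1 * (e * (x - t₀))
    · exact h1 J x ⟨hx, hfar⟩ (hJ x hx)
    · exact ⟨_, hz'.alternates_before (hin x (abs_lt.2 ⟨by linarith, by linarith⟩)) hxt⟩
  · intro x hx hxt
    have h3 : e * (x - t) = e * (x - t₀) - e * (t - t₀) := by ring
    by_cases hfar : δ ≤ 1 * (e * (x - t₀))
    · exact h2 J x ⟨hx, hfar⟩ (hJ x hx)
    · exact ⟨_, hz'.after x (hin x (abs_lt.2 ⟨by linarith, by linarith⟩)) hxt⟩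

/-! ### Families of polynomials with prescribed births and deaths of zeros -/

/-- If all the zeros of `g` in `[a, b]` are crossed downwards, then `g` stays negative once it has
reached a nonpositive value. -/
theorem neg_of_nonpos_of_zeros_decreasing {g g' : ℝ → ℝ} (hg : ∀ y, HasDerivAt g (g' y) y)
    {a b : ℝ} (h : ∀ y ∈ Icc a b, g y = 0 → g' y < 0) {y y' : ℝ} (hy : y ∈ Icc a b)
    (hy' : y' ∈ Icc a b) (hle : g y ≤ 0) (hlt : y < y') : g y' < 0 := by
  have hnonpos : ∀ s ∈ Icc y y', g s ≤ 0 := fun s hs =>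
    image_le_of_deriv_right_lt_deriv_boundary (f := g) (f' := g') (B := fun _ => 0)
      (B' := fun _ => 0) (a := y) (b := y')
      (fun s _ => (hg s).continuousAt.continuousWithinAt) (fun s _ => (hg s).hasDerivWithinAt) hle
      (fun s => hasDerivAt_const s _)
      (fun s hs h0 => h s ⟨hy.1.trans hs.1, hs.2.le.trans hy'.2⟩ h0) hs
  refine lt_of_le_of_ne (hnonpos y' (right_mem_Icc.2 hlt.le)) fun h0 => ?_
  have h2 : ∀ᶠ s in 𝓝[<] y', slope g y' s < 0 :=
    ((hasDerivAt_iff_tendsto_slope.1 (hg y')).mono_left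
      (nhdsWithin_mono _ fun s hs => ne_of_lt hs)).eventually (gt_mem_nhds (h y' hy' h0))
  obtain ⟨s, hs, hs'⟩ := (h2.and (Ioo_mem_nhdsLT hlt)).exists
  rw [slope_def_field, h0, sub_zero] at hs
  have h3 := hnonpos s ⟨hs'.1.le, hs'.2.le⟩
  exact absurd hs (not_lt.2 (div_nonneg_of_nonpos h3 (by linarith [hs'.2])))

/-- The polynomial `N₂` has, in addition to the zeros of `N₁`, two zeros `α < β` in an interval
`[z p, z (p + 2)]` that contains no zero of `N₁`. -/
structure Insertion (N₁ N₂ : Polynomial ℝ) (α β : ℝ) (z : ℕ → ℝ) (m p : ℕ) : Prop where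
  eq : N₂ = N₁ * ((Polynomial.X - Polynomial.C α) * (Polynomial.X - Polynomial.C β))
  le : p ≤ m
  nonneg : 0 ≤ z 0
  last : z (m + 3) = 1
  lt : ∀ j ≤ m + 2, z j < z (j + 1)
  left_lt : z p < α
  lt_right : β < z (p + 2)
  lt_mid : α < z (p + 1)
  mid : z (p + 1) = (α + β) / 2
  sign : ∀ j ≤ m + 2, j ≠ p + 1 → 0 < (-1) ^ j * N₁.eval (z j)
  trans : ∀ j < m + 2, j ≠ p → j ≠ p + 1 → ∀ y ∈ Icc (z j) (z (j + 1)),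
    N₁.eval y = 0 → (-1) ^ j * N₁.derivative.eval y < 0
  pos_left : ∀ y ∈ Icc 0 (z 0), 0 < N₁.eval y
  pos : ∀ y ∈ Icc (z (m + 2)) (z (m + 3)), 0 < (-1) ^ m * N₁.eval y
  strip : ∀ y ∈ Icc (z p) (z (p + 2)), 0 < (-1) ^ p * N₁.eval y

namespace Insertion

variable {N₁ N₂ : Polynomial ℝ} {α β : ℝ} {z : ℕ → ℝ} {m p : ℕ}

theorem alternates_left (h : Insertion N₁ N₂ α β z m p) :
    Alternates (fun y => N₁.eval y) (fun y => N₁.derivative.eval y)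
      (fun j => if j ≤ p then z j else z (j + 2)) m :=
  Alternates.of_skip h.le h.nonneg h.last h.lt h.sign h.trans h.pos_left h.pos h.strip

/-- The quadratic factor that interpolates between `1` (at `θ = 0`) and `(y - α) * (y - β)`
(at `θ = 1`). -/
def factor (α β θ y : ℝ) : ℝ := 1 - θ + θ * ((y - α) * (y - β))

theorem factor_pos (h : Insertion N₁ N₂ α β z m p) {θ : ℝ} (h0 : 0 ≤ θ) (h1 : θ ≤ 1) {y : ℝ}
    (hy : y ≤ z p ∨ z (p + 2) ≤ y) : 0 < factor α β θ y := by
  have h2 := h.left_lt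
  have h3 := h.lt_right
  have h4 := h.lt_mid
  have h5 := h.mid
  have hq : 0 < (y - α) * (y - β) := by
    rcases hy with hy | hy
    · exact mul_pos_of_neg_of_neg (by linarith) (by linarith)
    · exact mul_pos (by linarith) (by linarith)
  rw [factor]
  rcases h1.lt_or_eq with h1 | rfl
  · have := mul_nonneg h0 hq.le
    linarith
  · linarith

theorem factor_eq (h : Insertion N₁ N₂ α β z m p) (θ y : ℝ) :
    factor α β θ y = θ * (y - z (p + 1)) ^ 2 + (1 - θ * (1 + ((β - α) / 2) ^ 2)) := by
  rw [factor, h.mid]; ring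

theorem z_le (h : Insertion N₁ N₂ α β z m p) {i j : ℕ} (hij : i ≤ j) (hj : j ≤ m + 3) :
    z i ≤ z j :=
  le_of_steps (N := m + 4) (fun i hi => (h.lt i (by omega)).le) hij (by omega)

/-- The zeros of `N₁ * factor α β θ` in `y`, away from the strip. -/
theorem outside (h : Insertion N₁ N₂ α β z m p) {θ : ℝ} (h0 : 0 ≤ θ) (h1 : θ ≤ 1) {g g' : ℝ → ℝ}
    (hg : ∀ y, g y = N₁.eval y * factor α β θ y)
    (hg' : ∀ y, g' y = N₁.derivative.eval y * factor α β θ y +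
      N₁.eval y * (2 * θ * (y - z (p + 1)))) :
    (∀ j ≤ m + 2, j ≠ p + 1 → 0 < (-1) ^ j * g (z j)) ∧
    (∀ j < m + 2, j ≠ p → j ≠ p + 1 → ∀ y ∈ Icc (z j) (z (j + 1)),
      g y = 0 → (-1) ^ j * g' y < 0) ∧
    (∀ y ∈ Icc 0 (z 0), 0 < g y) ∧
    (∀ y ∈ Icc (z (m + 2)) (z (m + 3)), 0 < (-1) ^ m * g y) := by
  have hle := h.le
  refine ⟨?_, ?_, ?_, ?_⟩
  · intro j hj hjp
    rw [hg, ← mul_assoc]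
    refine mul_pos (h.sign j hj hjp) (h.factor_pos h0 h1 ?_)
    rcases lt_or_gt_of_ne hjp with hlt | hlt
    · exact Or.inl (h.z_le (by omega) (by omega))
    · exact Or.inr (h.z_le (by omega) (by omega))
  · intro j hj hjp hjp' y hy hy0
    have hpos : 0 < factor α β θ y := by
      refine h.factor_pos h0 h1 ?_
      rcases lt_or_gt_of_ne hjp with hlt | hlt
      · exact Or.inl (hy.2.trans (h.z_le (by omega) (by omega)))
      · exact Or.inr (le_trans (h.z_le (by omega) (by omega)) hy.1)
    rw [hg, mul_eq_zero] at hy0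
    have hN := hy0.resolve_right hpos.ne'
    rw [hg', hN, zero_mul, add_zero, ← mul_assoc]
    exact mul_neg_of_neg_of_pos (h.trans j hj hjp hjp' y hy hN) hpos
  · intro y hy
    rw [hg]
    exact mul_pos (h.pos_left y hy)
      (h.factor_pos h0 h1 (Or.inl (hy.2.trans (h.z_le (by omega) (by omega)))))
  · intro y hy
    rw [hg, ← mul_assoc]
    exact mul_pos (h.pos y hy)
      (h.factor_pos h0 h1 (Or.inr (le_trans (h.z_le (by omega) (by omega)) hy.1)))

/-- Before the fold, the factor has no zero. -/
theorem alternates_before (h : Insertion N₁ N₂ α β z m p) {θ : ℝ} (h0 : 0 ≤ θ)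
    (hθ : θ * (1 + ((β - α) / 2) ^ 2) < 1) {g g' : ℝ → ℝ}
    (hg : ∀ y, g y = N₁.eval y * factor α β θ y)
    (hg' : ∀ y, g' y = N₁.derivative.eval y * factor α β θ y +
      N₁.eval y * (2 * θ * (y - z (p + 1)))) : ∃ z', Alternates g g' z' m := by
  have h1 : θ ≤ 1 := by nlinarith [mul_nonneg h0 (sq_nonneg ((β - α) / 2))]
  obtain ⟨k1, k2, k3, k4⟩ := h.outside h0 h1 hg hg'
  refine ⟨_, Alternates.of_skip h.le h.nonneg h.last h.lt k1 k2 k3 k4 fun y hy => ?_⟩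
  rw [hg, ← mul_assoc]
  refine mul_pos (h.strip y hy) ?_
  rw [h.factor_eq]
  have := mul_nonneg h0 (sq_nonneg (y - z (p + 1)))
  linarith

/-- After the fold, the factor has two simple zeros, symmetric with respect to `z (p + 1)`. -/
theorem alternates_after (h : Insertion N₁ N₂ α β z m p) {θ : ℝ} (h1 : θ ≤ 1)
    (hθ : 1 < θ * (1 + ((β - α) / 2) ^ 2)) {g g' : ℝ → ℝ}
    (hg : ∀ y, g y = N₁.eval y * factor α β θ y)
    (hg' : ∀ y, g' y = N₁.derivative.eval y * factor α β θ y +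
      N₁.eval y * (2 * θ * (y - z (p + 1)))) : Alternates g g' z (m + 2) := by
  have h0 : 0 < θ := by
    by_contra hcon
    nlinarith [mul_nonneg (neg_nonneg.2 (not_lt.1 hcon)) (sq_nonneg ((β - α) / 2))]
  have hpow : ∀ j, (-1 : ℝ) ^ (j + 2) = (-1) ^ j := fun j => by rw [pow_add]; norm_num
  have hle := h.le
  obtain ⟨k1, k2, k3, k4⟩ := h.outside h0.le h1 hg hg'
  have hmid : factor α β θ (z (p + 1)) < 0 := by
    rw [h.factor_eq, sub_self]; linarith
  have hl := h.lt p (by omega)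
  have hr := h.lt (p + 1) (by omega)
  refine ⟨h.nonneg, h.last, h.lt, ?_, ?_, k3, ?_⟩
  · intro j hj
    by_cases hjp : j = p + 1
    · subst hjp
      have h2 := mul_neg_of_pos_of_neg (h.strip (z (p + 1)) ⟨hl.le, hr.le⟩) hmid
      rw [hg, pow_succ]
      linarith
    · exact k1 j hj hjp
  · intro j hj y hy hy0
    -- within the strip, the zeros of `g` are those of the factor
    have hstrip : y ∈ Icc (z p) (z (p + 2)) → factor α β θ y = 0 ∧ y ≠ z (p + 1) := by
      intro hys
      have h2 := h.strip y hys
      rw [hg, mul_eq_zero] at hy0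
      have h3 := hy0.resolve_left fun h4 => by rw [h4, mul_zero] at h2; exact lt_irrefl _ h2
      exact ⟨h3, by rintro rfl; exact hmid.ne h3⟩
    by_cases h3 : j = p
    · subst h3
      have hys : y ∈ Icc (z j) (z (j + 2)) := ⟨hy.1, hy.2.trans hr.le⟩
      obtain ⟨h4, h5⟩ := hstrip hys
      have h6 : y - z (j + 1) < 0 := sub_neg.2 (lt_of_le_of_ne hy.2 h5)
      rw [hg', h4, mul_zero, zero_add, ← mul_assoc]
      exact mul_neg_of_pos_of_neg (h.strip y hys) (mul_neg_of_pos_of_neg (by linarith) h6)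
    by_cases h4 : j = p + 1
    · subst h4
      have hys : y ∈ Icc (z p) (z (p + 2)) := ⟨hl.le.trans hy.1, hy.2⟩
      obtain ⟨h4, h5⟩ := hstrip hys
      have h6 : 0 < y - z (p + 1) := sub_pos.2 (lt_of_le_of_ne hy.1 h5.symm)
      rw [hg', h4, mul_zero, zero_add, pow_succ]
      have := mul_pos (h.strip y hys) (mul_pos (by linarith : 0 < 2 * θ) h6)
      linarith
    · exact k2 j hj h3 h4 y hy hy0
  · intro y hy
    rw [hpow]
    exact k4 y hy

/-- At the value of `θ` for which the factor has a double zero, there is a fold. -/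
theorem exists_foldGerm (h : Insertion N₁ N₂ α β z m p) {θ e t₀ c : ℝ}
    (hθ : θ * (1 + ((β - α) / 2) ^ 2) = 1) (hc : 0 < c) {F : Jet}
    (hg : ∀ y, F.f t₀ y = N₁.eval y * factor α β θ y)
    (hg' : ∀ y, F.fy t₀ y = N₁.derivative.eval y * factor α β θ y +
      N₁.eval y * (2 * θ * (y - z (p + 1))))
    (hg'' : F.fyy t₀ (z (p + 1)) = N₁.eval (z (p + 1)) * (2 * θ))
    (hfx : ∀ y, F.fx t₀ y = c * (e * (N₁.eval y * ((y - α) * (y - β) - 1))))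
    (he : e = 1 ∨ e = -1) :
    ∃ z', FoldGerm F z' m p e t₀ := by
  have hsq : 0 ≤ ((β - α) / 2) ^ 2 := sq_nonneg _
  have h0 : 0 < θ := by
    by_contra hcon
    nlinarith [mul_nonneg (neg_nonneg.2 (not_lt.1 hcon)) hsq]
  have h1 : θ ≤ 1 := by nlinarith [mul_nonneg h0.le hsq]
  have hle := h.le
  obtain ⟨k1, k2, k3, k4⟩ := h.outside h0.le h1 hg hg'
  have hl := h.lt p (by omega)
  have hr := h.lt (p + 1) (by omega)
  have hfac : ∀ y, factor α β θ y = θ * (y - z (p + 1)) ^ 2 := fun y => by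
    rw [h.factor_eq, hθ, sub_self, add_zero]
  have hstrip : ∀ y ∈ Icc (z p) (z (p + 2)), y ≠ z (p + 1) → 0 < (-1) ^ p * F.f t₀ y := by
    intro y hy hne
    rw [hg, ← mul_assoc]
    refine mul_pos (h.strip y hy) ?_
    rw [hfac]
    have := sub_ne_zero.2 hne
    positivity
  -- the strip has to be shrunk, so that `F` is convex there
  have hyy : ∀ᶠ y in 𝓝 (z (p + 1)), 0 < (-1) ^ p * F.fyy t₀ y := by
    refine (continuous_const.mul (F.continuous_fyy_right t₀)).continuousAt.eventually
      (lt_mem_nhds ?_)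
    change 0 < (-1) ^ p * F.fyy t₀ (z (p + 1))
    rw [hg'', ← mul_assoc]
    exact mul_pos (h.strip _ ⟨hl.le, hr.le⟩) (by linarith)
  obtain ⟨ρ, hρ, hball⟩ := Metric.eventually_nhds_iff.1 hyy
  have hmin : 0 < min (ρ / 2) (min ((z (p + 1) - z p) / 2) ((z (p + 2) - z (p + 1)) / 2)) :=
    lt_min (by linarith) (lt_min (by linarith) (by linarith))
  obtain ⟨r, hr0, hr1, hr2, hr3⟩ : ∃ r > 0, r < ρ ∧ z p < z (p + 1) - r ∧
      z (p + 1) + r < z (p + 2) := by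
    refine ⟨_, hmin, (min_le_left _ _).trans_lt (by linarith), ?_, ?_⟩
    · have := (min_le_right (ρ / 2) _).trans
        (min_le_left ((z (p + 1) - z p) / 2) ((z (p + 2) - z (p + 1)) / 2))
      linarith
    · have := (min_le_right (ρ / 2) _).trans
        (min_le_right ((z (p + 1) - z p) / 2) ((z (p + 2) - z (p + 1)) / 2))
      linarith
  let z' : ℕ → ℝ := fun j =>
    if j = p then z (p + 1) - r else if j = p + 2 then z (p + 1) + r else z j
  have hz'p : z' p = z (p + 1) - r := if_pos rfl
  have hz'p2 : z' (p + 2) = z (p + 1) + r := by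
    change (if p + 2 = p then _ else if p + 2 = p + 2 then _ else _) = _
    rw [if_neg (by omega), if_pos rfl]
  have hz' : ∀ j, j ≠ p → j ≠ p + 2 → z' j = z j := fun j h1 h2 => by
    change (if j = p then _ else if j = p + 2 then _ else _) = _
    rw [if_neg h1, if_neg h2]
  have hz'p1 : z' (p + 1) = z (p + 1) := hz' _ (by omega) (by omega)
  -- every interval of the new separators is contained in the old one, except for a part of the strip
  have hlow : ∀ j, j ≠ p + 2 → z j ≤ z' j ∧ (j ≠ p → z' j = z j) := by
    intro j hj
    by_cases hjp : j = p
    · subst hjp; exact ⟨by rw [hz'p]; linarith, fun h => absurd rfl h⟩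
    · exact ⟨(hz' j hjp hj).ge, fun h => hz' j h hj⟩
  have hpowp : (-1 : ℝ) ^ (p + 2) = (-1) ^ p := by rw [pow_add]; norm_num
  have hsub : z p ∈ Icc (0 : ℝ) 1 ∧ z (p + 2) ∈ Icc (0 : ℝ) 1 :=
    ⟨separators_mem (m := m + 2) h.nonneg h.last h.lt (by omega),
      separators_mem (m := m + 2) h.nonneg h.last h.lt (by omega)⟩
  refine ⟨z', hle, ?_, ?_, ?_, ?_, ?_, ?_, ?_, ?_, ?_, ?_, ?_⟩
  · exact h.nonneg.trans (hlow 0 (by omega)).1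
  · rw [hz' _ (by omega) (by omega), h.last]
  · intro j hj
    by_cases c1 : j = p
    · subst c1; rw [hz'p, hz'p1]; linarith
    by_cases c2 : j = p + 1
    · subst c2; rw [hz'p1, hz'p2]; linarith
    by_cases c3 : j = p + 2
    · subst c3
      rw [hz'p2, hz' _ (by omega) (by omega)]
      have := h.lt (p + 2) hj
      linarith
    · rw [hz' j c1 c3]
      refine (h.lt j hj).trans_le (hlow _ (by omega)).1
  · intro j hj hjp
    by_cases c1 : j = p
    · subst c1
      exact hstrip _ (by rw [hz'p]; constructor <;> linarith) (by rw [hz'p]; linarith)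
    by_cases c3 : j = p + 2
    · subst c3
      rw [hpowp]
      exact hstrip _ (by rw [hz'p2]; constructor <;> linarith) (by rw [hz'p2]; linarith)
    · rw [hz' j c1 c3]; exact k1 j hj hjp
  · intro j hj c1 c2 y hy hy0
    have hns : ¬ (y ∈ Icc (z p) (z (p + 2)) ∧ y ≠ z (p + 1)) := fun hcon => by
      have := hstrip y hcon.1 hcon.2
      rw [hy0, mul_zero] at this
      exact lt_irrefl _ this
    refine k2 j hj c1 c2 y ⟨?_, ?_⟩ hy0
    · by_cases c3 : j = p + 2
      · subst c3
        rw [hz'p2] at hy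
        by_contra hcon
        exact hns ⟨⟨by linarith [hy.1], (not_le.1 hcon).le⟩, by linarith [hy.1]⟩
      · rw [hz' j c1 c3] at hy; exact hy.1
    · by_cases c3 : j + 1 = p
      · rw [c3, hz'p] at hy
        rw [c3]
        by_contra hcon
        exact hns ⟨⟨(not_le.1 hcon).le, by linarith [hy.2]⟩, by linarith [hy.2]⟩
      · rw [hz' (j + 1) c3 (by omega)] at hy; exact hy.2
  · intro y hy
    by_cases hp0 : p = 0
    · subst hp0
      rw [hz'p] at hy
      rcases le_total y (z 0) with hyz | hyz
      · exact k3 y ⟨hy.1, hyz⟩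
      · simpa using hstrip y ⟨hyz, by linarith [hy.2]⟩ (by linarith [hy.2])
    · rw [hz' 0 (by omega) (by omega)] at hy
      exact k3 y hy
  · intro y hy
    rw [hz' (m + 3) (by omega) (by omega)] at hy
    by_cases hpm : m = p
    · subst hpm
      rw [hz'p2] at hy
      rcases le_total y (z (m + 2)) with hyz | hyz
      · exact hstrip y ⟨by linarith [hy.1], hyz⟩ (by linarith [hy.1])
      · exact k4 y ⟨hyz, hy.2⟩
    · rw [hz' (m + 2) (by omega) (by omega)] at hy
      exact k4 y hy
  · intro y hy
    rw [hz'p, hz'p2] at hy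
    refine hball ?_
    rw [Real.dist_eq, abs_lt]
    constructor <;> linarith [hy.1, hy.2]
  · intro y hy
    rw [hz'p, hz'p2] at hy
    have h2 := h.strip y ⟨by linarith [hy.1], by linarith [hy.2]⟩
    have hab : (y - α) * (y - β) < 1 := by
      have a1 := h.left_lt
      have a2 := h.lt_right
      have a3 := h.lt_mid
      have a4 := h.mid
      have b1 := hsub.1.1
      have b2 := hsub.2.2
      nlinarith [hy.1, hy.2]
    have hee : e * e = 1 := by rcases he with rfl | rfl <;> norm_num
    have h3 := mul_pos hc (mul_pos h2 (sub_pos.2 hab))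
    rw [hfx]
    have h4 : -(e * (-1) ^ p) * (c * (e * (N₁.eval y * ((y - α) * (y - β) - 1)))) =
      (e * e) * (c * ((-1) ^ p * N₁.eval y * (1 - (y - α) * (y - β)))) := by ring
    rw [h4, hee, one_mul]
    exact h3
  · intro y hy
    rw [hz'p, hz'p2] at hy
    by_cases hne : y = z (p + 1)
    · rw [hne, hg, hfac, sub_self]; simp
    · exact (hstrip y ⟨by linarith [hy.1], by linarith [hy.2]⟩ hne).le
  · rw [hz'p1, hg, hfac, sub_self]; simp

end Insertion

theorem exists_zero_of_sign {g : ℝ → ℝ} (hg : Continuous g) {a b s : ℝ} (hab : a < b)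
    (ha : 0 < s * g a) (hb : s * g b < 0) : ∃ y ∈ Ioo a b, g y = 0 := by
  obtain ⟨y, hy, h0⟩ := intermediate_value_Ioo' (f := fun y => s * g y) hab.le
    (continuous_const.mul hg).continuousOn ⟨hb, ha⟩
  refine ⟨y, hy, ?_⟩
  have hs : s ≠ 0 := by rintro rfl; simp at ha
  exact (mul_eq_zero.1 h0).resolve_left hs

/-- Two zeros can be inserted to the right of any separator `z p`, so close to it that the other zeros
are not affected. -/
theorem Alternates.exists_insertion {N : Polynomial ℝ} {z : ℕ → ℝ} {m p : ℕ}
    (h : Alternates (fun y => N.eval y) (fun y => N.derivative.eval y) z m) (hp : p ≤ m) :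
    ∃ N₂ α β z', Insertion N N₂ α β z' m p := by
  have hpowp : (-1 : ℝ) ^ (p + 2) = (-1) ^ p := by rw [pow_add]; norm_num
  have hpow : ∀ j, (-1 : ℝ) ^ (j + 2) = (-1) ^ j := fun j => by rw [pow_add]; norm_num
  have hev : ∀ᶠ y in 𝓝 (z p), 0 < (-1) ^ p * N.eval y :=
    (continuous_const.mul N.continuous).continuousAt.eventually (lt_mem_nhds (h.sign p hp))
  obtain ⟨ρ, hρ, hball⟩ := Metric.eventually_nhds_iff.1 hev
  have hlt := h.lt p hp
  obtain ⟨r, hr0, hr1, hr2⟩ : ∃ r > 0, r < ρ ∧ z p + r < z (p + 1) := by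
    refine ⟨min (ρ / 2) ((z (p + 1) - z p) / 2), lt_min (by linarith) (by linarith),
      (min_le_left _ _).trans_lt (by linarith), ?_⟩
    have := min_le_right (ρ / 2) ((z (p + 1) - z p) / 2)
    linarith
  have hstrip : ∀ y ∈ Icc (z p) (z p + r), 0 < (-1) ^ p * N.eval y := by
    intro y hy
    refine hball ?_
    rw [Real.dist_eq, abs_lt]
    constructor <;> linarith [hy.1, hy.2]
  let z' : ℕ → ℝ := fun j => if j ≤ p then z j else if j = p + 1 then z p + r / 2 else
    if j = p + 2 then z p + r else z (j - 2)
  have e1 : ∀ j, j ≤ p → z' j = z j := fun j hj => if_pos hj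
  have e2 : z' (p + 1) = z p + r / 2 := by
    change (if p + 1 ≤ p then _ else if p + 1 = p + 1 then _ else _) = _
    rw [if_neg (by omega), if_pos rfl]
  have e3 : z' (p + 2) = z p + r := by
    change (if p + 2 ≤ p then _ else if p + 2 = p + 1 then _ else
      if p + 2 = p + 2 then _ else _) = _
    rw [if_neg (by omega), if_neg (by omega), if_pos rfl]
  have e4 : ∀ j, p < j → z' (j + 2) = z j := fun j hj => by
    change (if j + 2 ≤ p then _ else if j + 2 = p + 1 then _ else
      if j + 2 = p + 2 then _ else z (j + 2 - 2)) = _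
    rw [if_neg (by omega), if_neg (by omega), if_neg (by omega), Nat.add_sub_cancel]
  have hcases : ∀ j, j ≤ p ∨ j = p + 1 ∨ j = p + 2 ∨ ∃ i, p < i ∧ j = i + 2 := by
    intro j
    by_cases h1 : j ≤ p
    · exact Or.inl h1
    by_cases h2 : j = p + 1
    · exact Or.inr (Or.inl h2)
    by_cases h3 : j = p + 2
    · exact Or.inr (Or.inr (Or.inl h3))
    · exact Or.inr (Or.inr (Or.inr ⟨j - 2, by omega, by omega⟩))
  refine ⟨_, z p + r / 4, z p + 3 * r / 4, z', rfl, hp, ?_, ?_, ?_, ?_, ?_, ?_, ?_, ?_, ?_, ?_,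
    ?_, ?_⟩
  · rw [e1 0 (by omega)]; exact h.nonneg
  · rw [show m + 3 = (m + 1) + 2 from rfl, e4 _ (by omega), h.last]
  · intro j hj
    rcases hcases j with c | rfl | rfl | ⟨i, hi, rfl⟩
    · rcases c.lt_or_eq with c | rfl
      · rw [e1 _ c.le, e1 _ (by omega)]; exact h.lt j (by omega)
      · rw [e1 _ le_rfl, e2]; linarith
    · rw [e2, e3]; linarith
    · rw [e3, show p + 2 + 1 = p + 1 + 2 from rfl, e4 _ (by omega)]; linarith
    · rw [show i + 2 + 1 = i + 1 + 2 from rfl, e4 _ hi, e4 _ (by omega)]; exact h.lt i (by omega)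
  · rw [e1 p le_rfl]; linarith
  · rw [e3]; linarith
  · rw [e2]; linarith
  · rw [e2]; ring
  · intro j hj hjp
    rcases hcases j with c | rfl | rfl | ⟨i, hi, rfl⟩
    · rw [e1 _ c]; exact h.sign j (by omega)
    · exact absurd rfl hjp
    · rw [e3, hpowp]; exact hstrip _ ⟨by linarith, le_rfl⟩
    · rw [e4 _ hi, hpow]; exact h.sign i (by omega)
  · intro j hj c1 c2 y hy hy0
    rcases hcases j with c | rfl | rfl | ⟨i, hi, rfl⟩
    · rw [e1 _ c, e1 _ (by omega)] at hy
      exact h.trans j (by omega) y hy hy0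
    · exact absurd rfl c2
    · rw [e3, show p + 2 + 1 = p + 1 + 2 from rfl, e4 _ (by omega)] at hy
      rw [hpowp]
      exact h.trans p (by omega) y ⟨by linarith [hy.1], hy.2⟩ hy0
    · rw [show i + 2 + 1 = i + 1 + 2 from rfl, e4 _ hi, e4 _ (by omega)] at hy
      rw [hpow]
      exact h.trans i (by omega) y hy hy0
  · rw [e1 0 (by omega)]; exact h.pos_left
  · intro y hy
    rw [show m + 3 = (m + 1) + 2 from rfl, e4 (m + 1) (by omega)] at hy
    by_cases hpm : p = m
    · subst hpm
      rw [e3] at hy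
      exact h.pos y ⟨by linarith [hy.1], hy.2⟩
    · rw [e4 _ (by omega)] at hy
      exact h.pos y hy
  · rw [e1 p le_rfl, e3]; exact hstrip

theorem Insertion.derivative_eval {N₁ N₂ : Polynomial ℝ} {α β : ℝ} {z : ℕ → ℝ} {m p : ℕ}
    (h : Insertion N₁ N₂ α β z m p) (y : ℝ) :
    N₂.derivative.eval y = N₁.derivative.eval y * ((y - α) * (y - β)) +
      N₁.eval y * (2 * (y - z (p + 1))) := by
  rw [h.eq, h.mid]
  simp only [Polynomial.derivative_mul, Polynomial.derivative_sub, Polynomial.derivative_X,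
    Polynomial.derivative_C, Polynomial.eval_add, Polynomial.eval_mul, Polynomial.eval_sub,
    Polynomial.eval_X, Polynomial.eval_C, Polynomial.eval_one, Polynomial.eval_zero]
  ring

theorem Insertion.eval {N₁ N₂ : Polynomial ℝ} {α β : ℝ} {z : ℕ → ℝ} {m p : ℕ}
    (h : Insertion N₁ N₂ α β z m p) (y : ℝ) :
    N₂.eval y = N₁.eval y * ((y - α) * (y - β)) := by
  rw [h.eq]
  simp

theorem Insertion.alternates_right {N₁ N₂ : Polynomial ℝ} {α β : ℝ} {z : ℕ → ℝ} {m p : ℕ}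
    (h : Insertion N₁ N₂ α β z m p) :
    Alternates (fun y => N₂.eval y) (fun y => N₂.derivative.eval y) z (m + 2) := by
  have h1 := h.lt_mid
  have h2 := h.mid
  refine h.alternates_after le_rfl ?_ (fun y => ?_) (fun y => ?_)
  · have : 0 < ((β - α) / 2) ^ 2 := by
      have : 0 < β - α := by linarith
      positivity
    linarith
  · rw [h.eval, Insertion.factor]; ring
  · rw [h.derivative_eval, Insertion.factor]; ring

/-- The two zeros on both sides of the separator `z (p + 1)` can be divided out. -/
theorem Alternates.exists_removal {N : Polynomial ℝ} {z : ℕ → ℝ} {m p : ℕ}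
    (h : Alternates (fun y => N.eval y) (fun y => N.derivative.eval y) z (m + 2)) (hp : p ≤ m) :
    ∃ N₁ α β z', Insertion N₁ N α β z' m p := by
  have hpow : ∀ j, (-1 : ℝ) ^ (j + 2) = (-1) ^ j := fun j => by rw [pow_add]; norm_num
  have s0 := h.sign p (by omega)
  have s1 := h.sign (p + 1) (by omega)
  have s2 := h.sign (p + 2) (by omega)
  obtain ⟨α, hα, hα0⟩ := exists_zero_of_sign N.continuous (s := (-1) ^ p) (h.lt p (by omega)) s0
    (by rw [pow_succ] at s1; linarith)
  obtain ⟨β, hβ, hβ0⟩ := exists_zero_of_sign N.continuous (s := (-1) ^ (p + 1))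
    (h.lt (p + 1) (by omega)) s1 (by rw [hpow] at s2; rw [pow_succ]; linarith)
  have hαβ : α < β := hα.2.trans hβ.1
  obtain ⟨A, hA⟩ := Polynomial.dvd_iff_isRoot.2 hα0
  have hAβ : A.eval β = 0 := by
    rw [hA] at hβ0
    simp only [Polynomial.eval_mul, Polynomial.eval_sub, Polynomial.eval_X, Polynomial.eval_C,
      mul_eq_zero] at hβ0
    exact hβ0.resolve_left (sub_ne_zero.2 hαβ.ne')
  obtain ⟨N₁, hN₁⟩ := Polynomial.dvd_iff_isRoot.2 hAβ
  have heq : N = N₁ * ((Polynomial.X - Polynomial.C α) * (Polynomial.X - Polynomial.C β)) := by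
    rw [hA, hN₁]; ring
  have hev : ∀ y, N.eval y = N₁.eval y * ((y - α) * (y - β)) := fun y => by rw [heq]; simp
  have hdv : ∀ y, N₁.eval y = 0 →
      N.derivative.eval y = N₁.derivative.eval y * ((y - α) * (y - β)) := fun y hy => by
    rw [heq]; simp [hy]
  have hle : ∀ i j, i ≤ j → j ≤ m + 3 → z i ≤ z j := fun i j hij hj =>
    le_of_steps (N := m + 4) (fun i hi => (h.lt i (by omega)).le) hij (by omega)
  have hq : ∀ y, y ≤ z p ∨ z (p + 2) ≤ y → 0 < (y - α) * (y - β) := by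
    rintro y (hy | hy)
    · exact mul_pos_of_neg_of_neg (by linarith [hα.1]) (by linarith [hα.1])
    · exact mul_pos (by linarith [hβ.2]) (by linarith [hβ.2])
  have hsign : ∀ y, y ≤ z p ∨ z (p + 2) ≤ y → ∀ s, 0 < s * N.eval y → 0 < s * N₁.eval y := by
    intro y hy s hs
    rw [hev, ← mul_assoc] at hs
    exact pos_of_mul_pos_left hs (hq y hy).le
  -- a zero of a transversal function is unique in its interval
  have huniq : ∀ j ≤ m + 1, ∀ r ∈ Icc (z j) (z (j + 1)), ∀ y ∈ Icc (z j) (z (j + 1)),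
      N.eval r = 0 → N.eval y = 0 → ¬ r < y := by
    intro j hj r hr y hy hr0 hy0 hlt
    have := neg_of_nonpos_of_zeros_decreasing (g := fun y => (-1) ^ j * N.eval y)
      (g' := fun y => (-1) ^ j * N.derivative.eval y) (fun y => (N.hasDerivAt y).const_mul _)
      (a := z j) (b := z (j + 1)) (fun s hs h0 => h.trans j (by omega) s hs
        ((mul_eq_zero.1 h0).resolve_left (pow_ne_zero _ (by norm_num)))) hr hy
      (by simp [hr0]) hlt
    simp [hy0] at this
  have hne : ∀ y ∈ Icc (z p) (z (p + 2)), N₁.eval y ≠ 0 := by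
    intro y hy h0
    have hy0 : N.eval y = 0 := by rw [hev, h0, zero_mul]
    rcases le_total y (z (p + 1)) with hyz | hyz
    · have hyI : y ∈ Icc (z p) (z (p + 1)) := ⟨hy.1, hyz⟩
      have hyα : y = α := le_antisymm
        (not_lt.1 (huniq p (by omega) α ⟨hα.1.le, hα.2.le⟩ y hyI hα0 hy0))
        (not_lt.1 (huniq p (by omega) y hyI α ⟨hα.1.le, hα.2.le⟩ hy0 hα0))
      have := h.trans p (by omega) y hyI hy0
      rw [hdv y h0, hyα, sub_self] at this
      simp at this
    · have hyI : y ∈ Icc (z (p + 1)) (z (p + 1 + 1)) := ⟨hyz, hy.2⟩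
      have hyβ : y = β := le_antisymm
        (not_lt.1 (huniq (p + 1) (by omega) β ⟨hβ.1.le, hβ.2.le⟩ y hyI hβ0 hy0))
        (not_lt.1 (huniq (p + 1) (by omega) y hyI β ⟨hβ.1.le, hβ.2.le⟩ hy0 hβ0))
      have := h.trans (p + 1) (by omega) y hyI hy0
      rw [hdv y h0, hyβ, sub_self] at this
      simp at this
  have hstrip : ∀ y ∈ Icc (z p) (z (p + 2)), 0 < (-1) ^ p * N₁.eval y := by
    intro y hy
    have h0 := hsign (z p) (Or.inl le_rfl) _ s0
    by_contra hcon
    have hlt : z p < y := lt_of_le_of_ne hy.1 (by rintro rfl; exact hcon h0)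
    have hneg : (-1) ^ p * N₁.eval y < 0 :=
      lt_of_le_of_ne (not_lt.1 hcon) (mul_ne_zero (pow_ne_zero _ (by norm_num)) (hne y hy))
    obtain ⟨s, hs, hs0⟩ := exists_zero_of_sign N₁.continuous hlt h0 hneg
    exact hne s ⟨hs.1.le, hs.2.le.trans hy.2⟩ hs0
  let z' := Function.update z (p + 1) ((α + β) / 2)
  have hz' : ∀ j, j ≠ p + 1 → z' j = z j := fun j hj => Function.update_of_ne hj _ _
  have hz'p : z' (p + 1) = (α + β) / 2 := Function.update_self _ _ _
  refine ⟨N₁, α, β, z', heq, hp, ?_, ?_, ?_, ?_, ?_, ?_, hz'p, ?_, ?_, ?_, ?_, ?_⟩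
  · rw [hz' 0 (by omega)]; exact h.nonneg
  · rw [hz' _ (by omega), ← h.last]
  · intro j hj
    by_cases h1 : j = p + 1
    · rw [h1, hz'p, hz' _ (by omega)]
      have := hβ.2
      linarith
    · by_cases h2 : j = p
      · rw [h2, hz'p, hz' _ (by omega)]
        have := hα.1
        linarith
      · rw [hz' j h1, hz' (j + 1) (by omega)]; exact h.lt j hj
  · rw [hz' p (by omega)]; exact hα.1
  · rw [hz' (p + 2) (by omega)]; exact hβ.2
  · rw [hz'p]; linarith
  · intro j hj hjp
    rw [hz' j hjp]
    refine hsign _ ?_ _ (h.sign j hj)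
    rcases lt_or_gt_of_ne hjp with hlt | hlt
    · exact Or.inl (hle _ _ (by omega) (by omega))
    · exact Or.inr (hle _ _ (by omega) (by omega))
  · intro j hj h1 h2 y hy h0
    rw [hz' j h2, hz' (j + 1) (by omega)] at hy
    have h3 := h.trans j hj y hy (by simp only [hev, h0, zero_mul])
    rw [hdv y h0, ← mul_assoc] at h3
    have h4 : 0 < (y - α) * (y - β) := by
      refine hq y ?_
      rcases lt_or_gt_of_ne h1 with hlt | hlt
      · exact Or.inl (hy.2.trans (hle _ _ (by omega) (by omega)))
      · exact Or.inr ((hle _ _ (by omega) (by omega)).trans hy.1)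
    exact neg_of_mul_neg_left h3 h4.le
  · intro y hy
    rw [hz' 0 (by omega)] at hy
    have := hsign y (Or.inl (hy.2.trans (hle _ _ (by omega) (by omega)))) 1
      (by simpa using h.pos_left y hy)
    simpa using this
  · intro y hy
    rw [hz' _ (by omega), hz' _ (by omega)] at hy
    have := h.pos y hy
    rw [hpow] at this
    exact hsign y (Or.inr ((hle _ _ (by omega) (by omega)).trans hy.1)) _ this
  · rw [hz' p (by omega), hz' (p + 2) (by omega)]; exact hstrip

/-- Every valid pattern is realized by a sequence of polynomials, each of which is obtained from
the previous one by the insertion or the removal of two adjacent zeros. -/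
theorem ValidPattern.exists_polynomials {n : ℕ} {k p : ℕ → ℕ} {e : ℕ → ℝ}
    (h : ValidPattern n k p e) : ∃ N : ℕ → Polynomial ℝ, ∀ i < n, ∃ α β z,
      (e i = 1 ∧ k (i + 1) = k i + 1 ∧ Insertion (N i) (N (i + 1)) α β z (2 * k i) (p i)) ∨
      (e i = -1 ∧ k i = k (i + 1) + 1 ∧
        Insertion (N (i + 1)) (N i) α β z (2 * k (i + 1)) (p i)) := by
  suffices hind : ∀ l ≤ n, ∃ N : ℕ → Polynomial ℝ,
      (∃ z, Alternates (fun y => (N l).eval y) (fun y => (N l).derivative.eval y) z (2 * k l)) ∧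
      ∀ i < l, ∃ α β z,
      (e i = 1 ∧ k (i + 1) = k i + 1 ∧ Insertion (N i) (N (i + 1)) α β z (2 * k i) (p i)) ∨
      (e i = -1 ∧ k i = k (i + 1) + 1 ∧
        Insertion (N (i + 1)) (N i) α β z (2 * k (i + 1)) (p i)) by
    obtain ⟨N, -, hN⟩ := hind n le_rfl
    exact ⟨N, hN⟩
  intro l
  induction l with
  | zero =>
    intro _
    refine ⟨fun _ => 1, ⟨fun j => j, ?_⟩, fun i hi => absurd hi (Nat.not_lt_zero i)⟩
    rw [h.start]
    exact ⟨by simp, by simp, by simp, by simp, by simp, by simp, by simp⟩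
  | succ l ih =>
    intro hl
    obtain ⟨N, ⟨z, hz⟩, hN⟩ := ih (by omega)
    have hpl := h.pos_le l (by omega)
    obtain ⟨M, ⟨z', hz'⟩, hM⟩ : ∃ M : Polynomial ℝ,
        (∃ z, Alternates (fun y => M.eval y) (fun y => M.derivative.eval y) z (2 * k (l + 1))) ∧
        ∃ α β z,
        (e l = 1 ∧ k (l + 1) = k l + 1 ∧ Insertion (N l) M α β z (2 * k l) (p l)) ∨
        (e l = -1 ∧ k l = k (l + 1) + 1 ∧ Insertion M (N l) α β z (2 * k (l + 1)) (p l)) := by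
      rcases h.step l (by omega) with ⟨h1, h2⟩ | ⟨h1, h2⟩
      · obtain ⟨M, α, β, z', hM⟩ := hz.exists_insertion (p := p l) (by omega)
        refine ⟨M, ⟨z', ?_⟩, α, β, z', Or.inl ⟨h1, h2, hM⟩⟩
        rw [h2]
        exact hM.alternates_right
      · rw [h2] at hz
        obtain ⟨M, α, β, z', hM⟩ := Alternates.exists_removal (m := 2 * k (l + 1)) (p := p l) hz
          (by omega)
        exact ⟨M, ⟨_, hM.alternates_left⟩, α, β, z', Or.inr ⟨h1, h2, hM⟩⟩
    refine ⟨Function.update N (l + 1) M, ⟨z', ?_⟩, fun i hi => ?_⟩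
    · rw [Function.update_self]; exact hz'
    · rw [Function.update_of_ne (show i ≠ l + 1 by omega)]
      by_cases hil : i = l
      · subst hil
        rw [Function.update_self]
        exact hM
      · rw [Function.update_of_ne (show i + 1 ≠ l + 1 by omega)]
        exact hN i (by omega)

/-- The derivative of `smoothStep`: a positive function on `(0, 1)` of integral `1`, which vanishes
elsewhere. -/
noncomputable def stepDeriv (τ : ℝ) : ℝ := 6 * (max 0 τ * max 0 (1 - τ))

theorem continuous_stepDeriv : Continuous stepDeriv := by
  unfold stepDeriv; fun_prop

theorem stepDeriv_pos {τ : ℝ} (hτ : τ ∈ Ioo (0 : ℝ) 1) : 0 < stepDeriv τ := by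
  rw [stepDeriv, max_eq_right hτ.1.le, max_eq_right (by linarith [hτ.2])]
  have h1 := hτ.1
  have h2 : 0 < 1 - τ := by linarith [hτ.2]
  positivity

theorem stepDeriv_of_nonpos {τ : ℝ} (hτ : τ ≤ 0) : stepDeriv τ = 0 := by
  rw [stepDeriv, max_eq_left hτ]; simp

theorem stepDeriv_of_one_le {τ : ℝ} (hτ : 1 ≤ τ) : stepDeriv τ = 0 := by
  rw [stepDeriv, max_eq_left (by linarith : 1 - τ ≤ 0)]; simp

/-- A continuously differentiable step from `0` to `1`. -/
noncomputable def smoothStep (t : ℝ) : ℝ := ∫ τ in (0 : ℝ)..t, stepDeriv τ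

theorem hasDerivAt_smoothStep (t : ℝ) : HasDerivAt smoothStep (stepDeriv t) t :=
  intervalIntegral.integral_hasDerivAt_right (continuous_stepDeriv.intervalIntegrable _ _)
    (continuous_stepDeriv.stronglyMeasurableAtFilter _ _) continuous_stepDeriv.continuousAt

theorem smoothStep_of_nonpos {t : ℝ} (ht : t ≤ 0) : smoothStep t = 0 := by
  rw [smoothStep]
  refine (intervalIntegral.integral_congr (g := fun _ => 0) fun τ hτ => ?_).trans (by simp)
  rw [uIcc_of_ge ht] at hτ
  exact stepDeriv_of_nonpos hτ.2

theorem smoothStep_one : smoothStep 1 = 1 := by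
  have h : ∀ τ ∈ uIcc (0 : ℝ) 1, HasDerivAt (fun τ : ℝ => 3 * τ ^ 2 - 2 * τ ^ 3) (stepDeriv τ) τ := by
    intro τ hτ
    rw [uIcc_of_le zero_le_one] at hτ
    have h1 := ((hasDerivAt_pow 2 τ).const_mul 3).sub ((hasDerivAt_pow 3 τ).const_mul 2)
    refine h1.congr_deriv ?_
    rw [stepDeriv, max_eq_right hτ.1, max_eq_right (by linarith [hτ.2])]
    norm_num
    ring
  rw [smoothStep, intervalIntegral.integral_eq_sub_of_hasDerivAt h
    (continuous_stepDeriv.intervalIntegrable _ _)]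
  norm_num

theorem smoothStep_of_one_le {t : ℝ} (ht : 1 ≤ t) : smoothStep t = 1 := by
  have h1 : ∫ τ in (1 : ℝ)..t, stepDeriv τ = 0 := by
    refine (intervalIntegral.integral_congr (g := fun _ => 0) fun τ hτ => ?_).trans (by simp)
    rw [uIcc_of_le ht] at hτ
    exact stepDeriv_of_one_le hτ.1
  have h2 := smoothStep_one
  rw [smoothStep] at h2 ⊢
  rw [← intervalIntegral.integral_add_adjacent_intervals
    (continuous_stepDeriv.intervalIntegrable _ 1) (continuous_stepDeriv.intervalIntegrable 1 _),
    h1, h2, add_zero]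

theorem smoothStep_lt {s t : ℝ} (hs : 0 ≤ s) (ht : t ≤ 1) (hst : s < t) :
    smoothStep s < smoothStep t :=
  pos_of_derivAt_pos hasDerivAt_smoothStep hst fun _ hτ =>
    stepDeriv_pos ⟨hs.trans_lt hτ.1, hτ.2.trans_le ht⟩

theorem smoothStep_mem {t : ℝ} (ht : t ∈ Icc (0 : ℝ) 1) : smoothStep t ∈ Icc (0 : ℝ) 1 := by
  constructor
  · rcases ht.1.eq_or_lt with h | h
    · rw [← h, smoothStep_of_nonpos le_rfl]
    · rw [← smoothStep_of_nonpos le_rfl]; exact (smoothStep_lt le_rfl ht.2 h).le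
  · rcases ht.2.eq_or_lt with h | h
    · rw [h, smoothStep_one]
    · rw [← smoothStep_one]; exact (smoothStep_lt ht.1 le_rfl h).le

theorem exists_smoothStep_eq {c : ℝ} (hc : c ∈ Ioo (0 : ℝ) 1) :
    ∃ τ ∈ Ioo (0 : ℝ) 1, smoothStep τ = c := by
  have hcont : ContinuousOn smoothStep (Icc 0 1) := fun t _ =>
    (hasDerivAt_smoothStep t).continuousAt.continuousWithinAt
  exact intermediate_value_Ioo zero_le_one hcont
    (by rwa [smoothStep_of_nonpos le_rfl, smoothStep_one])

/-- The polynomials `N i`, interpolated by means of the functions `σ i`. -/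
noncomputable def Jet.separable (n : ℕ) (N : ℕ → Polynomial ℝ) (σ σ' : ℕ → ℝ → ℝ)
    (hσ : ∀ i x, HasDerivAt (σ i) (σ' i x) x) (hσ' : ∀ i, Continuous (σ' i)) : Jet where
  f x y := (N 0).eval y + ∑ i ∈ Finset.range n, σ i x * ((N (i + 1)).eval y - (N i).eval y)
  fx x y := ∑ i ∈ Finset.range n, σ' i x * ((N (i + 1)).eval y - (N i).eval y)
  fy x y := (N 0).derivative.eval y + ∑ i ∈ Finset.range n,
    σ i x * ((N (i + 1)).derivative.eval y - (N i).derivative.eval y)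
  fyy x y := (N 0).derivative.derivative.eval y + ∑ i ∈ Finset.range n,
    σ i x * ((N (i + 1)).derivative.derivative.eval y - (N i).derivative.derivative.eval y)
  hasDerivAt_x x y := by
    refine (HasDerivAt.fun_sum fun i _ => (hσ i x).mul_const _).const_add _
  hasDerivAt_y x y := ((N 0).hasDerivAt y).add (HasDerivAt.fun_sum fun i _ =>
    (((N (i + 1)).hasDerivAt y).sub ((N i).hasDerivAt y)).const_mul _)
  hasDerivAt_yy x y := ((N 0).derivative.hasDerivAt y).add (HasDerivAt.fun_sum fun i _ =>
    (((N (i + 1)).derivative.hasDerivAt y).sub ((N i).derivative.hasDerivAt y)).const_mul _)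
  continuous_f := by
    have : ∀ i, Continuous (σ i) := fun i => continuous_iff_continuousAt.2 fun x =>
      (hσ i x).continuousAt
    fun_prop
  continuous_fx := by fun_prop
  continuous_fy := by
    have : ∀ i, Continuous (σ i) := fun i => continuous_iff_continuousAt.2 fun x =>
      (hσ i x).continuousAt
    fun_prop
  continuous_fyy := by
    have : ∀ i, Continuous (σ i) := fun i => continuous_iff_continuousAt.2 fun x =>
      (hσ i x).continuousAt
    fun_prop

theorem sum_smoothStep {n i : ℕ} (hi : i < n) {x : ℝ} (hx : x ∈ Icc (i : ℝ) (i + 1)) (a : ℕ → ℝ) :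
    a 0 + ∑ j ∈ Finset.range n, smoothStep (x - j) * (a (j + 1) - a j) =
      a i + smoothStep (x - i) * (a (i + 1) - a i) := by
  rw [← Finset.sum_subset (Finset.range_subset_range.2 (Nat.succ_le_of_lt hi)),
    Finset.sum_range_succ, Finset.sum_congr rfl (g := fun j => a (j + 1) - a j),
    Finset.sum_range_sub]
  · ring
  · intro j hj
    have h1 : (j : ℝ) + 1 ≤ i := by exact_mod_cast Finset.mem_range.1 hj
    rw [smoothStep_of_one_le (by linarith [hx.1]), one_mul]
  · intro j _ hj
    have h1 : (i : ℝ) + 1 ≤ j := by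
      have : i + 1 ≤ j := not_lt.1 fun h => hj (Finset.mem_range.2 h)
      exact_mod_cast this
    rw [smoothStep_of_nonpos (by linarith [hx.2]), zero_mul]

theorem sum_stepDeriv {n i : ℕ} (hi : i < n) {x : ℝ} (hx : x ∈ Icc (i : ℝ) (i + 1)) (a : ℕ → ℝ) :
    ∑ j ∈ Finset.range n, stepDeriv (x - j) * a j = stepDeriv (x - i) * a i := by
  refine Finset.sum_eq_single_of_mem i (Finset.mem_range.2 hi) fun j _ hji => ?_
  rcases lt_or_gt_of_ne hji with h | h
  · have h1 : (j : ℝ) + 1 ≤ i := by exact_mod_cast h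
    rw [stepDeriv_of_one_le (by linarith [hx.1]), zero_mul]
  · have h1 : (i : ℝ) + 1 ≤ j := by exact_mod_cast h
    rw [stepDeriv_of_nonpos (by linarith [hx.2]), zero_mul]

/-- The model family: the polynomial `N i` at `x = i`, interpolated by means of `smoothStep`. -/
noncomputable def modelJet (n : ℕ) (N : ℕ → Polynomial ℝ) : Jet :=
  Jet.separable n N (fun i x => smoothStep (x - i)) (fun i x => stepDeriv (x - i))
    (fun i x => by
      simpa using (hasDerivAt_smoothStep (x - i)).comp_sub_const x (i : ℝ))
    (fun i => continuous_stepDeriv.comp (by fun_prop))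

theorem modelJet_f {n i : ℕ} (N : ℕ → Polynomial ℝ) (hi : i < n) {x : ℝ}
    (hx : x ∈ Icc (i : ℝ) (i + 1)) (y : ℝ) : (modelJet n N).f x y =
      (N i).eval y + smoothStep (x - i) * ((N (i + 1)).eval y - (N i).eval y) :=
  sum_smoothStep hi hx fun i => (N i).eval y

theorem modelJet_fy {n i : ℕ} (N : ℕ → Polynomial ℝ) (hi : i < n) {x : ℝ}
    (hx : x ∈ Icc (i : ℝ) (i + 1)) (y : ℝ) : (modelJet n N).fy x y =
      (N i).derivative.eval y +
        smoothStep (x - i) * ((N (i + 1)).derivative.eval y - (N i).derivative.eval y) :=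
  sum_smoothStep hi hx fun i => (N i).derivative.eval y

theorem modelJet_fyy {n i : ℕ} (N : ℕ → Polynomial ℝ) (hi : i < n) {x : ℝ}
    (hx : x ∈ Icc (i : ℝ) (i + 1)) (y : ℝ) : (modelJet n N).fyy x y =
      (N i).derivative.derivative.eval y + smoothStep (x - i) *
        ((N (i + 1)).derivative.derivative.eval y - (N i).derivative.derivative.eval y) :=
  sum_smoothStep hi hx fun i => (N i).derivative.derivative.eval y

theorem modelJet_fx {n i : ℕ} (N : ℕ → Polynomial ℝ) (hi : i < n) {x : ℝ}
    (hx : x ∈ Icc (i : ℝ) (i + 1)) (y : ℝ) : (modelJet n N).fx x y =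
      stepDeriv (x - i) * ((N (i + 1)).eval y - (N i).eval y) :=
  sum_stepDeriv hi hx fun i => (N (i + 1)).eval y - (N i).eval y

theorem Insertion.derivative_derivative_eval_mid {N₁ N₂ : Polynomial ℝ} {α β : ℝ} {z : ℕ → ℝ}
    {m p : ℕ} (h : Insertion N₁ N₂ α β z m p) :
    N₂.derivative.derivative.eval (z (p + 1)) = N₁.derivative.derivative.eval (z (p + 1)) *
      ((z (p + 1) - α) * (z (p + 1) - β)) + N₁.eval (z (p + 1)) * 2 := by
  rw [h.eq, h.mid]
  simp only [Polynomial.derivative_mul, Polynomial.derivative_sub, Polynomial.derivative_X,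
    Polynomial.derivative_C, Polynomial.eval_add, Polynomial.eval_mul, Polynomial.eval_sub,
    Polynomial.eval_X, Polynomial.eval_C, Polynomial.eval_one, Polynomial.eval_zero,
    Polynomial.derivative_add, Polynomial.derivative_one, Polynomial.derivative_zero]
  ring

/-- Over a slab on which the interpolated polynomial is `N₁ * Insertion.factor α β (θ x)`, the zeros
of a family have the expected configuration, and so have those of the nearby families. -/
theorem Insertion.exists_foldSlab {N₁ N₂ : Polynomial ℝ} {α β : ℝ} {z : ℕ → ℝ} {m p : ℕ}
    (h : Insertion N₁ N₂ α β z m p) {F : Jet} {a : ℝ} {e : ℝ} (he : e = 1 ∨ e = -1) {θ : ℝ → ℝ}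
    (hθ : ∀ s ∈ Icc (0 : ℝ) 1, θ s = if e = 1 then smoothStep s else 1 - smoothStep s)
    (hf : ∀ x ∈ Icc a (a + 1), ∀ y, F.f x y =
      N₁.eval y + θ (x - a) * (N₂.eval y - N₁.eval y))
    (hfy : ∀ x ∈ Icc a (a + 1), ∀ y, F.fy x y =
      N₁.derivative.eval y + θ (x - a) * (N₂.derivative.eval y - N₁.derivative.eval y))
    (hfyy : ∀ x ∈ Icc a (a + 1), ∀ y, F.fyy x y = N₁.derivative.derivative.eval y +
      θ (x - a) * (N₂.derivative.derivative.eval y - N₁.derivative.derivative.eval y))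
    (hfx : ∀ x ∈ Icc a (a + 1), ∀ y, F.fx x y =
      stepDeriv (x - a) * (e * (N₂.eval y - N₁.eval y))) :
    ∃ ε > 0, ∀ J : Jet, (∀ x ∈ Icc a (a + 1), CloseAt ε J x F x) →
      ∃ t, FoldSlab J m p e a (a + 1) t := by
  have hδ : 0 < ((β - α) / 2) ^ 2 := by
    have : 0 < β - α := by linarith [h.lt_mid, h.mid]
    positivity
  set δ := ((β - α) / 2) ^ 2 with hδdef
  have hc0 : 0 < 1 / (1 + δ) := by positivity
  have hc1 : 1 / (1 + δ) < 1 := by rw [div_lt_one (by linarith)]; linarith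
  -- the parameter `τ` at which the quadratic factor has a double zero
  obtain ⟨τ, hτ, hθτ⟩ : ∃ τ ∈ Ioo (0 : ℝ) 1, θ τ = 1 / (1 + δ) := by
    rcases he with rfl | rfl
    · obtain ⟨τ, hτ, h1⟩ := exists_smoothStep_eq ⟨hc0, hc1⟩
      exact ⟨τ, hτ, by rw [hθ τ ⟨hτ.1.le, hτ.2.le⟩, if_pos rfl, h1]⟩
    · obtain ⟨τ, hτ, h1⟩ := exists_smoothStep_eq (c := 1 - 1 / (1 + δ))
        ⟨by linarith, by linarith⟩
      exact ⟨τ, hτ, by rw [hθ τ ⟨hτ.1.le, hτ.2.le⟩, if_neg (by norm_num), h1]; ring⟩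
  have hθmem : ∀ s ∈ Icc (0 : ℝ) 1, θ s ∈ Icc (0 : ℝ) 1 := by
    intro s hs
    have h1 := smoothStep_mem hs
    rw [hθ s hs]
    split_ifs
    · exact h1
    · exact ⟨by linarith [h1.2], by linarith [h1.1]⟩
  have hτI : τ ∈ Icc (0 : ℝ) 1 := ⟨hτ.1.le, hτ.2.le⟩
  have hθlt : ∀ s ∈ Icc (0 : ℝ) 1, e * (s - τ) < 0 → θ s * (1 + δ) < 1 := by
    intro s hs hlt
    rw [← lt_div_iff₀ (by linarith), ← hθτ, hθ s hs, hθ τ hτI]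
    rcases he with rfl | rfl
    · rw [if_pos rfl, if_pos rfl]
      exact smoothStep_lt hs.1 hτI.2 (by linarith)
    · rw [if_neg (by norm_num), if_neg (by norm_num)]
      have := smoothStep_lt hτI.1 hs.2 (by linarith : τ < s)
      linarith
  have hθgt : ∀ s ∈ Icc (0 : ℝ) 1, 0 < e * (s - τ) → 1 < θ s * (1 + δ) := by
    intro s hs hlt
    rw [← div_lt_iff₀ (by linarith), ← hθτ, hθ s hs, hθ τ hτI]
    rcases he with rfl | rfl
    · rw [if_pos rfl, if_pos rfl]
      exact smoothStep_lt hτI.1 hs.2 (by linarith)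
    · rw [if_neg (by norm_num), if_neg (by norm_num)]
      have := smoothStep_lt hs.1 hτI.2 (by linarith : s < τ)
      linarith
  have hg : ∀ x ∈ Icc a (a + 1), ∀ y, F.f x y = N₁.eval y * Insertion.factor α β (θ (x - a)) y := by
    intro x hx y
    rw [hf x hx, h.eval, Insertion.factor]; ring
  have hg' : ∀ x ∈ Icc a (a + 1), ∀ y, F.fy x y =
      N₁.derivative.eval y * Insertion.factor α β (θ (x - a)) y +
        N₁.eval y * (2 * θ (x - a) * (y - z (p + 1))) := by
    intro x hx y
    rw [hfy x hx, h.derivative_eval, Insertion.factor]; ring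
  have hmem : ∀ x ∈ Icc a (a + 1), x - a ∈ Icc (0 : ℝ) 1 := fun x hx =>
    ⟨by linarith [hx.1], by linarith [hx.2]⟩
  have hsub : ∀ x, x - a - τ = x - (a + τ) := fun x => by ring
  have hτa : a + τ ∈ Icc a (a + 1) := ⟨by linarith [hτ.1], by linarith [hτ.2]⟩
  have haτ : a + τ - a = τ := by ring
  obtain ⟨z', hz'⟩ := h.exists_foldGerm (θ := θ τ) (e := e) (t₀ := a + τ) (F := F)
    (by rw [hθτ, ← hδdef]; field_simp) (stepDeriv_pos hτ)
    (fun y => by rw [hg _ hτa, haτ]) (fun y => by rw [hg' _ hτa, haτ])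
    (by
      rw [hfyy _ hτa, haτ, h.derivative_derivative_eval_mid, hθτ, h.mid]
      have : (1 + δ) ≠ 0 := by linarith
      field_simp
      rw [hδdef]
      ring)
    (fun y => by rw [hfx _ hτa, haτ, h.eval]; ring) he
  refine hz'.exists_foldSlab he ⟨by linarith [hτ.1], by linarith [hτ.2]⟩ ?_ ?_
  · intro x hx hlt
    rw [← hsub] at hlt
    exact h.alternates_before (hθmem _ (hmem x hx)).1 (hθlt _ (hmem x hx) hlt) (hg x hx) (hg' x hx)
  · intro x hx hlt
    rw [← hsub] at hlt
    exact ⟨z, h.alternates_after (hθmem _ (hmem x hx)).2 (hθgt _ (hmem x hx) hlt) (hg x hx)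
      (hg' x hx)⟩

/-! ### Polynomial approximation -/

theorem exists_derivative_eq (q : Polynomial ℝ) : ∃ P : Polynomial ℝ, P.derivative = q := by
  induction q using Polynomial.induction_on' with
  | add q r hq hr =>
    obtain ⟨P, hP⟩ := hq
    obtain ⟨Q, hQ⟩ := hr
    exact ⟨P + Q, by rw [Polynomial.derivative_add, hP, hQ]⟩
  | monomial k a =>
    refine ⟨Polynomial.monomial (k + 1) (a / (k + 1)), ?_⟩
    rw [Polynomial.derivative_monomial, Nat.add_sub_cancel, Nat.cast_add, Nat.cast_one,
      div_mul_cancel₀ a (by positivity)]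

/-- Approximation by polynomials in the `C¹` topology. -/
theorem exists_polynomial_near_deriv {g g' : ℝ → ℝ} (hg : ∀ x, HasDerivAt g (g' x) x)
    (hg' : Continuous g') {L : ℝ} (hL : 0 ≤ L) {η : ℝ} (hη : 0 < η) :
    ∃ φ : Polynomial ℝ, ∀ x ∈ Icc 0 L,
      |φ.eval x - g x| ≤ η ∧ |φ.derivative.eval x - g' x| ≤ η := by
  obtain ⟨q, hq⟩ := exists_polynomial_near_of_continuousOn 0 L g' hg'.continuousOn (η / (L + 1))
    (by positivity)
  obtain ⟨P, hP⟩ := exists_derivative_eq q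
  have hle : η / (L + 1) ≤ η := div_le_self hη.le (by linarith)
  refine ⟨P + Polynomial.C (g 0 - P.eval 0), fun x hx => ⟨?_, ?_⟩⟩
  · have h1 := (convex_Icc 0 L).norm_image_sub_le_of_norm_hasDerivWithin_le
      (f := fun x => (P + Polynomial.C (g 0 - P.eval 0)).eval x - g x)
      (f' := fun x => (P + Polynomial.C (g 0 - P.eval 0)).derivative.eval x - g' x)
      (C := η / (L + 1)) (x := 0) (y := x)
      (fun x _ => ((Polynomial.hasDerivAt _ x).sub (hg x)).hasDerivWithinAt)
      (fun x hx => by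
        rw [Polynomial.derivative_add, Polynomial.derivative_C, add_zero, hP]
        exact (hq x hx).le) ⟨le_rfl, hL⟩ hx
    simp only [Polynomial.eval_add, Polynomial.eval_C, Real.norm_eq_abs, sub_zero] at h1 ⊢
    rw [show P.eval x + (g 0 - P.eval 0) - g x - (P.eval 0 + (g 0 - P.eval 0) - g 0) =
      P.eval x + (g 0 - P.eval 0) - g x by ring] at h1
    refine h1.trans ?_
    rw [abs_of_nonneg hx.1]
    calc η / (L + 1) * x ≤ η / (L + 1) * (L + 1) :=
          mul_le_mul_of_nonneg_left (by linarith [hx.2]) (by positivity)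
      _ = η := by field_simp
  · rw [Polynomial.derivative_add, Polynomial.derivative_C, add_zero, hP]
    exact (hq x hx).le.trans hle

theorem abs_sum_mul_sub_sum_mul_le {n : ℕ} {a a' b : ℕ → ℝ} {η C : ℝ} (hη : 0 ≤ η)
    (h : ∀ i < n, |a i - a' i| ≤ η) (hb : ∀ i < n, |b i| ≤ C) :
    |∑ i ∈ Finset.range n, a i * b i - ∑ i ∈ Finset.range n, a' i * b i| ≤ n * (η * C) := by
  rw [← Finset.sum_sub_distrib]
  refine (Finset.abs_sum_le_sum_abs _ _).trans ?_
  refine (Finset.sum_le_card_nsmul _ _ (η * C) fun i hi => ?_).trans_eq (by simp)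
  rw [Finset.mem_range] at hi
  rw [← sub_mul, abs_mul]
  exact mul_le_mul (h i hi) (hb i hi) (abs_nonneg _) hη

theorem exists_abs_eval_le (A : ℕ → Polynomial ℝ) (n : ℕ) :
    ∃ C : ℝ, 0 ≤ C ∧ ∀ i < n, ∀ y ∈ Icc (0 : ℝ) 1, |(A i).eval y| ≤ C := by
  have h : ∀ i, ∃ C : ℝ, ∀ y ∈ Icc (0 : ℝ) 1, |(A i).eval y| ≤ C := fun i =>
    (isCompact_Icc (a := (0 : ℝ)) (b := 1)).exists_bound_of_continuousOn
      (f := fun y => (A i).eval y) (A i).continuous.continuousOn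
  choose C hC using h
  have hC0 : ∀ i, 0 ≤ C i := fun i => (abs_nonneg _).trans (hC i 0 ⟨le_rfl, zero_le_one⟩)
  refine ⟨∑ i ∈ Finset.range n, C i, Finset.sum_nonneg fun i _ => hC0 i, fun i hi y hy => ?_⟩
  exact (hC i y hy).trans
    (Finset.single_le_sum (fun i _ => hC0 i) (Finset.mem_range.2 hi))

/-- Replacing the interpolating functions by polynomial approximations of class `C¹` changes the
family, and the derivatives in a `Jet`, by an arbitrarily small amount. -/
theorem exists_separable_closeAt (n : ℕ) (N : ℕ → Polynomial ℝ) {σ σ' : ℕ → ℝ → ℝ}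
    (hσ : ∀ i x, HasDerivAt (σ i) (σ' i x) x) (hσ' : ∀ i, Continuous (σ' i)) {L : ℝ} (hL : 0 ≤ L)
    {ε : ℝ} (hε : 0 < ε) : ∃ φ : ℕ → Polynomial ℝ, ∀ x ∈ Icc 0 L,
      CloseAt ε (Jet.separable n N (fun i x => (φ i).eval x) (fun i x => (φ i).derivative.eval x)
        (fun i x => (φ i).hasDerivAt x) (fun i => (φ i).derivative.continuous)) x
        (Jet.separable n N σ σ' hσ hσ') x := by
  obtain ⟨C₀, h0, hC₀⟩ := exists_abs_eval_le (fun i => N (i + 1) - N i) n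
  obtain ⟨C₁, h1, hC₁⟩ := exists_abs_eval_le (fun i => (N (i + 1)).derivative - (N i).derivative) n
  obtain ⟨C₂, h2, hC₂⟩ := exists_abs_eval_le
    (fun i => (N (i + 1)).derivative.derivative - (N i).derivative.derivative) n
  simp only [Polynomial.eval_sub] at hC₀ hC₁ hC₂
  set C := C₀ + C₁ + C₂ with hC
  have hCpos : 0 ≤ C := by positivity
  have hη : 0 < ε / (n * C + 1) := by positivity
  choose φ hφ using fun i => exists_polynomial_near_deriv (hσ i) (hσ' i) hL hη
  have hle : (n : ℝ) * (ε / (n * C + 1) * C) ≤ ε := by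
    rw [show (n : ℝ) * (ε / (n * C + 1) * C) = ε * (n * C) / (n * C + 1) by ring,
      div_le_iff₀ (by positivity)]
    nlinarith
  refine ⟨φ, fun x hx y hy => ⟨?_, ?_, ?_, ?_⟩⟩
  · simp only [Jet.separable, add_sub_add_left_eq_sub]
    exact (abs_sum_mul_sub_sum_mul_le (C := C) hη.le (fun i _ => (hφ i x hx).1)
      (fun i hi => (hC₀ i hi y hy).trans (by linarith))).trans hle
  · simp only [Jet.separable]
    exact (abs_sum_mul_sub_sum_mul_le (C := C) hη.le (fun i _ => (hφ i x hx).2)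
      (fun i hi => (hC₀ i hi y hy).trans (by linarith))).trans hle
  · simp only [Jet.separable, add_sub_add_left_eq_sub]
    exact (abs_sum_mul_sub_sum_mul_le (C := C) hη.le (fun i _ => (hφ i x hx).1)
      (fun i hi => (hC₁ i hi y hy).trans (by linarith))).trans hle
  · simp only [Jet.separable, add_sub_add_left_eq_sub]
    exact (abs_sum_mul_sub_sum_mul_le (C := C) hη.le (fun i _ => (hφ i x hx).1)
      (fun i hi => (hC₂ i hi y hy).trans (by linarith))).trans hle

theorem eval_aeval_X (i : Fin 2) (v : Fin 2 → ℝ) (q : Polynomial ℝ) :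
    MvPolynomial.eval v (Polynomial.aeval (MvPolynomial.X i) q) = q.eval (v i) := by
  rw [← MvPolynomial.coe_aeval_eq_eval, RingHom.coe_coe, ← Polynomial.aeval_algHom_apply,
    MvPolynomial.aeval_X, Polynomial.coe_aeval_eq_eval]

theorem exists_mvPolynomial_eq_separable (n : ℕ) (N φ : ℕ → Polynomial ℝ) :
    ∃ f : MvPolynomial (Fin 2) ℝ, ∀ x y,
      MvPolynomial.eval ![x, y] f = (N 0).eval y +
        ∑ i ∈ Finset.range n, (φ i).eval x * ((N (i + 1)).eval y - (N i).eval y) ∧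
      MvPolynomial.eval ![x, y] (MvPolynomial.pderiv 0 f) =
        ∑ i ∈ Finset.range n, (φ i).derivative.eval x * ((N (i + 1)).eval y - (N i).eval y) ∧
      MvPolynomial.eval ![x, y] (MvPolynomial.pderiv 1 f) = (N 0).derivative.eval y +
        ∑ i ∈ Finset.range n,
          (φ i).eval x * ((N (i + 1)).derivative.eval y - (N i).derivative.eval y) := by
  refine ⟨Polynomial.aeval (MvPolynomial.X 1) (N 0) + ∑ i ∈ Finset.range n,
    Polynomial.aeval (MvPolynomial.X 0) (φ i) *
      (Polynomial.aeval (MvPolynomial.X 1) (N (i + 1)) -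
        Polynomial.aeval (MvPolynomial.X 1) (N i)), fun x y => ⟨?_, ?_, ?_⟩⟩
  · simp [eval_aeval_X]
  · simp [eval_aeval_X, mul_comm]
  · simp [eval_aeval_X, mul_comm]

/-- Every valid pattern of births and deaths of zeros is realized by a polynomial
over `[0, n] × [0, 1]`. -/
theorem ValidPattern.exists_mvPolynomial {n : ℕ} {k p : ℕ → ℕ} {e : ℕ → ℝ}
    (h : ValidPattern n k p e) : ∃ (f : MvPolynomial (Fin 2) ℝ) (J : Jet) (t : ℕ → ℝ),
      (∀ x y, J.f x y = MvPolynomial.eval ![x, y] f ∧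
        J.fx x y = MvPolynomial.eval ![x, y] (MvPolynomial.pderiv 0 f) ∧
        J.fy x y = MvPolynomial.eval ![x, y] (MvPolynomial.pderiv 1 f)) ∧
      ∀ i < n, FoldSlab J (2 * min (k i) (k (i + 1))) (p i) (e i) i (i + 1) (t i) := by
  obtain ⟨N, hN⟩ := h.exists_polynomials
  have hslab : ∀ i : ℕ, ∃ ε > 0, i < n → ∀ J : Jet,
      (∀ x ∈ Icc (i : ℝ) (i + 1), CloseAt ε J x (modelJet n N) x) →
      ∃ t, FoldSlab J (2 * min (k i) (k (i + 1))) (p i) (e i) i (i + 1) t := by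
    intro i
    by_cases hi : i < n
    swap
    · exact ⟨1, one_pos, fun h => absurd h hi⟩
    obtain ⟨α, β, z, ⟨he, hk, hins⟩ | ⟨he, hk, hins⟩⟩ := hN i hi
    · rw [hk, min_eq_left (Nat.le_succ _)]
      obtain ⟨ε, hε, h1⟩ := hins.exists_foldSlab (F := modelJet n N) (a := i) (e := e i)
        (Or.inl he) (θ := smoothStep) (fun s _ => by rw [if_pos he])
        (fun x hx y => by rw [modelJet_f N hi hx])
        (fun x hx y => by rw [modelJet_fy N hi hx])
        (fun x hx y => by rw [modelJet_fyy N hi hx])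
        (fun x hx y => by rw [modelJet_fx N hi hx, he, one_mul])
      exact ⟨ε, hε, fun _ => h1⟩
    · rw [hk, min_eq_right (Nat.le_succ _)]
      obtain ⟨ε, hε, h1⟩ := hins.exists_foldSlab (F := modelJet n N) (a := i) (e := e i)
        (Or.inr he) (θ := fun s => 1 - smoothStep s)
        (fun s _ => by rw [if_neg (by rw [he]; norm_num)])
        (fun x hx y => by rw [modelJet_f N hi hx]; ring)
        (fun x hx y => by rw [modelJet_fy N hi hx]; ring)
        (fun x hx y => by rw [modelJet_fyy N hi hx]; ring)
        (fun x hx y => by rw [modelJet_fx N hi hx, he]; ring)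
      exact ⟨ε, hε, fun _ => h1⟩
  choose ε hε hJ using hslab
  have hmin : ∀ᶠ δ in 𝓝[>] (0 : ℝ), ∀ i ∈ Finset.range n, δ < ε i := by
    rw [Finset.eventually_all]
    exact fun i _ => mem_nhdsWithin_of_mem_nhds (Iio_mem_nhds (hε i))
  obtain ⟨δ, hδ, hδ0⟩ := (hmin.and self_mem_nhdsWithin).exists
  have hδ0 : 0 < δ := hδ0
  obtain ⟨φ, hφ⟩ := exists_separable_closeAt n N (σ := fun i x => smoothStep (x - i))
    (σ' := fun i x => stepDeriv (x - i)) (fun i x => by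
      simpa using (hasDerivAt_smoothStep (x - i)).comp_sub_const x (i : ℝ))
    (fun i => continuous_stepDeriv.comp (by fun_prop)) (Nat.cast_nonneg n) hδ0
  obtain ⟨f, hf⟩ := exists_mvPolynomial_eq_separable n N φ
  have ht : ∀ i : ℕ, ∃ t, i < n → FoldSlab (Jet.separable n N (fun i x => (φ i).eval x)
      (fun i x => (φ i).derivative.eval x) (fun i x => (φ i).hasDerivAt x)
      (fun i => (φ i).derivative.continuous)) (2 * min (k i) (k (i + 1))) (p i) (e i)
      i (i + 1) t := by
    intro i
    by_cases hi : i < n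
    · obtain ⟨t, ht⟩ := hJ i hi (Jet.separable n N (fun i x => (φ i).eval x)
        (fun i x => (φ i).derivative.eval x) (fun i x => (φ i).hasDerivAt x)
        (fun i => (φ i).derivative.continuous)) fun x hx => by
          refine (hφ x ⟨(Nat.cast_nonneg i).trans hx.1, hx.2.trans ?_⟩).mono
            (hδ i (Finset.mem_range.2 hi)).le
          exact_mod_cast hi
      exact ⟨t, fun _ => ht⟩
    · exact ⟨0, fun h => absurd h hi⟩
  choose t ht using ht
  exact ⟨f, _, t, fun x y => ⟨(hf x y).1.symm, (hf x y).2.1.symm, (hf x y).2.2.symm⟩, ht⟩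

/-! ### The domain bounded by a polynomial, and its collapse -/

theorem neg_of_nonpos_of_zeros_increasing {g g' : ℝ → ℝ} (hg : ∀ y, HasDerivAt g (g' y) y)
    {a b : ℝ} (h : ∀ y ∈ Icc a b, g y = 0 → 0 < g' y) {y y' : ℝ} (hy : y ∈ Icc a b)
    (hy' : y' ∈ Icc a b) (hle : g y ≤ 0) (hlt : y' < y) : g y' < 0 := by
  have h1 := neg_of_nonpos_of_zeros_decreasing (g := fun s => g (-s)) (g' := fun s => -g' (-s))
    (fun s => by simpa [Function.comp_def] using (hg (-s)).comp s (hasDerivAt_neg s)) (a := -b) (b := -a)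
    (fun s hs h0 => neg_neg_of_pos (h (-s) ⟨by linarith [hs.2], by linarith [hs.1]⟩ h0))
    (y := -y) (y' := -y') ⟨by linarith [hy.2], by linarith [hy.1]⟩
    ⟨by linarith [hy'.2], by linarith [hy'.1]⟩ (by simpa using hle) (by linarith)
  simpa using h1

/-- The nonpositivity set of `g` in `[0, 1]` is a union of intervals: the `i`-th one is around
`z (2 * i + 1)`, between the separators `z (2 * i)` and `z (2 * i + 2)`. It is empty if `i` is
virtual, and merges with the next one if `i` is glued. -/
structure Windows (g : ℝ → ℝ) (z : ℕ → ℝ) (N : ℕ) (glued virtual : ℕ → Prop) : Prop where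
  nonneg : 0 ≤ z 0
  last : z (2 * N + 1) = 1
  lt : ∀ j ≤ 2 * N, z j < z (j + 1)
  nonpos : ∀ i < N, ¬ virtual i → g (z (2 * i + 1)) ≤ 0
  virtual_pos : ∀ i < N, virtual i → ∀ y ∈ Icc (z (2 * i)) (z (2 * i + 2)), 0 < g y
  down : ∀ i < N, ∀ y ∈ Icc (z (2 * i)) (z (2 * i + 1)), g y ≤ 0 →
    ∀ s ∈ Icc y (z (2 * i + 1)), g s ≤ 0
  up : ∀ i < N, ∀ y ∈ Icc (z (2 * i + 1)) (z (2 * i + 2)), g y ≤ 0 →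
    ∀ s ∈ Icc (z (2 * i + 1)) y, g s ≤ 0
  sep : ∀ i, i + 1 < N → ¬ glued i → 0 < g (z (2 * i + 2))
  glued_nonpos : ∀ i, i + 1 < N → glued i → ∀ y ∈ Icc (z (2 * i + 1)) (z (2 * i + 3)), g y ≤ 0
  pos_left : ∀ y ∈ Icc 0 (z 0), 0 < g y
  pos_right : ∀ y ∈ Icc (z (2 * N)) (z (2 * N + 1)), 0 < g y

theorem neg_one_pow_two_mul (i : ℕ) : (-1 : ℝ) ^ (2 * i) = 1 := by rw [pow_mul]; norm_num

theorem neg_one_pow_two_mul_add_one (i : ℕ) : (-1 : ℝ) ^ (2 * i + 1) = -1 := by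
  rw [pow_succ, neg_one_pow_two_mul]; norm_num

theorem nonpos_of_decreasing {g g' : ℝ → ℝ} (hg : ∀ y, HasDerivAt g (g' y) y) {z : ℕ → ℝ} {i : ℕ}
    (h : ∀ y ∈ Icc (z (2 * i)) (z (2 * i + 1)), g y = 0 → (-1) ^ (2 * i) * g' y < 0) :
    ∀ y ∈ Icc (z (2 * i)) (z (2 * i + 1)), g y ≤ 0 → ∀ s ∈ Icc y (z (2 * i + 1)), g s ≤ 0 := by
  intro y hy hle s hs
  rcases hs.1.eq_or_lt with rfl | hlt
  · exact hle
  refine (neg_of_nonpos_of_zeros_decreasing hg (fun y hy h0 => ?_) hy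
    ⟨hy.1.trans hs.1, hs.2⟩ hle hlt).le
  have := h y hy h0
  rwa [neg_one_pow_two_mul, one_mul] at this

theorem nonpos_of_increasing {g g' : ℝ → ℝ} (hg : ∀ y, HasDerivAt g (g' y) y) {z : ℕ → ℝ} {i : ℕ}
    (h : ∀ y ∈ Icc (z (2 * i + 1)) (z (2 * i + 1 + 1)), g y = 0 → (-1) ^ (2 * i + 1) * g' y < 0) :
    ∀ y ∈ Icc (z (2 * i + 1)) (z (2 * i + 2)), g y ≤ 0 →
      ∀ s ∈ Icc (z (2 * i + 1)) y, g s ≤ 0 := by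
  intro y hy hle s hs
  rcases hs.2.eq_or_lt with rfl | hlt
  · exact hle
  refine (neg_of_nonpos_of_zeros_increasing hg (fun y hy h0 => ?_) hy
    ⟨hs.1, hs.2.trans hy.2⟩ hle hlt).le
  have := h y hy h0
  rw [neg_one_pow_two_mul_add_one] at this
  linarith

theorem Alternates.windows {g g' : ℝ → ℝ} (hg : ∀ y, HasDerivAt g (g' y) y) {z : ℕ → ℝ} {N : ℕ}
    (h : Alternates g g' z (2 * N)) {glued virtual : ℕ → Prop} (hglued : ∀ i, ¬ glued i)
    (hvirtual : ∀ i, ¬ virtual i) : Windows g z N glued virtual where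
  nonneg := h.nonneg
  last := h.last
  lt := h.lt
  nonpos i hi _ := by
    have := h.sign (2 * i + 1) (by omega)
    rw [neg_one_pow_two_mul_add_one] at this
    linarith
  virtual_pos i hi hv := absurd hv (hvirtual i)
  down i hi := nonpos_of_decreasing hg (h.trans (2 * i) (by omega))
  up i hi := nonpos_of_increasing hg (h.trans (2 * i + 1) (by omega))
  sep i hi _ := by
    have := h.sign (2 * (i + 1)) (by omega)
    rw [neg_one_pow_two_mul, one_mul] at this
    exact this
  glued_nonpos i hi hv := absurd hv (hglued i)
  pos_left := h.pos_left
  pos_right y hy := by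
    have := h.pos y hy
    rwa [neg_one_pow_two_mul, one_mul] at this

/-- The windows on both sides of a fold, and at the fold itself. -/
theorem FoldAt.windows {J : Jet} {z : ℕ → ℝ} {k p : ℕ} {e t : ℝ} {I : Set ℝ}
    (h : FoldAt J z (2 * k) p e t I) (he : e = 1 ∨ e = -1) {x : ℝ} (hx : x ∈ I) :
    Windows (J.f x) z (k + 1) (fun i => p = 2 * i + 1 ∧ e * (x - t) ≤ 0)
      (fun i => p = 2 * i ∧ e * (x - t) < 0) := by
  have hg := J.hasDerivAt_y x
  rcases lt_or_ge 0 (e * (x - t)) with hpos | hle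
  · exact Alternates.windows (N := k + 1) hg (h.after x hx hpos) (fun i hi => by linarith [hi.2])
      (fun i hi => by linarith [hi.2])
  have hp := h.le
  -- the sign of `J.f x` on the strip
  have hstrip : ∀ y ∈ Icc (z p) (z (p + 2)), y ≠ z (p + 1) → 0 < (-1) ^ p * J.f x y := by
    intro y hy hne
    rcases hle.lt_or_eq with hlt | heq
    · exact h.before x hx hlt y hy
    · have hxt : x = t := by rcases he with rfl | rfl <;> linarith
      subst hxt
      exact h.fold_pos y hy hne
  have hmid : (e * (x - t) < 0 ∧ 0 < (-1) ^ p * J.f x (z (p + 1))) ∨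
      (¬ e * (x - t) < 0 ∧ J.f x (z (p + 1)) = 0) := by
    rcases hle.lt_or_eq with hlt | heq
    · exact Or.inl ⟨hlt, h.before x hx hlt _ ⟨(h.lt p (by omega)).le, (h.lt (p + 1) (by omega)).le⟩⟩
    · have hxt : x = t := by rcases he with rfl | rfl <;> linarith
      subst hxt
      exact Or.inr ⟨heq.not_lt, h.fold⟩
  have hsign : ∀ i ≤ k, 2 * i + 1 ≠ p + 1 → J.f x (z (2 * i + 1)) ≤ 0 := by
    intro i hi hne
    have := h.sign x hx (2 * i + 1) (by omega) hne
    rw [neg_one_pow_two_mul_add_one] at this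
    linarith
  have hsep : ∀ i < k, 2 * i + 2 ≠ p + 1 → 0 < J.f x (z (2 * i + 2)) := by
    intro i hi hne
    have := h.sign x hx (2 * (i + 1)) (by omega) hne
    rw [neg_one_pow_two_mul, one_mul] at this
    exact this
  have hdown : ∀ i ≤ k, 2 * i ≠ p → 2 * i ≠ p + 1 → ∀ y ∈ Icc (z (2 * i)) (z (2 * i + 1)),
      J.f x y ≤ 0 → ∀ s ∈ Icc y (z (2 * i + 1)), J.f x s ≤ 0 := fun i hi h1 h2 =>
    nonpos_of_decreasing hg (h.trans x hx (2 * i) (by omega) h1 h2)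
  have hup : ∀ i ≤ k, 2 * i + 1 ≠ p → 2 * i + 1 ≠ p + 1 →
      ∀ y ∈ Icc (z (2 * i + 1)) (z (2 * i + 2)), J.f x y ≤ 0 →
      ∀ s ∈ Icc (z (2 * i + 1)) y, J.f x s ≤ 0 := fun i hi h1 h2 =>
    nonpos_of_increasing hg (h.trans x hx (2 * i + 1) (by omega) h1 h2)
  have hright : ∀ y ∈ Icc (z (2 * (k + 1))) (z (2 * (k + 1) + 1)), 0 < J.f x y := by
    intro y hy
    have := h.pos x hx y hy
    rwa [neg_one_pow_two_mul, one_mul] at this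
  rcases Nat.even_or_odd' p with ⟨i₀, rfl | rfl⟩
  · simp only [neg_one_pow_two_mul, one_mul] at hstrip hmid
    have hlt1 := h.lt (2 * i₀) (by omega)
    have hlt2 := h.lt (2 * i₀ + 1) (by omega)
    refine ⟨h.nonneg, h.last, h.lt, ?_, ?_, ?_, ?_, ?_, ?_, h.pos_left x hx, hright⟩
    · intro i hi hv
      by_cases hii : i = i₀
      · subst hii
        rcases hmid with h1 | h1
        · exact absurd ⟨rfl, h1.1⟩ hv
        · exact h1.2.le
      · exact hsign i (by omega) (by omega)
    · rintro i hi ⟨h1, h2⟩ y hy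
      obtain rfl : i₀ = i := by omega
      by_cases hy1 : y = z (2 * i₀ + 1)
      · rw [hy1]
        rcases hmid with h3 | h3
        · exact h3.2
        · exact absurd h2 h3.1
      · exact hstrip y hy hy1
    · intro i hi y hy hy0 s hs
      by_cases hii : i = i₀
      · subst hii
        have hyz : y = z (2 * i + 1) := by
          by_contra hne
          exact absurd (hstrip y ⟨hy.1, hy.2.trans hlt2.le⟩ hne) (not_lt.2 hy0)
        rwa [le_antisymm hs.2 (hyz ▸ hs.1), ← hyz]
      · exact hdown i (by omega) (by omega) (by omega) y hy hy0 s hs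
    · intro i hi y hy hy0 s hs
      by_cases hii : i = i₀
      · subst hii
        have hyz : y = z (2 * i + 1) := by
          by_contra hne
          exact absurd (hstrip y ⟨hlt1.le.trans hy.1, hy.2⟩ hne) (not_lt.2 hy0)
        rwa [le_antisymm (hyz ▸ hs.2) hs.1, ← hyz]
      · exact hup i (by omega) (by omega) (by omega) y hy hy0 s hs
    · intro i hi _
      exact hsep i (by omega) (by omega)
    · rintro i hi ⟨h1, -⟩
      omega
  · simp only [neg_one_pow_two_mul_add_one] at hstrip hmid
    have hnonpos : ∀ y ∈ Icc (z (2 * i₀ + 1)) (z (2 * i₀ + 3)), J.f x y ≤ 0 := by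
      intro y hy
      by_cases hy1 : y = z (2 * i₀ + 1 + 1)
      · rw [hy1]
        rcases hmid with h1 | h1
        · linarith [h1.2]
        · exact h1.2.le
      · linarith [hstrip y hy hy1]
    have hlt1 := h.lt (2 * i₀ + 1) (by omega)
    have hlt2 := h.lt (2 * i₀ + 2) (by omega)
    refine ⟨h.nonneg, h.last, h.lt, ?_, ?_, ?_, ?_, ?_, ?_, h.pos_left x hx, hright⟩
    · intro i hi _
      exact hsign i (by omega) (by omega)
    · rintro i hi ⟨h1, -⟩
      omega
    · intro i hi y hy hy0 s hs
      by_cases hii : i = i₀ + 1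
      · subst hii
        exact hnonpos s ⟨(hlt1.le.trans hy.1).trans hs.1, hs.2⟩
      · exact hdown i (by omega) (by omega) (by omega) y hy hy0 s hs
    · intro i hi y hy hy0 s hs
      by_cases hii : i = i₀
      · subst hii
        exact hnonpos s ⟨hs.1, hs.2.trans (hy.2.trans hlt2.le)⟩
      · exact hup i (by omega) (by omega) (by omega) y hy hy0 s hs
    · intro i hi hgl
      refine hsep i (by omega) fun hcon => hgl ⟨by omega, hle⟩
    · rintro i hi ⟨h1, -⟩ y hy
      obtain rfl : i₀ = i := by omega
      exact hnonpos y hy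

/-- The flattening of a closed set along a fiber that consists of windows. -/
theorem Windows.strands {D : Set (ℝ × ℝ)} (hD : IsClosed D) (hne : D.Nonempty) {x : ℝ}
    {g : ℝ → ℝ} {z : ℕ → ℝ} {N : ℕ} {glued virtual : ℕ → Prop} (h : Windows g z N glued virtual)
    (hmem : ∀ y, (x, y) ∈ D ↔ y ∈ Icc (0 : ℝ) 1 ∧ g y ≤ 0) :
    (∀ i, i + 1 < N → gapHeight D x (z (2 * i + 1)) ≤ gapHeight D x (z (2 * (i + 1) + 1)) ∧
      (gapHeight D x (z (2 * i + 1)) = gapHeight D x (z (2 * (i + 1) + 1)) ↔ glued i)) ∧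
    ∀ w, (x, w) ∈ flatten D '' D ↔ ∃ i < N, ¬ virtual i ∧ gapHeight D x (z (2 * i + 1)) = w := by
  have hz : ∀ j ≤ 2 * N + 1, z j ∈ Icc (0 : ℝ) 1 := fun j hj =>
    separators_mem h.nonneg h.last h.lt hj
  constructor
  · intro i hi
    have h1 := h.lt (2 * i + 1) (by omega)
    have h2 := h.lt (2 * i + 2) (by omega)
    refine ⟨gapHeight_mono x (h1.trans h2).le, ?_⟩
    rw [show 2 * (i + 1) + 1 = 2 * i + 3 by ring, gapHeight_eq_iff hD hne (h1.trans h2)]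
    constructor
    · intro hall
      by_contra hgl
      have h3 := h.sep i hi hgl
      have h4 := ((hmem _).1 (hall (z (2 * i + 2)) ⟨h1.le, h2.le⟩)).2
      linarith
    · intro hgl s hs
      exact (hmem s).2 ⟨⟨(hz (2 * i + 1) (by omega)).1.trans hs.1,
        hs.2.trans (hz (2 * i + 3) (by omega)).2⟩, h.glued_nonpos i hi hgl s hs⟩
  · intro w
    constructor
    · rintro ⟨⟨x', y⟩, hy, heq⟩
      simp only [flatten, Prod.mk.injEq] at heq
      obtain ⟨rfl, rfl⟩ := heq
      obtain ⟨hy1, hy0⟩ := (hmem y).1 hy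
      -- the window that contains `y`
      have hex : ∃ i < N, y ∈ Icc (z (2 * i)) (z (2 * i + 2)) := by
        by_contra! hcon
        have hall : ∀ i ≤ N, z (2 * i) ≤ y := by
          intro i
          induction i with
          | zero =>
            intro _
            by_contra hlt
            exact absurd (h.pos_left y ⟨hy1.1, (not_le.1 hlt).le⟩) (not_lt.2 hy0)
          | succ i ih =>
            intro hi
            by_contra hlt
            exact hcon i (by omega) ⟨ih (by omega), (not_le.1 hlt).le⟩
        have := h.pos_right y ⟨hall N le_rfl, by rw [h.last]; exact hy1.2⟩
        linarith
      obtain ⟨i, hi, hyi⟩ := hex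
      have hv : ¬ virtual i := fun hv => absurd (h.virtual_pos i hi hv y hyi) (not_lt.2 hy0)
      have hzi := hz (2 * i + 1) (by omega)
      refine ⟨i, hi, hv, ((gapHeight_eq_iff_uIcc hD hne).2 (Or.inr fun s hs => ?_)).symm⟩
      rcases le_total y (z (2 * i + 1)) with hle | hle
      · rw [uIcc_of_le hle] at hs
        exact (hmem s).2 ⟨⟨hy1.1.trans hs.1, hs.2.trans hzi.2⟩,
          h.down i hi y ⟨hyi.1, hle⟩ hy0 s hs⟩
      · rw [uIcc_of_ge hle] at hs
        exact (hmem s).2 ⟨⟨hzi.1.trans hs.1, hs.2.trans hy1.2⟩,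
          h.up i hi y ⟨hle, hyi.2⟩ hy0 s hs⟩
    · rintro ⟨i, hi, hv, rfl⟩
      exact ⟨(x, z (2 * i + 1)), (hmem _).2 ⟨hz _ (by omega), h.nonpos i hi hv⟩, rfl⟩

theorem localStrands_of_windows {D : Set (ℝ × ℝ)} (hD : IsClosed D) (hne : D.Nonempty) {x₀ : ℝ}
    {J : Jet} {z : ℕ → ℝ} {N : ℕ} {glued virtual : ℕ → ℝ → Prop}
    (h : ∀ᶠ x in 𝓝 x₀, Windows (J.f x) z N (fun i => glued i x) (fun i => virtual i x))
    (hmem : ∀ᶠ x in 𝓝 x₀, ∀ y, (x, y) ∈ D ↔ y ∈ Icc (0 : ℝ) 1 ∧ J.f x y ≤ 0) :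
    LocalStrands (flatten D '' D) x₀ N glued virtual
      (fun i x => gapHeight D x (z (2 * i + 1))) := by
  filter_upwards [h, hmem] with x hx hxmem
  obtain ⟨h1, h2⟩ := hx.strands hD hne hxmem
  refine ⟨fun i _ => ?_, h1, h2⟩
  exact (continuous_gapHeight.comp (f := fun x : ℝ => (x, z (2 * i + 1)))
    (by fun_prop)).continuousAt

/-- The points of the box `[0, L] × [0, 1]` at which `J.f` is nonpositive. -/
def boxSublevel (J : Jet) (L : ℝ) : Set (ℝ × ℝ) :=
  {q | q.1 ∈ Icc 0 L ∧ q.2 ∈ Icc (0 : ℝ) 1 ∧ J.f q.1 q.2 ≤ 0}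

theorem isCompact_boxSublevel (J : Jet) (L : ℝ) : IsCompact (boxSublevel J L) := by
  have h : boxSublevel J L = (Icc 0 L ×ˢ Icc 0 1) ∩ {q | J.f q.1 q.2 ≤ 0} := by
    ext q
    simp only [boxSublevel, mem_ofPred_eq, mem_inter_iff, mem_prod, and_assoc]
  rw [h]
  exact (isCompact_Icc.prod isCompact_Icc).inter_right
    (isClosed_le J.continuous_f continuous_const)

/-- The zeros of `J.f` over `[0, n]` undergo the births and deaths that are prescribed by a valid
pattern, at the parameters `t i ∈ (i, i + 1)`. -/
structure FoldFamily (J : Jet) (n : ℕ) (k p : ℕ → ℕ) (e t : ℕ → ℝ) : Prop where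
  pos : 0 < n
  valid : ValidPattern n k p e
  slab : ∀ i < n, FoldSlab J (2 * min (k i) (k (i + 1))) (p i) (e i) i (i + 1) (t i)

theorem countBelow_eq {n i : ℕ} {v : ℕ → ℝ} {x : ℝ} (hi : i ≤ n)
    (h : ∀ j < n, v j < x ↔ j < i) : countBelow n v x = i := by
  have : (Finset.range n).filter (fun j => v j < x) = Finset.range i := by
    ext j
    rw [Finset.mem_filter, Finset.mem_range, Finset.mem_range]
    exact ⟨fun hj => (h j hj.1).1 hj.2, fun hj => ⟨by omega, (h j (by omega)).2 hj⟩⟩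
  rw [countBelow, this, Finset.card_range]

/-- The slabs `[i, i + 1]` cover `[0, n]`. -/
theorem exists_nat_slab {n : ℕ} (hn : 0 < n) {x : ℝ} (hx : x ∈ Icc (0 : ℝ) n) :
    ∃ i < n, x ∈ Icc (i : ℝ) (i + 1) := by
  rcases hx.2.lt_or_eq with hlt | rfl
  · exact ⟨⌊x⌋₊, (Nat.floor_lt hx.1).2 hlt, Nat.floor_le hx.1, (Nat.lt_floor_add_one x).le⟩
  · obtain ⟨m, rfl⟩ := Nat.exists_eq_succ_of_ne_zero hn.ne'
    exact ⟨m, Nat.lt_succ_self m, by push_cast; linarith, by push_cast; linarith⟩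

theorem Alternates.pos_ends {g g' : ℝ → ℝ} {z : ℕ → ℝ} {k : ℕ}
    (h : Alternates g g' z (2 * k)) : 0 < g 0 ∧ 0 < g 1 := by
  refine ⟨h.pos_left 0 ⟨le_rfl, h.nonneg⟩, ?_⟩
  have := h.pos 1 ⟨?_, h.last.ge⟩
  · rwa [neg_one_pow_two_mul, one_mul] at this
  · rw [← h.last]; exact (h.lt _ le_rfl).le

theorem Alternates.pos_of_zero {g g' : ℝ → ℝ} {z : ℕ → ℝ} (h : Alternates g g' z 0) :
    ∀ y ∈ Icc (0 : ℝ) 1, 0 < g y := by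
  intro y hy
  rcases le_total y (z 0) with hyz | hyz
  · exact h.pos_left y ⟨hy.1, hyz⟩
  · simpa using h.pos y ⟨hyz, by rw [h.last]; exact hy.2⟩

namespace FoldFamily

variable {J : Jet} {n : ℕ} {k p : ℕ → ℕ} {e t : ℕ → ℝ}

theorem lt_succ (h : FoldFamily J n k p e t) (i : ℕ) (hi : i + 1 < n) : t i < t (i + 1) := by
  have h1 := (h.slab i (by omega)).mem.2
  have h2 := (h.slab (i + 1) hi).mem.1
  push_cast at h2
  exact h1.trans h2

theorem lt_of_lt (h : FoldFamily J n k p e t) {i j : ℕ} (hij : i < j) (hj : j < n) :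
    t i < (j : ℝ) := by
  have h1 := (h.slab i (by omega)).mem.2
  have h2 : (i : ℝ) + 1 ≤ j := by exact_mod_cast hij
  linarith

theorem sign_eq (h : FoldFamily J n k p e t) {i : ℕ} (hi : i < n) : e i = 1 ∨ e i = -1 := by
  rcases h.valid.step i hi with h1 | h1
  · exact Or.inl h1.1
  · exact Or.inr h1.1

/-- Away from the folds, all the zeros are simple, and their number is given by the pattern. -/
theorem exists_alternates (h : FoldFamily J n k p e t) {x : ℝ} (hx : x ∈ Icc (0 : ℝ) n)
    (hne : ∀ i < n, t i ≠ x) :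
    ∃ z, Alternates (J.f x) (J.fy x) z (2 * k (countBelow n t x)) := by
  obtain ⟨i, hi, hxi⟩ := exists_nat_slab h.pos hx
  have hs := h.slab i hi
  have hlow : ∀ j < i, t j < x := fun j hj => (h.lt_of_lt hj hi).trans_le hxi.1
  have hhigh : ∀ j, i < j → j < n → x < t j := fun j hij hj => by
    have h1 : (i : ℝ) + 1 ≤ j := by exact_mod_cast hij
    have h2 := (h.slab j hj).mem.1
    linarith [hxi.2]
  rcases lt_or_gt_of_ne (hne i hi) with hlt | hlt
  · have hc : countBelow n t x = i + 1 := countBelow_eq hi fun j hj => by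
      rcases lt_trichotomy j i with c | rfl | c
      · exact iff_of_true (hlow j c) (by omega)
      · exact iff_of_true hlt (by omega)
      · exact iff_of_false (hhigh j c hj).not_gt (by omega)
    rw [hc]
    rcases h.valid.step i hi with ⟨he, hk⟩ | ⟨he, hk⟩
    · have := hs.after x hxi (by rw [he]; linarith)
      rw [hk, min_eq_left (Nat.le_succ _)] at this
      rwa [hk, mul_add]
    · have := hs.before x hxi (by rw [he]; linarith)
      rwa [hk, min_eq_right (Nat.le_succ _)] at this
  · have hc : countBelow n t x = i := countBelow_eq hi.le fun j hj => by
      rcases lt_trichotomy j i with c | rfl | c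
      · exact iff_of_true (hlow j c) c
      · exact iff_of_false hlt.not_gt (lt_irrefl _)
      · exact iff_of_false (hhigh j c hj).not_gt (by omega)
    rw [hc]
    rcases h.valid.step i hi with ⟨he, hk⟩ | ⟨he, hk⟩
    · have := hs.before x hxi (by rw [he]; linarith)
      rwa [hk, min_eq_left (Nat.le_succ _)] at this
    · have := hs.after x hxi (by rw [he]; linarith)
      rw [hk, min_eq_right (Nat.le_succ _)] at this
      rwa [hk, mul_add]

theorem alternates_end (h : FoldFamily J n k p e t) {x : ℝ} (hx : x = 0 ∨ x = n) :
    ∃ z, Alternates (J.f x) (J.fy x) z 0 := by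
  have hmem : x ∈ Icc (0 : ℝ) n := by
    rcases hx with rfl | rfl
    · exact ⟨le_rfl, Nat.cast_nonneg n⟩
    · exact ⟨Nat.cast_nonneg n, le_rfl⟩
  have hpos : ∀ i < n, 0 < t i := fun i hi =>
    (Nat.cast_nonneg i).trans_lt (h.slab i hi).mem.1
  have hlt : ∀ i < n, t i < n := fun i hi => by
    have h1 := (h.slab i hi).mem.2
    have h2 : (i : ℝ) + 1 ≤ n := by exact_mod_cast hi
    linarith
  have hne : ∀ i < n, t i ≠ x := by
    intro i hi heq
    rcases hx with rfl | rfl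
    · exact (hpos i hi).ne' heq
    · exact (hlt i hi).ne heq
  have hk : k (countBelow n t x) = 0 := by
    rcases hx with rfl | rfl
    · rw [countBelow_eq (Nat.zero_le n) fun j hj => iff_of_false (hpos j hj).not_gt (by omega),
        h.valid.start]
    · rw [countBelow_eq le_rfl fun j hj => iff_of_true (hlt j hj) hj, h.valid.finish]
  obtain ⟨z, hz⟩ := h.exists_alternates hmem hne
  rw [hk] at hz
  exact ⟨z, hz⟩

/-- The domain does not meet the vertical sides of the box. -/
theorem pos_end (h : FoldFamily J n k p e t) {x : ℝ} (hx : x = 0 ∨ x = n) :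
    ∀ y ∈ Icc (0 : ℝ) 1, 0 < J.f x y := by
  obtain ⟨z, hz⟩ := h.alternates_end hx
  exact hz.pos_of_zero

/-- The domain does not meet the horizontal sides of the box. -/
theorem pos_bottom_top (h : FoldFamily J n k p e t) {x : ℝ} (hx : x ∈ Icc (0 : ℝ) n) :
    0 < J.f x 0 ∧ 0 < J.f x 1 := by
  by_cases hne : ∀ i < n, t i ≠ x
  · obtain ⟨z, hz⟩ := h.exists_alternates hx hne
    exact hz.pos_ends
  push Not at hne
  obtain ⟨i, hi, rfl⟩ := hne
  obtain ⟨z, I, hI, hf⟩ := (h.slab i hi).foldAt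
  have hw := hf.windows (h.sign_eq hi) (mem_of_mem_nhds hI)
  refine ⟨hw.pos_left 0 ⟨le_rfl, hw.nonneg⟩, hw.pos_right 1 ⟨?_, hw.last.ge⟩⟩
  rw [← hw.last]
  exact (hw.lt _ le_rfl).le

theorem eventually_alternates {x : ℝ} {z : ℕ → ℝ} {m : ℕ} (h : Alternates (J.f x) (J.fy x) z m) :
    ∀ᶠ x' in 𝓝 x, Alternates (J.f x') (J.fy x') z m := by
  obtain ⟨ε, hε, hpos⟩ := (h.eventually.and self_mem_nhdsWithin).exists
  filter_upwards [J.eventually_closeAt x hpos] with x' hx' using hε J x' hx'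

theorem eventually_mem_boxSublevel_iff (h : FoldFamily J n k p e t) {x : ℝ}
    (hx : x ∈ Icc (0 : ℝ) n) : ∀ᶠ x' in 𝓝 x, ∀ y,
      (x', y) ∈ boxSublevel J n ↔ y ∈ Icc (0 : ℝ) 1 ∧ J.f x' y ≤ 0 := by
  by_cases hend : x = 0 ∨ x = n
  · obtain ⟨z, hz⟩ := h.alternates_end hend
    filter_upwards [eventually_alternates hz] with x' hx' y
    refine ⟨fun hy => hy.2, fun hy => ?_⟩
    exact absurd (hx'.pos_of_zero y hy.1) (not_lt.2 hy.2)
  · push Not at hend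
    filter_upwards [Ioo_mem_nhds (lt_of_le_of_ne hx.1 hend.1.symm)
      (lt_of_le_of_ne hx.2 hend.2)] with x' hx' y
    exact ⟨fun hy => hy.2, fun hy => ⟨⟨hx'.1.le, hx'.2.le⟩, hy⟩⟩

/-- The ordinate of the fold of index `i`, whose abscissa is `t i` (and `0` if there is no such
fold). -/
noncomputable def foldHeight (h : FoldFamily J n k p e t) (i : ℕ) : ℝ :=
  if hi : i < n then (h.slab i hi).foldAt.choose (p i + 1) else 0

theorem exists_foldAt (h : FoldFamily J n k p e t) {i : ℕ} (hi : i < n) :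
    ∃ z, ∃ I ∈ 𝓝 (t i), FoldAt J z (2 * min (k i) (k (i + 1))) (p i) (e i) (t i) I ∧
      z (p i + 1) = h.foldHeight i := by
  obtain ⟨I, hI, hf⟩ := (h.slab i hi).foldAt.choose_spec
  exact ⟨_, I, hI, hf, by rw [foldHeight, dif_pos hi]⟩

theorem t_mem (h : FoldFamily J n k p e t) {i : ℕ} (hi : i < n) : t i ∈ Ioo (0 : ℝ) n := by
  have h1 := (h.slab i hi).mem
  have h2 : (i : ℝ) + 1 ≤ n := by exact_mod_cast hi
  exact ⟨(Nat.cast_nonneg i).trans_lt h1.1, by linarith [h1.2]⟩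

theorem foldHeight_mem (h : FoldFamily J n k p e t) {i : ℕ} (hi : i < n) :
    h.foldHeight i ∈ Icc (0 : ℝ) 1 ∧ J.f (t i) (h.foldHeight i) = 0 := by
  obtain ⟨z, I, hI, hf, hz⟩ := h.exists_foldAt hi
  rw [← hz]
  refine ⟨?_, hf.fold⟩
  have hle := hf.le
  exact separators_mem (m := 2 * min (k i) (k (i + 1)) + 2) hf.nonneg hf.last hf.lt (by omega)

theorem fold_mem (h : FoldFamily J n k p e t) {i : ℕ} (hi : i < n) :
    (t i, h.foldHeight i) ∈ boxSublevel J n :=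
  ⟨Ioo_subset_Icc_self (h.t_mem hi), (h.foldHeight_mem hi).1, (h.foldHeight_mem hi).2.le⟩

theorem nonempty (h : FoldFamily J n k p e t) : (boxSublevel J n).Nonempty :=
  ⟨_, h.fold_mem h.pos⟩

/-- The collapse of the domain has the prescribed pattern. -/
theorem hasPattern (h : FoldFamily J n k p e t) :
    HasPattern (flatten (boxSublevel J n) '' boxSublevel J n) n k p e t
      (fun i => gapHeight (boxSublevel J n) (t i) (h.foldHeight i)) where
  lt_succ := h.lt_succ
  event i hi := by
    obtain ⟨z, I, hI, hf, hz⟩ := h.exists_foldAt hi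
    have hmem := h.eventually_mem_boxSublevel_iff (Ioo_subset_Icc_self (h.t_mem hi))
    refine ⟨_, localStrands_of_windows (isCompact_boxSublevel J n).isClosed h.nonempty
      (J := J) (z := z) ?_ hmem, ?_⟩
    · filter_upwards [hI] with x hx using hf.windows (h.sign_eq hi) hx
    · rw [← hz]
      rcases Nat.even_or_odd' (p i) with ⟨j, hj | hj⟩
      · simp only [hj]
        rw [Nat.mul_div_cancel_left j two_pos]
      · -- at the fold, the fiber contains the whole interval between two glued windows
        have hdiv : 2 * (p i / 2) + 1 = p i := by omega
        simp only [hdiv]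
        have hle := hf.le
        have hlt := hf.lt (p i) (by omega)
        have hlt' := hf.lt (p i + 1) (by omega)
        have hw := hf.windows (h.sign_eq hi) (mem_of_mem_nhds hI)
        have hbox : ∀ j ≤ 2 * (min (k i) (k (i + 1)) + 1) + 1, z j ∈ Icc (0 : ℝ) 1 :=
          fun j hj => separators_mem hw.nonneg hw.last hw.lt hj
        refine (gapHeight_eq_iff (isCompact_boxSublevel J n).isClosed h.nonempty hlt).2
          fun s hs => ?_
        refine (hmem.self_of_nhds s).2 ⟨⟨(hbox _ (by omega)).1.trans hs.1,
          hs.2.trans (hbox _ (by omega)).2⟩, ?_⟩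
        refine hw.glued_nonpos j (by omega) ⟨hj, by simp⟩ s ⟨by rw [← hj]; exact hs.1, ?_⟩
        rw [show 2 * j + 3 = p i + 2 by omega]
        exact hs.2.trans hlt'.le
  regular x hne := by
    by_cases hx : x ∈ Icc (0 : ℝ) n
    · obtain ⟨z, hz⟩ := h.exists_alternates hx hne
      refine ⟨_, localStrands_of_windows (isCompact_boxSublevel J n).isClosed h.nonempty
        (J := J) (z := z) ?_ (h.eventually_mem_boxSublevel_iff hx)⟩
      filter_upwards [eventually_alternates hz] with x' hx' using
        hx'.windows (J.hasDerivAt_y x') (fun _ => id) (fun _ => id)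
    · -- outside the box, there is nothing
      have hk : k (countBelow n t x) = 0 := by
        rw [mem_Icc, not_and_or, not_le, not_le] at hx
        rcases hx with hx | hx
        · rw [countBelow_eq (Nat.zero_le n) fun j hj => iff_of_false
            (hx.trans (h.t_mem hj).1).not_gt (by omega), h.valid.start]
        · rw [countBelow_eq le_rfl fun j hj => iff_of_true ((h.t_mem hj).2.trans hx) hj,
            h.valid.finish]
      rw [hk]
      refine ⟨fun _ _ => 0, ?_⟩
      filter_upwards [isClosed_Icc.isOpen_compl.mem_nhds hx] with x' hx'
      refine ⟨fun i hi => absurd hi (by omega), fun i hi => absurd hi (by omega), fun y => ?_⟩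
      refine iff_of_false ?_ (by rintro ⟨i, hi, -⟩; omega)
      rintro ⟨q, hq, heq⟩
      rw [flatten, Prod.mk.injEq] at heq
      exact hx' (heq.1 ▸ hq.1)

end FoldFamily

/-! ### Surfaces bounded by regular curves -/

/-- A subset of the plane is a surface with boundary if it is given by the nonnegativity of the
first coordinate of local charts of the plane. -/
theorem isSurfaceWithBoundary_of_local {D : Set (ℝ × ℝ)}
    (h : ∀ q ∈ D, ∃ Φ : OpenPartialHomeomorph (ℝ × ℝ) (ℝ × ℝ), q ∈ Φ.source ∧
      ∀ q' ∈ Φ.source, q' ∈ D ↔ 0 ≤ (Φ q').1) : IsSurfaceWithBoundary D := by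
  classical
  choose Φ hΦ hD using fun q : D => h q q.2
  let fwd : D → D → EuclideanHalfSpace 2 := fun q d =>
    ⟨!₂[max 0 (Φ q d).1, (Φ q d).2], by simp⟩
  let co : EuclideanHalfSpace 2 → ℝ × ℝ := fun w => (w.1 0, w.1 1)
  have hco : Continuous co := by fun_prop
  let back : D → EuclideanHalfSpace 2 → D := fun q w =>
    if hw : (Φ q).symm (co w) ∈ D then ⟨_, hw⟩ else q
  have hback : ∀ (q : D) (w : EuclideanHalfSpace 2), co w ∈ (Φ q).target →
      ((back q w : D) : ℝ × ℝ) = (Φ q).symm (co w) := by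
    intro q w hw
    have hmem : (Φ q).symm (co w) ∈ D := by
      rw [hD q _ ((Φ q).map_target hw), (Φ q).right_inv hw]
      exact w.2
    simp only [back, dif_pos hmem]
  have hfwd : ∀ (q d : D), (d : ℝ × ℝ) ∈ (Φ q).source → co (fwd q d) = Φ q d := by
    intro q d hd
    have := (hD q _ hd).1 d.2
    ext
    · simp [co, fwd, this]
    · simp [co, fwd]
  let chart : D → OpenPartialHomeomorph D (EuclideanHalfSpace 2) := fun q =>
    { toFun := fwd q
      invFun := back q
      source := Subtype.val ⁻¹' (Φ q).source
      target := co ⁻¹' (Φ q).target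
      map_source' := fun d hd => by
        rw [mem_preimage, hfwd q d hd]
        exact (Φ q).map_source hd
      map_target' := fun w hw => by
        rw [mem_preimage, hback q w hw]
        exact (Φ q).map_target hw
      left_inv' := fun d hd => by
        apply Subtype.ext
        rw [hback q _ (by rw [hfwd q d hd]; exact (Φ q).map_source hd), hfwd q d hd]
        exact (Φ q).left_inv hd
      right_inv' := fun w hw => by
        have h1 : co (fwd q (back q w)) = co w := by
          rw [hfwd q _ (by rw [hback q w hw]; exact (Φ q).map_target hw), hback q w hw]
          exact (Φ q).right_inv hw
        rw [Prod.ext_iff] at h1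
        apply Subtype.ext
        ext i
        fin_cases i
        · exact h1.1
        · exact h1.2
      open_source := (Φ q).open_source.preimage continuous_subtype_val
      open_target := (Φ q).open_target.preimage hco
      continuousOn_toFun := by
        have h1 : ContinuousOn (fun d : D => Φ q d) (Subtype.val ⁻¹' (Φ q).source) :=
          (Φ q).continuousOn.comp continuous_subtype_val.continuousOn fun d hd => hd
        have h2 : Continuous fun r : ℝ × ℝ => (⟨!₂[max 0 r.1, r.2], by simp⟩ :
            EuclideanHalfSpace 2) := by
          refine Continuous.subtype_mk ?_ _
          fun_prop
        exact h2.comp_continuousOn h1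
      continuousOn_invFun := by
        rw [IsInducing.subtypeVal.continuousOn_iff]
        refine ContinuousOn.congr ?_ fun w hw => hback q w hw
        exact (Φ q).symm.continuousOn.comp hco.continuousOn fun w hw => hw }
  exact ⟨{
    atlas := range chart
    chartAt := chart
    mem_chart_source := fun q => hΦ q
    chart_mem_atlas := fun q => mem_range_self q }⟩

theorem Jet.hasStrictFDerivAt (J : Jet) (q : ℝ × ℝ) :
    HasStrictFDerivAt (fun q : ℝ × ℝ => J.f q.1 q.2)
      ((ContinuousLinearMap.toSpanSingleton ℝ (J.fx q.1 q.2)).coprod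
        (ContinuousLinearMap.toSpanSingleton ℝ (J.fy q.1 q.2))) q := by
  have hT : Continuous fun c : ℝ => ContinuousLinearMap.toSpanSingleton ℝ c :=
    (ContinuousLinearMap.toSpanSingletonCLE (𝕜 := ℝ) (E := ℝ)).continuous
  exact hasStrictFDerivAt_uncurry_coprod (𝕜 := ℝ) (f := J.f)
    (f₁ := fun x y => ContinuousLinearMap.toSpanSingleton ℝ (J.fx x y))
    (f₂ := fun x y => ContinuousLinearMap.toSpanSingleton ℝ (J.fy x y))
    (Filter.Eventually.of_forall fun v => (J.hasDerivAt_x v.1 v.2).hasFDerivAt)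
    (Filter.Eventually.of_forall fun v => (J.hasDerivAt_y v.1 v.2).hasFDerivAt)
    (hT.comp J.continuous_fx).continuousAt (hT.comp J.continuous_fy).continuousAt

/-- At a regular point, `-J.f` is the first coordinate of a local chart. -/
theorem Jet.exists_chart (J : Jet) (q : ℝ × ℝ) (hq : J.fx q.1 q.2 ≠ 0 ∨ J.fy q.1 q.2 ≠ 0) :
    ∃ Φ : OpenPartialHomeomorph (ℝ × ℝ) (ℝ × ℝ), q ∈ Φ.source ∧
      ∀ q', (Φ q').1 = -J.f q'.1 q'.2 := by
  have hs := (J.hasStrictFDerivAt q).neg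
  set a := J.fx q.1 q.2
  set b := J.fy q.1 q.2
  by_cases hb : b = 0
  · have ha : a ≠ 0 := hq.resolve_right fun h => h hb
    let L : (ℝ × ℝ) ≃L[ℝ] (ℝ × ℝ) := ContinuousLinearEquiv.equivOfInverse
      ((-((ContinuousLinearMap.toSpanSingleton ℝ a).coprod
        (ContinuousLinearMap.toSpanSingleton ℝ b))).prod (ContinuousLinearMap.snd ℝ ℝ ℝ))
      (((-a⁻¹) • (ContinuousLinearMap.fst ℝ ℝ ℝ + b • ContinuousLinearMap.snd ℝ ℝ ℝ)).prod
        (ContinuousLinearMap.snd ℝ ℝ ℝ))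
      (fun v => Prod.ext (by simp; field_simp; ring) (by simp))
      (fun v => Prod.ext (by simp; field_simp; ring) (by simp))
    have hL : HasStrictFDerivAt (fun q : ℝ × ℝ => (-J.f q.1 q.2, q.2)) (L : ℝ × ℝ →L[ℝ] ℝ × ℝ) q :=
      hs.prodMk hasStrictFDerivAt_snd
    exact ⟨hL.toOpenPartialHomeomorph _, hL.mem_toOpenPartialHomeomorph_source, fun _ => rfl⟩
  · let L : (ℝ × ℝ) ≃L[ℝ] (ℝ × ℝ) := ContinuousLinearEquiv.equivOfInverse
      ((-((ContinuousLinearMap.toSpanSingleton ℝ a).coprod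
        (ContinuousLinearMap.toSpanSingleton ℝ b))).prod (ContinuousLinearMap.fst ℝ ℝ ℝ))
      ((ContinuousLinearMap.snd ℝ ℝ ℝ).prod
        ((-b⁻¹) • (ContinuousLinearMap.fst ℝ ℝ ℝ + a • ContinuousLinearMap.snd ℝ ℝ ℝ)))
      (fun v => Prod.ext (by simp) (by simp; field_simp; ring))
      (fun v => Prod.ext (by simp; field_simp; ring) (by simp))
    have hL : HasStrictFDerivAt (fun q : ℝ × ℝ => (-J.f q.1 q.2, q.1)) (L : ℝ × ℝ →L[ℝ] ℝ × ℝ) q :=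
      hs.prodMk hasStrictFDerivAt_fst
    exact ⟨hL.toOpenPartialHomeomorph _, hL.mem_toOpenPartialHomeomorph_source, fun _ => rfl⟩

theorem exists_mem_Icc_of_le {z : ℕ → ℝ} {y : ℝ} (h0 : z 0 ≤ y) :
    ∀ m : ℕ, y ≤ z m → y = z 0 ∨ ∃ j < m, y ∈ Icc (z j) (z (j + 1)) := by
  intro m
  induction m with
  | zero => intro h; exact Or.inl (le_antisymm h h0)
  | succ m ih =>
    intro h
    rcases le_total y (z m) with hle | hle
    · rcases ih hle with h1 | ⟨j, hj, hyj⟩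
      · exact Or.inl h1
      · exact Or.inr ⟨j, by omega, hyj⟩
    · exact Or.inr ⟨m, by omega, hle, h⟩

theorem Alternates.deriv_ne_zero {g g' : ℝ → ℝ} {z : ℕ → ℝ} {m : ℕ} (h : Alternates g g' z m)
    {y : ℝ} (hy : y ∈ Icc (0 : ℝ) 1) (h0 : g y = 0) : g' y ≠ 0 := by
  rcases le_or_gt y (z 0) with hle | hlt
  · exact absurd h0 (h.pos_left y ⟨hy.1, hle⟩).ne'
  rcases le_total y (z m) with hle | hle
  · rcases exists_mem_Icc_of_le hlt.le m hle with h1 | ⟨j, hj, hyj⟩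
    · exact absurd h1 hlt.ne'
    · intro hcon
      have := h.trans j hj y hyj h0
      rw [hcon, mul_zero] at this
      exact lt_irrefl _ this
  · have := h.pos y ⟨hle, by rw [h.last]; exact hy.2⟩
    rw [h0, mul_zero] at this
    exact absurd this (lt_irrefl _)

theorem FoldAt.deriv_ne_zero {J : Jet} {z : ℕ → ℝ} {m p : ℕ} {e t : ℝ} {I : Set ℝ}
    (h : FoldAt J z m p e t I) (ht : t ∈ I) {y : ℝ} (hy : y ∈ Icc (0 : ℝ) 1)
    (h0 : J.f t y = 0) (hne : y ≠ z (p + 1)) : J.fy t y ≠ 0 := by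
  rcases le_or_gt y (z 0) with hle | hlt
  · exact absurd h0 (h.pos_left t ht y ⟨hy.1, hle⟩).ne'
  rcases le_total y (z (m + 2)) with hle | hle
  · rcases exists_mem_Icc_of_le hlt.le (m + 2) hle with h1 | ⟨j, hj, hyj⟩
    · exact absurd h1 hlt.ne'
    · have hp := h.le
      have hstrip : y ∉ Icc (z p) (z (p + 2)) := fun hmem => by
        have := h.fold_pos y hmem hne
        rw [h0, mul_zero] at this
        exact lt_irrefl _ this
      have h1 : j ≠ p := by
        rintro rfl
        exact hstrip ⟨hyj.1, hyj.2.trans (h.lt (j + 1) (by omega)).le⟩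
      have h2 : j ≠ p + 1 := by
        rintro rfl
        exact hstrip ⟨(h.lt p (by omega)).le.trans hyj.1, hyj.2⟩
      intro hcon
      have := h.trans t ht j hj h1 h2 y hyj h0
      rw [hcon, mul_zero] at this
      exact lt_irrefl _ this
  · have := h.pos t ht y ⟨hle, by rw [h.last]; exact hy.2⟩
    rw [h0, mul_zero] at this
    exact absurd this (lt_irrefl _)

theorem FoldAt.mono {J : Jet} {z : ℕ → ℝ} {m p : ℕ} {e t : ℝ} {I I' : Set ℝ}
    (h : FoldAt J z m p e t I) (hI : I' ⊆ I) : FoldAt J z m p e t I' :=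
  ⟨h.le, h.nonneg, h.last, h.lt, fun x hx => h.sign x (hI hx), fun x hx => h.trans x (hI hx),
    fun x hx => h.pos_left x (hI hx), fun x hx => h.pos x (hI hx), fun x hx => h.before x (hI hx),
    fun x hx => h.after x (hI hx), h.fold, h.fold_pos, h.fold_x⟩

/-- Arbitrarily near a fold there are two zeros on the same vertical line. -/
theorem FoldAt.not_injOn {J : Jet} {z : ℕ → ℝ} {m p : ℕ} {e t : ℝ} {I : Set ℝ}
    (h : FoldAt J z m p e t I) (he : e = 1 ∨ e = -1) (hI : I ∈ 𝓝 t) {U : Set (ℝ × ℝ)}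
    (hU : U ∈ 𝓝 (t, z (p + 1))) :
    ∃ x y y', y ≠ y' ∧ (x, y) ∈ U ∧ (x, y') ∈ U ∧ x ∈ I ∧ y ∈ Icc (z p) (z (p + 2)) ∧
      y' ∈ Icc (z p) (z (p + 2)) ∧ J.f x y = 0 ∧ J.f x y' = 0 := by
  have hp := h.le
  have hl := h.lt p (by omega)
  have hr := h.lt (p + 1) (by omega)
  rw [nhds_prod_eq, Filter.mem_prod_iff] at hU
  obtain ⟨A, hA, B, hB, hAB⟩ := hU
  obtain ⟨r, hr0, hball⟩ := Metric.mem_nhds_iff.1 hB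
  obtain ⟨η, hη, hηr, hη1, hη2⟩ : ∃ η > 0, η < r ∧ z p < z (p + 1) - η ∧
      z (p + 1) + η < z (p + 2) := by
    refine ⟨min (r / 2) (min ((z (p + 1) - z p) / 2) ((z (p + 2) - z (p + 1)) / 2)),
      lt_min (by linarith) (lt_min (by linarith) (by linarith)),
      (min_le_left _ _).trans_lt (by linarith), ?_, ?_⟩
    · have := (min_le_right (r / 2) _).trans
        (min_le_left ((z (p + 1) - z p) / 2) ((z (p + 2) - z (p + 1)) / 2))
      linarith
    · have := (min_le_right (r / 2) _).trans
        (min_le_right ((z (p + 1) - z p) / 2) ((z (p + 2) - z (p + 1)) / 2))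
      linarith
  have hev : ∀ y ∈ Icc (z p) (z (p + 2)), y ≠ z (p + 1) →
      ∀ᶠ x in 𝓝 t, 0 < (-1) ^ p * J.f x y := by
    intro y hy hne
    have hc : ContinuousAt (fun x => (-1) ^ p * J.f x y) t :=
      (J.hasDerivAt_x t y).continuousAt.const_mul _
    exact hc.eventually (lt_mem_nhds (h.fold_pos y hy hne))
  have hall := ((hev (z (p + 1) - η) ⟨by linarith, by linarith⟩ (by linarith)).and
    (hev (z (p + 1) + η) ⟨by linarith, by linarith⟩ (by linarith))).and
    ((Filter.eventually_mem_set.2 hA).and (Filter.eventually_mem_set.2 hI))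
  -- a parameter on the side where the zeros exist
  obtain ⟨s, hs, hball'⟩ := Metric.eventually_nhds_iff.1 hall
  obtain ⟨⟨h1, h2⟩, hxA, hxI⟩ := hball' (y := t + e * (s / 2)) (by
    rw [Real.dist_eq, add_sub_cancel_left]
    rcases he with rfl | rfl
    · rw [one_mul, abs_of_pos (by linarith)]; linarith
    · rw [neg_one_mul, abs_neg, abs_of_pos (by linarith)]; linarith)
  have hxt : 0 < e * (t + e * (s / 2) - t) := by
    rcases he with rfl | rfl <;> linarith
  have h3 := (h.after _ hxI hxt).sign (p + 1) (by omega)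
  generalize t + e * (s / 2) = x at *
  have h4 : (-1) ^ p * J.f x (z (p + 1)) < 0 := by
    rw [pow_succ] at h3; linarith
  obtain ⟨y, hy, hy0⟩ := exists_zero_of_sign (J.continuous_f_right x) (s := (-1) ^ p)
    (by linarith : z (p + 1) - η < z (p + 1)) h1 h4
  obtain ⟨y', hy', hy0'⟩ := exists_zero_of_sign (J.continuous_f_right x) (s := -(-1) ^ p)
    (by linarith : z (p + 1) < z (p + 1) + η) (by linarith) (by linarith)
  have hB' : ∀ y, |y - z (p + 1)| < r → y ∈ B := fun y hy => hball (by
    rw [Metric.mem_ball, Real.dist_eq]; exact hy)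
  exact ⟨x, y, y', (hy.2.trans hy'.1).ne,
    hAB ⟨hxA, hB' y (abs_lt.2 ⟨by linarith [hy.1], by linarith [hy.2]⟩)⟩,
    hAB ⟨hxA, hB' y' (abs_lt.2 ⟨by linarith [hy'.1], by linarith [hy'.2]⟩)⟩, hxI,
    ⟨by linarith [hy.1], by linarith [hy.2]⟩, ⟨by linarith [hy'.1], by linarith [hy'.2]⟩, hy0, hy0'⟩

/-- Where the derivative in `y` does not vanish, the zeros lie on distinct vertical lines. -/
theorem Jet.exists_isCompact_injOn (J : Jet) (q : ℝ × ℝ) (hq : J.fy q.1 q.2 ≠ 0) :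
    ∃ U ∈ 𝓝 q, IsCompact U ∧ InjOn Prod.fst (U ∩ {q | J.f q.1 q.2 = 0}) := by
  have hev : ∀ᶠ q' in 𝓝 q, 0 < J.fy q.1 q.2 * J.fy q'.1 q'.2 :=
    (continuous_const.mul J.continuous_fy).continuousAt.eventually
      (lt_mem_nhds (mul_self_pos.2 hq))
  obtain ⟨r, hr, hball⟩ := Metric.nhds_basis_closedBall.eventually_iff.1 hev
  refine ⟨_, Metric.closedBall_mem_nhds q hr, isCompact_closedBall q r, ?_⟩
  rintro ⟨x, y⟩ ⟨hy, hy0⟩ ⟨x', y'⟩ ⟨hy', hy0'⟩ hxx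
  obtain rfl : x = x' := hxx
  have hy0 : J.f x y = 0 := hy0
  have hy0' : J.f x y' = 0 := hy0'
  rw [← closedBall_prod_same, mem_prod] at hy hy'
  have key : ∀ a b, J.f x a = 0 → J.f x b = 0 → a ∈ Metric.closedBall q.2 r →
      b ∈ Metric.closedBall q.2 r → ¬ a < b := by
    intro a b ha0 hb0 ha hb hlt
    rw [Real.closedBall_eq_Icc] at ha hb
    have := pos_of_derivAt_pos (g := fun s => J.fy q.1 q.2 * J.f x s)
      (g' := fun s => J.fy q.1 q.2 * J.fy x s) (fun s => (J.hasDerivAt_y x s).const_mul _) hlt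
      fun s hs => hball (x := (x, s)) (by
        rw [← closedBall_prod_same, mem_prod]
        refine ⟨hy.1, ?_⟩
        rw [Real.closedBall_eq_Icc]
        exact ⟨ha.1.trans hs.1.le, hs.2.le.trans hb.2⟩)
    simp only [ha0, hb0, mul_zero] at this
    exact lt_irrefl _ this
  rw [Prod.mk.injEq]
  exact ⟨rfl, le_antisymm (not_lt.1 (key _ _ hy0' hy0 hy'.2 hy.2))
    (not_lt.1 (key _ _ hy0 hy0' hy.2 hy'.2))⟩

namespace FoldFamily

variable {J : Jet} {n : ℕ} {k p : ℕ → ℕ} {e t : ℕ → ℝ}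

/-- The zeros of `J.f` in the box are transversal to the vertical lines, except the folds. -/
theorem deriv_ne_zero_or_eq_fold (h : FoldFamily J n k p e t) {q : ℝ × ℝ}
    (hq : q ∈ boxSublevel J n) (h0 : J.f q.1 q.2 = 0) :
    J.fy q.1 q.2 ≠ 0 ∨ ∃ i < n, q = (t i, h.foldHeight i) := by
  by_cases hne : ∀ i < n, t i ≠ q.1
  · obtain ⟨z, hz⟩ := h.exists_alternates hq.1 hne
    exact Or.inl (hz.deriv_ne_zero hq.2.1 h0)
  push Not at hne
  obtain ⟨i, hi, hti⟩ := hne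
  obtain ⟨z, I, hI, hf, hz⟩ := h.exists_foldAt hi
  by_cases hy : q.2 = z (p i + 1)
  · exact Or.inr ⟨i, hi, Prod.ext hti.symm (hy.trans hz)⟩
  · rw [← hti] at h0 ⊢
    exact Or.inl (hf.deriv_ne_zero (mem_of_mem_nhds hI) hq.2.1 h0 hy)

theorem regular (h : FoldFamily J n k p e t) {q : ℝ × ℝ}
    (hq : q ∈ boxSublevel J n) (h0 : J.f q.1 q.2 = 0) :
    J.fx q.1 q.2 ≠ 0 ∨ J.fy q.1 q.2 ≠ 0 := by
  rcases h.deriv_ne_zero_or_eq_fold hq h0 with h1 | ⟨i, hi, rfl⟩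
  · exact Or.inr h1
  · obtain ⟨z, I, hI, hf, hz⟩ := h.exists_foldAt hi
    rw [← hz]
    exact Or.inl hf.fold_x

theorem mem_interior_box (h : FoldFamily J n k p e t) {q : ℝ × ℝ} (hq : q ∈ boxSublevel J n) :
    q ∈ Ioo (0 : ℝ) n ×ˢ Ioo (0 : ℝ) 1 := by
  obtain ⟨h1, h2, h3⟩ := hq
  have hx : ∀ x, x = 0 ∨ x = (n : ℝ) → q.1 ≠ x := fun x hx heq => by
    have := h.pos_end (x := q.1) (heq ▸ hx) q.2 h2
    linarith
  have hbt := h.pos_bottom_top h1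
  exact ⟨⟨lt_of_le_of_ne h1.1 (hx 0 (Or.inl rfl)).symm, lt_of_le_of_ne h1.2 (hx n (Or.inr rfl))⟩,
    lt_of_le_of_ne h2.1 fun heq => by rw [← heq] at h3; linarith [hbt.1],
    lt_of_le_of_ne h2.2 fun heq => by rw [heq] at h3; linarith [hbt.2]⟩

theorem isOpen_box : IsOpen (Ioo (0 : ℝ) n ×ˢ Ioo (0 : ℝ) 1) := isOpen_Ioo.prod isOpen_Ioo

theorem mem_iff_of_mem_box {q : ℝ × ℝ} (hq : q ∈ Ioo (0 : ℝ) n ×ˢ Ioo (0 : ℝ) 1) :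
    q ∈ boxSublevel J n ↔ J.f q.1 q.2 ≤ 0 :=
  ⟨fun h => h.2.2, fun h => ⟨Ioo_subset_Icc_self hq.1, Ioo_subset_Icc_self hq.2, h⟩⟩

theorem isSurfaceWithBoundary (h : FoldFamily J n k p e t) :
    IsSurfaceWithBoundary (boxSublevel J n) := by
  refine isSurfaceWithBoundary_of_local fun q hq => ?_
  have hbox := h.mem_interior_box hq
  rcases hq.2.2.lt_or_eq with hlt | h0
  · -- an interior point: translate the box into the half plane
    have hopen : IsOpen ((Ioo (0 : ℝ) n ×ˢ Ioo (0 : ℝ) 1) ∩ {q | J.f q.1 q.2 < 0}) :=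
      isOpen_box.inter (isOpen_lt J.continuous_f continuous_const)
    refine ⟨OpenPartialHomeomorph.ofSet _ hopen, ⟨hbox, hlt⟩, fun q' hq' => ?_⟩
    have hq' : q' ∈ Ioo (0 : ℝ) n ×ˢ Ioo (0 : ℝ) 1 ∧ J.f q'.1 q'.2 < 0 := hq'
    exact iff_of_true ((mem_iff_of_mem_box hq'.1).2 hq'.2.le) hq'.1.1.1.le
  · obtain ⟨Φ, hΦ, hf⟩ := J.exists_chart q (h.regular hq h0)
    refine ⟨Φ.restrOpen _ isOpen_box, ⟨hΦ, hbox⟩, fun q' hq' => ?_⟩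
    have hq' : q' ∈ Φ.source ∩ Ioo (0 : ℝ) n ×ˢ Ioo (0 : ℝ) 1 := by
      simpa using hq'
    rw [mem_iff_of_mem_box hq'.2]
    change _ ↔ 0 ≤ (Φ q').1
    rw [hf, Left.nonneg_neg_iff]

/-- As the zeros of `J.f` are regular, `J.f` changes sign at each of them. -/
theorem frontier_eq (h : FoldFamily J n k p e t) :
    frontier (boxSublevel J n) = {q | q ∈ boxSublevel J n ∧ J.f q.1 q.2 = 0} := by
  rw [(isCompact_boxSublevel J n).isClosed.frontier_eq]
  ext q
  constructor
  · rintro ⟨hq, hint⟩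
    refine ⟨hq, le_antisymm hq.2.2 (not_lt.1 fun hlt => hint ?_)⟩
    rw [mem_interior_iff_mem_nhds]
    filter_upwards [isOpen_box.mem_nhds (h.mem_interior_box hq),
      (isOpen_lt J.continuous_f continuous_const).mem_nhds hlt] with q' h1 h2
    have h2 : J.f q'.1 q'.2 < 0 := h2
    exact (mem_iff_of_mem_box h1).2 h2.le
  · rintro ⟨hq, h0⟩
    refine ⟨hq, fun hint => ?_⟩
    -- otherwise `q` would be a local maximum of `J.f`
    have hev : ∀ᶠ q' in 𝓝 q, J.f q'.1 q'.2 ≤ J.f q.1 q.2 := by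
      filter_upwards [mem_interior_iff_mem_nhds.1 hint] with q' hq'
      rw [h0]
      exact hq'.2.2
    have hx : J.fx q.1 q.2 = 0 := by
      refine IsLocalMax.hasDerivAt_eq_zero (f := fun s => J.f s q.2) ?_ (J.hasDerivAt_x q.1 q.2)
      have hc : ContinuousAt (fun s : ℝ => (s, q.2)) q.1 := by fun_prop
      exact hc.eventually hev
    have hy : J.fy q.1 q.2 = 0 := by
      refine IsLocalMax.hasDerivAt_eq_zero (f := J.f q.1) ?_ (J.hasDerivAt_y q.1 q.2)
      have hc : ContinuousAt (fun s : ℝ => (q.1, s)) q.2 := by fun_prop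
      exact hc.eventually hev
    rcases h.regular hq h0 with h1 | h1
    · exact h1 hx
    · exact h1 hy

/-- The topological critical points of the boundary are the folds: elsewhere it is transversal to
the vertical lines, and near a fold it meets some vertical lines twice. -/
theorem topCriticalSet_eq (h : FoldFamily J n k p e t) :
    topCriticalSet canonicalPlane (frontier (boxSublevel J n)) =
      {q | ∃ i < n, (t i, h.foldHeight i) = q} := by
  rw [h.frontier_eq]
  ext q
  constructor
  · rintro ⟨⟨hq, h0⟩, hcrit⟩
    rcases h.deriv_ne_zero_or_eq_fold hq h0 with h1 | ⟨i, hi, heq⟩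
    · refine absurd ?_ hcrit
      obtain ⟨U, hU, hUc, hinj⟩ := J.exists_isCompact_injOn q h1
      have hcomp : IsCompact (U ∩ {q | q ∈ boxSublevel J n ∧ J.f q.1 q.2 = 0}) := by
        have hcl : IsClosed {q | q ∈ boxSublevel J n ∧ J.f q.1 q.2 = 0} :=
          (isCompact_boxSublevel J n).isClosed.inter (isClosed_eq J.continuous_f continuous_const)
        exact hUc.inter_right hcl
      have := isCompact_iff_compactSpace.1 hcomp
      refine ⟨U, hU, (Continuous.isClosedEmbedding
        (continuous_fst.comp continuous_subtype_val) ?_).isEmbedding⟩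
      rintro ⟨a, ha⟩ ⟨b, hb⟩ hab
      exact Subtype.ext (hinj ⟨ha.1, ha.2.2⟩ ⟨hb.1, hb.2.2⟩ hab)
    · exact ⟨i, hi, heq.symm⟩
  · rintro ⟨i, hi, rfl⟩
    refine ⟨⟨h.fold_mem hi, (h.foldHeight_mem hi).2⟩, ?_⟩
    rintro ⟨U, hU, hemb⟩
    obtain ⟨z, I, hI, hf, hz⟩ := h.exists_foldAt hi
    rw [← hz] at hU
    have hp := hf.le
    obtain ⟨x, y, y', hne, hy, hy', ⟨hxI, hxn⟩, hyI, hyI', h0, h0'⟩ :=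
      (hf.mono (inter_subset_left (t := Ioo (0 : ℝ) n))).not_injOn (h.sign_eq hi)
        (Filter.inter_mem hI (isOpen_Ioo.mem_nhds (h.t_mem hi))) hU
    have hsub : Icc (z (p i)) (z (p i + 2)) ⊆ Icc (0 : ℝ) 1 :=
      separators_Icc_subset (m := 2 * min (k i) (k (i + 1)) + 2) hf.nonneg hf.last hf.lt
        (by omega) (by omega)
    have hmem : ∀ y, y ∈ Icc (z (p i)) (z (p i + 2)) → J.f x y = 0 →
        (x, y) ∈ boxSublevel J n := fun y hy h0 =>
      ⟨Ioo_subset_Icc_self hxn, hsub hy, h0.le⟩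
    have := hemb.injective (a₁ := ⟨(x, y), hy, hmem y hyI h0, h0⟩)
      (a₂ := ⟨(x, y'), hy', hmem y' hyI' h0', h0'⟩) rfl
    exact hne (congrArg (fun w => w.1.2) this)

theorem isDomainOfFiniteType (h : FoldFamily J n k p e t) :
    IsDomainOfFiniteType canonicalPlane (boxSublevel J n) where
  isClosed := (isCompact_boxSublevel J n).isClosed
  isSurface := h.isSurfaceWithBoundary
  boundary_nonempty := by
    rw [h.frontier_eq]
    exact ⟨_, h.fold_mem h.pos, (h.foldHeight_mem h.pos).2⟩
  proper := by
    have := isCompact_iff_compactSpace.1 (isCompact_boxSublevel J n)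
    exact (continuous_fst.comp continuous_subtype_val).isProperMap
  finite_critical := by
    rw [h.topCriticalSet_eq]
    exact ((Finset.range n).finite_toSet.image fun i => (t i, h.foldHeight i)).subset
      fun q ⟨i, hi, hq⟩ => ⟨i, by simpa using hi, hq⟩

/-- The boundary consists of finitely many components of the algebraic curve. -/
theorem isAlgebraicDomain (h : FoldFamily J n k p e t) {f : MvPolynomial (Fin 2) ℝ}
    (hf : ∀ x y, J.f x y = MvPolynomial.eval ![x, y] f ∧
      J.fx x y = MvPolynomial.eval ![x, y] (MvPolynomial.pderiv 0 f) ∧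
      J.fy x y = MvPolynomial.eval ![x, y] (MvPolynomial.pderiv 1 f)) :
    IsAlgebraicDomain (boxSublevel J n) where
  isClosed := (isCompact_boxSublevel J n).isClosed
  isSurface := h.isSurfaceWithBoundary
  boundary := by
    have hZ : ∀ q : ℝ × ℝ, q ∈ polyZeros f ↔ J.f q.1 q.2 = 0 := fun q => by
      rw [(hf q.1 q.2).1]; rfl
    have hf0 : f ≠ 0 := by
      rintro rfl
      have := (h.pos_bottom_top (x := 0) ⟨le_rfl, Nat.cast_nonneg n⟩).1
      rw [(hf 0 0).1, map_zero] at this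
      exact lt_irrefl _ this
    rw [h.frontier_eq]
    set C := {q | q ∈ boxSublevel J n ∧ J.f q.1 q.2 = 0} with hC
    have hCcomp : IsCompact C := (isCompact_boxSublevel J n).inter_right
      (isClosed_eq J.continuous_f continuous_const)
    -- a component of the curve that meets the box does not leave it
    have hsub : ∀ q ∈ C, connectedComponentIn (polyZeros f) q ⊆ C := by
      intro q hq
      have hclosed : IsClosed (Icc (0 : ℝ) n ×ˢ Icc (0 : ℝ) 1) := isClosed_Icc.prod isClosed_Icc
      have hbox : connectedComponentIn (polyZeros f) q ⊆ Ioo (0 : ℝ) n ×ˢ Ioo (0 : ℝ) 1 := by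
        refine IsPreconnected.subset_left_of_subset_union isOpen_box hclosed.isOpen_compl ?_ ?_
          ⟨q, mem_connectedComponentIn ((hZ q).2 hq.2), h.mem_interior_box hq.1⟩
          isPreconnected_connectedComponentIn
        · rw [disjoint_compl_right_iff_subset]
          exact prod_mono Ioo_subset_Icc_self Ioo_subset_Icc_self
        · intro q' hq'
          have h0 := (hZ q').1 (connectedComponentIn_subset _ _ hq')
          by_cases hmem : q' ∈ Icc (0 : ℝ) n ×ˢ Icc (0 : ℝ) 1
          · exact Or.inl (h.mem_interior_box ⟨hmem.1, hmem.2, h0.le⟩)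
          · exact Or.inr hmem
      intro q' hq'
      have h0 := (hZ q').1 (connectedComponentIn_subset _ _ hq')
      exact ⟨(mem_iff_of_mem_box (hbox hq')).2 h0.le, h0⟩
    -- locally, the curve is connected
    have hlocal : ∀ q ∈ C, ∃ s ∈ 𝓝[C] q, s ⊆ connectedComponentIn (polyZeros f) q := by
      intro q hq
      obtain ⟨Φ, hΦ, hΦf⟩ := J.exists_chart q (h.regular hq.1 hq.2)
      have htarget : Φ.target ∈ 𝓝 (Φ q) := Φ.open_target.mem_nhds (Φ.map_source hΦ)
      obtain ⟨r, hr, hball⟩ := Metric.mem_nhds_iff.1 htarget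
      have hseg : IsPreconnected (({0} : Set ℝ) ×ˢ Metric.ball (Φ q).2 r) :=
        isPreconnected_singleton.prod (convex_ball _ _).isPreconnected
      have hq1 : (Φ q).1 = 0 := by rw [hΦf, hq.2, neg_zero]
      have hsegt : ({0} : Set ℝ) ×ˢ Metric.ball (Φ q).2 r ⊆ Φ.target := by
        refine subset_trans ?_ hball
        rw [← ball_prod_same]
        refine prod_mono ?_ subset_rfl
        rw [singleton_subset_iff, hq1]
        exact Metric.mem_ball_self hr
      have himg : IsPreconnected (Φ.symm '' (({0} : Set ℝ) ×ˢ Metric.ball (Φ q).2 r)) :=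
        hseg.image _ (Φ.symm.continuousOn.mono hsegt)
      have hmemimg : ∀ q' ∈ Φ.source, J.f q'.1 q'.2 = 0 → (Φ q').2 ∈ Metric.ball (Φ q).2 r →
          q' ∈ Φ.symm '' (({0} : Set ℝ) ×ˢ Metric.ball (Φ q).2 r) := by
        intro q' hq' h0 hb
        exact ⟨Φ q', ⟨by rw [mem_singleton_iff, hΦf, h0, neg_zero], hb⟩, Φ.left_inv hq'⟩
      have hZimg : Φ.symm '' (({0} : Set ℝ) ×ˢ Metric.ball (Φ q).2 r) ⊆ polyZeros f := by
        rintro _ ⟨w, hw, rfl⟩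
        rw [hZ, ← neg_eq_zero, ← hΦf, Φ.right_inv (hsegt hw)]
        exact hw.1
      have hcomp := himg.subset_connectedComponentIn
        (hmemimg q hΦ hq.2 (Metric.mem_ball_self hr)) hZimg
      refine ⟨_, ?_, hcomp⟩
      have hc : ContinuousAt (fun q' => (Φ q').2) q :=
        continuousAt_snd.comp (Φ.continuousAt hΦ)
      filter_upwards [self_mem_nhdsWithin, mem_nhdsWithin_of_mem_nhds (Φ.open_source.mem_nhds hΦ),
        mem_nhdsWithin_of_mem_nhds (hc (Metric.ball_mem_nhds _ hr))] with q' h1 h2 h3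
      exact hmemimg q' h2 h1.2 h3
    refine ⟨(fun q => connectedComponentIn (polyZeros f) q) '' C, ?_, ?_, ?_, ?_⟩
    · refine hCcomp.induction_on
        (p := fun s => ((fun q => connectedComponentIn (polyZeros f) q) '' s).Finite)
        (by simp) (fun s s' hss hs' => hs'.subset (image_mono hss))
        (fun s s' hs hs' => by rw [image_union]; exact hs.union hs') fun q hq => ?_
      obtain ⟨s, hs, hsq⟩ := hlocal q hq
      refine ⟨s, hs, (finite_singleton (connectedComponentIn (polyZeros f) q)).subset ?_⟩
      rintro _ ⟨q', hq', rfl⟩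
      exact (connectedComponentIn_eq (hsq hq')).symm
    · rintro _ ⟨q, -, rfl⟩ _ ⟨q', -, rfl⟩ hne
      rw [Function.onFun, id, id, Set.disjoint_left]
      intro w hw hw'
      exact hne ((connectedComponentIn_eq hw).trans (connectedComponentIn_eq hw').symm)
    · rintro _ ⟨q, hq, rfl⟩
      refine ⟨f, hf0, ⟨q, (hZ q).2 hq.2, rfl⟩, fun q' hq' => ?_⟩
      have hq'C := hsub q hq hq'
      rw [← (hf q'.1 q'.2).2.1, ← (hf q'.1 q'.2).2.2]
      exact h.regular hq'C.1 hq'C.2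
    · refine Subset.antisymm (fun q hq => ?_) (sUnion_subset ?_)
      · exact mem_sUnion_of_mem (mem_connectedComponentIn ((hZ q).2 hq.2)) ⟨q, hq, rfl⟩
      · rintro _ ⟨q, hq, rfl⟩
        exact hsub q hq

end FoldFamily

/-! ### Realization of a graph -/

theorem HasPattern.pos_of_nonempty {A : Set (ℝ × ℝ)} {n : ℕ} {k p : ℕ → ℕ} {e v c : ℕ → ℝ}
    (h : HasPattern A n k p e v c) (hval : ValidPattern n k p e) (hne : A.Nonempty) : 0 < n := by
  rw [Nat.pos_iff_ne_zero]
  rintro rfl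
  obtain ⟨⟨x, y⟩, hxy⟩ := hne
  obtain ⟨q, hq⟩ := h.regular x fun i hi => absurd hi (Nat.not_lt_zero i)
  obtain ⟨-, -, hA⟩ := hq.self_of_nhds
  obtain ⟨i, hi, -⟩ := (hA y).1 hxy
  rw [countBelow_eq le_rfl fun j hj => absurd hj (Nat.not_lt_zero j), hval.start] at hi
  exact Nat.not_lt_zero i hi

/-- Every compact connected generic transversal graph in a vertical plane is vertically equivalent
(as a subset, and with its vertices) to the Poincaré–Reeb graph of a connected algebraic domain of
finite type in `(ℝ², x)`. -/
theorem mainTheorem1 {P : Type*} [TopologicalSpace P] (V : VerticalSpace P)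
    (hV : IsVerticalPlane V) (G : TransversalGraph V) (hcompact : IsCompact G.carrier)
    (hconn : IsConnected G.carrier) (hgen : G.IsGeneric) (htwo : G.IsTwoSided) :
    ∃ D : Set (ℝ × ℝ), IsAlgebraicDomain D ∧ IsDomainOfFiniteType canonicalPlane D ∧
      IsConnected D ∧ IsVerticalPlane (collapsePlane canonicalPlane D) ∧
      ∃ e : VerticalEquiv V (collapsePlane canonicalPlane D),
        e.Φ '' G.carrier = poincareReebSet canonicalPlane D ∧
        e.Φ '' G.vertices = poincareReebVertices canonicalPlane D := by
  obtain ⟨K, hK, hKb⟩ := hV.exists_global_chart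
  obtain ⟨_, _, ⟨S⟩⟩ := G.exists_edgeSystem hcompact hconn.nonempty hgen htwo K hK
  obtain ⟨n, k, p, e, v, c, hval, hpat, hW⟩ := S.exists_hasPattern
  have hn := hpat.pos_of_nonempty hval (hconn.nonempty.image K)
  obtain ⟨f, J, t, hf, hslab⟩ := hval.exists_mvPolynomial
  have F : FoldFamily J n k p e t := ⟨hn, hval, hslab⟩
  have hpat' := F.hasPattern
  have hne := F.nonempty
  have hDc := isCompact_boxSublevel J n
  set D := boxSublevel J n
  obtain ⟨ψ, M, hψ, hMψ, hMlt, hMA, hMc⟩ := hpat'.exists_homeomorph hpat hval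
  obtain ⟨L, hLmap, hLproj, hLbelow⟩ := exists_collapse_homeomorph hDc hne
  have hflat : flatten D '' D = M.symm '' (K '' G.carrier) := by
    rw [← hMA, image_image]; simp
  have hLimage : ∀ X : Set (ℝ × ℝ), L.symm '' (flatten D '' X) = collapseMap canonicalPlane D '' X :=
    fun X => by
      rw [image_image]
      exact image_congr fun q _ => by rw [← hLmap, L.symm_apply_apply]
  have hψsymm : ∀ z, (M.symm z).1 = ψ.symm z.1 := fun z => by
    rw [← ψ.symm_apply_apply (M.symm z).1, ← hMψ, M.apply_symm_apply]
  have hproj : ∀ q, (collapsePlane canonicalPlane D).proj (L.symm (M.symm (K q))) =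
      ψ.symm (V.proj q) := fun q => by
    rw [← hLproj, L.apply_symm_apply, hψsymm, hK]
  refine ⟨D, F.isAlgebraicDomain hf, F.isDomainOfFiniteType, ?_,
    isVerticalPlane_of_homeomorph L hLproj hLbelow,
    { Φ := K.trans (M.symm.trans L.symm)
      ψ := ψ.symm
      strictMono_ψ := fun x y hxy => ?_
      comm := hproj
      below_iff := fun q q' => ?_ }, ?_, ?_⟩
  · refine isConnected_of_flatten_image hDc ?_
    rw [hflat]
    exact (hconn.image K K.continuous.continuousOn).image M.symm M.symm.continuous.continuousOn
  · rwa [← hψ.lt_iff_lt, ψ.apply_symm_apply, ψ.apply_symm_apply]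
  · rw [hLbelow, hKb]
    simp only [Homeomorph.trans_apply, hproj, L.apply_symm_apply, ψ.symm.injective.eq_iff]
    refine and_congr_right fun hqq => ?_
    have h1 := hMlt (M.symm (K q)) (M.symm (K q')) (by rw [hψsymm, hψsymm, hK, hK, hqq])
    rwa [M.apply_symm_apply, M.apply_symm_apply] at h1
  · rw [poincareReebSet, ← hLimage, hflat, image_image, image_image]
    rfl
  · rw [poincareReebVertices, F.topCriticalSet_eq, ← hLimage]
    have hverts : flatten D '' {q | ∃ i < n, (t i, F.foldHeight i) = q} =
        M.symm '' (K '' G.vertices) := by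
      rw [hW]
      ext w
      constructor
      · rintro ⟨_, ⟨i, hi, rfl⟩, rfl⟩
        exact ⟨_, ⟨i, hi, rfl⟩, by rw [← hMc i hi, M.symm_apply_apply]; rfl⟩
      · rintro ⟨_, ⟨i, hi, rfl⟩, rfl⟩
        exact ⟨_, ⟨i, hi, rfl⟩, by rw [← hMc i hi, M.symm_apply_apply]; rfl⟩
    rw [hverts, image_image, image_image]
    rfl
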